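/- Let $n\ge 2$ and let $Sp(2n,\mathbb R)$ be the group of real $2n\times 2n$ matrices preserving the standard symplectic form $Q(e_i,e_{i+n})=1=-Q(e_{i+n},e_i)$ (all other values being $0$). Let $\Phi=\{\pm L_i\pm L_j : 1\le i,j\le n\}\setminus\{0\}$ be the root system of type $C_n$. With $e_{k,\ell}$ the matrix units, put $f_{L_i+L_j}=e_{i,j+n}+e_{j,i+n}$ and $f_{-L_i-L_j}=e_{j+n,i}+e_{i+n,j}$ $(i<j)$, $f_{L_i-L_j}=e_{i,j}-e_{j+n,i+n}$ $(i\ne j)$, $f_{2L_i}=e_{i,i+n}$, $f_{-2L_i}=e_{i+n,i}$, and $x_r(t)=\exp(tf_r)\in Sp(2n,\mathbb R)$ for $r\in\Phi$, $t\in\mathbb R$. Write $[x,y]=xyx^{-1}y^{-1}$, and in any group containing elements $x_r(t)$ put $w_r(t)=x_r(t)\,x_{-r}(-t^{-1})\,x_r(t)$ and $h_r(t)=w_r(t)\,w_r(-1)$ for $t\in\mathbb R^*$. There are real constants $g_{ijrp}$ such that in $Sp(2n,\mathbb R)$ one has $[x_r(a),x_p(b)]=\prod_{i,j>0,\ ir+jp\in\Phi}x_{ir+jp}(g_{ijrp}a^ib^j)$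 for all $r,p\in\Phi$ with $r+p\ne 0$ and all $a,b\in\mathbb R$. For any such constants the following hold. (A) $Sp(2n,\mathbb R)$ is presented by the generators $x_r(a)$ ($r\in\Phi$, $a\in\mathbb R$) subject to the relations, for $r,p\in\Phi$ and $a,b\in\mathbb R^*$: 1. $x_r(a)x_r(b)=x_r(a+b)$; 2. $[x_r(a),x_p(b)]=\prod_{i,j>0,\ ir+jp\in\Phi}x_{ir+jp}(g_{ijrp}a^ib^j)$ if $r+p\ne0$; 3. $[x_r(a),x_p(b)]=1$ if $0\ne r+p\notin\Phi$; 4. $h_{L_1-L_2}(a)\,h_{L_1-L_2}(b)=h_{L_1-L_2}(ab)$; 5. $h_{2L_n}(-1)\,h_{2L_n}(-1)=1$. (B) Let $\widetilde G$ be the group presented by the generators $\tilde x_r(a)$ subject to the relations 1, 2 and 3 only, let $\pi_1:\widetilde G\to Sp(2n,\mathbb R)$ be the homomorphism with $\pi_1(\tilde x_r(a))=x_r(a)$, and let $\tilde h_r(t)$ be the elements $h_r(t)$ formed in $\widetilde G$. Let $\widetilde H_{L_1-L_2}$ be the subgroup of $\widetilde G$ generated by all $\tilde h_{L_1-L_2}(t)$,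 $t\in\mathbb R^*$, and $\widetilde H_0$ the cyclic subgroup generated by $\tilde h_{2L_n}(-1)^2$. Then $$\ker\pi_1=\bigl(\ker\pi_1\cap\widetilde H_{L_1-L_2}\bigr)\cdot\widetilde H_0,$$ and $\ker\pi_1\cap\widetilde H_{L_1-L_2}$ is generated by the symbols $\{s,t\}=\tilde h_{L_1-L_2}(s)\,\tilde h_{L_1-L_2}(t)\,\tilde h_{L_1-L_2}(st)^{-1}$, $s,t\in\mathbb R^*$. -/

import Mathlib

open scoped Pointwise commutatorElement

namespace SpPresentation

/-- The root system of type `C_n`: the nonzero vectors `± L_i ± L_j`, `1 ≤ i, j ≤ n`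
(the index set `{1, …, n}` is `Fin n`). -/
inductive Root (n : ℕ) : Type
  /-- the root `L_i + L_j`, `i < j` -/
  | add (i j : Fin n) (h : i < j) : Root n
  /-- the root `L_i - L_j`, `i ≠ j` -/
  | sub (i j : Fin n) (h : i ≠ j) : Root n
  /-- the root `- L_i - L_j`, `i < j` -/
  | negAdd (i j : Fin n) (h : i < j) : Root n
  /-- the root `2 L_i` -/
  | long (i : Fin n) : Root n
  /-- the root `- 2 L_i` -/
  | negLong (i : Fin n) : Root n

namespace Root

variable {n : ℕ}

/-- The coordinates of a root in the basis `L_1, …, L_n`. -/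
def vec : Root n → Fin n → ℤ
  | add i j _ => Pi.single i 1 + Pi.single j 1
  | sub i j _ => Pi.single i 1 - Pi.single j 1
  | negAdd i j _ => -Pi.single i 1 - Pi.single j 1
  | long i => Pi.single i 2
  | negLong i => -Pi.single i 2

/-- The opposite root `-r`. -/
def neg : Root n → Root n
  | add i j h => negAdd i j h
  | sub i j h => sub j i h.symm
  | negAdd i j h => add i j h
  | long i => negLong i
  | negLong i => long i

theorem vec_neg (r : Root n) : r.neg.vec = -r.vec := by
  cases r <;> simp [neg, vec] <;> abel

/-- The root vector `f_r`. The matrix index `k ≤ n` is `Sum.inl k`, the index `k + n` is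
`Sum.inr k`, so that `Matrix.single (.inl i) (.inr j) 1` is the matrix unit `e_{i,j+n}`. -/
def mat : Root n → Matrix (Fin n ⊕ Fin n) (Fin n ⊕ Fin n) ℝ
  | add i j _ => Matrix.single (.inl i) (.inr j) 1 + Matrix.single (.inl j) (.inr i) 1
  | sub i j _ => Matrix.single (.inl i) (.inl j) 1 - Matrix.single (.inr j) (.inr i) 1
  | negAdd i j _ => Matrix.single (.inr j) (.inl i) 1 + Matrix.single (.inr i) (.inl j) 1
  | long i => Matrix.single (.inl i) (.inr i) 1
  | negLong i => Matrix.single (.inr i) (.inl i) 1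

/-- The root vectors lie in the symplectic Lie algebra. -/
theorem mat_mul_J (r : Root n) :
    r.mat * Matrix.J (Fin n) ℝ = -(Matrix.J (Fin n) ℝ * r.mat.transpose) := by
  have e11 (i j : Fin n) : Matrix.single (Sum.inl i : Fin n ⊕ Fin n) (Sum.inl j : Fin n ⊕ Fin n)
      (1 : ℝ) = Matrix.fromBlocks (Matrix.single i j 1) 0 0 0 := by
    ext (a | a) (b | b) <;> simp [Matrix.single]
  have e12 (i j : Fin n) : Matrix.single (Sum.inl i : Fin n ⊕ Fin n) (Sum.inr j : Fin n ⊕ Fin n)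
      (1 : ℝ) = Matrix.fromBlocks 0 (Matrix.single i j 1) 0 0 := by
    ext (a | a) (b | b) <;> simp [Matrix.single]
  have e21 (i j : Fin n) : Matrix.single (Sum.inr i : Fin n ⊕ Fin n) (Sum.inl j : Fin n ⊕ Fin n)
      (1 : ℝ) = Matrix.fromBlocks 0 0 (Matrix.single i j 1) 0 := by
    ext (a | a) (b | b) <;> simp [Matrix.single]
  have e22 (i j : Fin n) : Matrix.single (Sum.inr i : Fin n ⊕ Fin n) (Sum.inr j : Fin n ⊕ Fin n)
      (1 : ℝ) = Matrix.fromBlocks 0 0 0 (Matrix.single i j 1) := by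
    ext (a | a) (b | b) <;> simp [Matrix.single]
  cases r <;>
    simp [mat, e11, e12, e21, e22, Matrix.J, Matrix.fromBlocks_multiply,
      Matrix.fromBlocks_transpose, Matrix.fromBlocks_add, Matrix.fromBlocks_neg,
      sub_eq_add_neg, Matrix.transpose_add, Matrix.transpose_neg, add_comm]

end Root

/-- The symplectic group `Sp(2n, ℝ)`. -/
abbrev Sp (n : ℕ) : Type := Matrix.symplecticGroup (Fin n) ℝ

theorem exp_mem_symplecticGroup {n : ℕ} (r : Root n) (t : ℝ) :
    NormedSpace.exp (t • r.mat) ∈ Matrix.symplecticGroup (Fin n) ℝ := by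
  set J := Matrix.J (Fin n) ℝ with hJ
  have hu : IsUnit J := (Matrix.isUnit_iff_isUnit_det J).2 (Matrix.isUnit_det_J (Fin n) ℝ)
  have hdet : IsUnit J.det := Matrix.isUnit_det_J (Fin n) ℝ
  have hc : Commute (t • r.mat) (-(t • r.mat)) := by
    rw [commute_iff_eq, Matrix.mul_neg, Matrix.neg_mul]
  have h1 : (t • r.mat).transpose = J⁻¹ * (-(t • r.mat)) * J := by
    rw [Matrix.mul_assoc, Matrix.neg_mul, Matrix.smul_mul, r.mat_mul_J, ← hJ, smul_neg, neg_neg,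
      Matrix.mul_smul, Matrix.nonsing_inv_mul_cancel_left _ _ hdet, Matrix.transpose_smul]
  rw [SymplecticGroup.mem_iff, ← Matrix.exp_transpose, h1, Matrix.exp_conj' _ _ hu, ← hJ,
    Matrix.mul_assoc, Matrix.mul_assoc J⁻¹, Matrix.mul_nonsing_inv_cancel_left _ _ hdet,
    ← Matrix.mul_assoc, ← Matrix.exp_add_of_commute _ _ hc]
  simp

/-- The one-parameter root subgroup `x_r(t) = exp (t f_r)` of `Sp(2n, ℝ)`. -/
noncomputable def spX {n : ℕ} (r : Root n) (t : ℝ) : Sp n :=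
  ⟨NormedSpace.exp (t • r.mat), exp_mem_symplecticGroup r t⟩

section Words

/-! Words in a family `x r t` of elements of a group, indexed by roots and real numbers. -/

variable {n : ℕ} {G : Type*} [Group G] (x : Root n → ℝ → G)

/-- `w_r(t) = x_r(t) x_{-r}(-t⁻¹) x_r(t)`. -/
noncomputable def wElt (r : Root n) (t : ℝ) : G := x r t * x r.neg (-t⁻¹) * x r t

/-- `h_r(t) = w_r(t) w_r(-1)`, that is,
`x_r(t) x_{-r}(-t⁻¹) x_r(t) x_r(-1) x_{-r}(1) x_r(-1)`. -/
noncomputable def hElt (r : Root n) (t : ℝ) : G := wElt x r t * wElt x r (-1)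

open Classical in
/-- The factor `x_{ir+jp}(s)`, to be read as `1` if `ir + jp` is not a root. -/
noncomputable def factor (r p : Root n) (i j : ℕ) (s : ℝ) : G :=
  if H : ∃ q : Root n, q.vec = (i : ℤ) • r.vec + (j : ℤ) • p.vec then x H.choose s else 1

/-- The product of the `x_{ir+jp}(c_{ijrp} a^i b^j)` over all `i, j > 0` for which `ir + jp` is a
root. In type `C_n`, and for `r + p ≠ 0`, this forces `(i, j)` to be `(1, 1)`, `(2, 1)` or
`(1, 2)`. -/
noncomputable def chevalleyProd (c : ℕ → ℕ → Root n → Root n → ℝ) (r p : Root n) (a b : ℝ) : G :=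
  (([(1, 1), (2, 1), (1, 2)] : List (ℕ × ℕ)).map fun ij =>
    factor x r p ij.1 ij.2 (c ij.1 ij.2 r p * a ^ ij.1 * b ^ ij.2)).prod

end Words

/-- `c` is a system of structure constants of `Sp(2n, ℝ)`: the Chevalley commutator formula
`[x_r(a), x_p(b)] = ∏ x_{ir+jp}(c_{ijrp} a^i b^j)` holds in `Sp(2n, ℝ)` whenever `r + p ≠ 0`. -/
def IsStructureConstants (n : ℕ) (c : ℕ → ℕ → Root n → Root n → ℝ) : Prop :=
  ∀ r p : Root n, r.vec + p.vec ≠ 0 → ∀ a b : ℝ,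
    ⁅(spX r a : Sp n), spX p b⁆ = chevalleyProd spX c r p a b

/-- The free generator `x_r(t)`. -/
def freeX {n : ℕ} (r : Root n) (t : ℝ) : FreeGroup (Root n × ℝ) := FreeGroup.of (r, t)

/-- Relators of the group `G̃`: additivity and the Chevalley commutator relations. -/
inductive BasicRelator {n : ℕ} (c : ℕ → ℕ → Root n → Root n → ℝ) : FreeGroup (Root n × ℝ) → Prop
  | additive (r : Root n) (a b : ℝ) (ha : a ≠ 0) (hb : b ≠ 0) :
      BasicRelator c (freeX r a * freeX r b * (freeX r (a + b))⁻¹)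
  | commutator (r p : Root n) (hrp : r.vec + p.vec ≠ 0) (a b : ℝ) (ha : a ≠ 0) (hb : b ≠ 0) :
      BasicRelator c (⁅freeX r a, freeX p b⁆ * (chevalleyProd freeX c r p a b)⁻¹)
  | commute (r p : Root n) (hrp : r.vec + p.vec ≠ 0)
      (hroot : ¬ ∃ q : Root n, q.vec = r.vec + p.vec) (a b : ℝ) (ha : a ≠ 0) (hb : b ≠ 0) :
      BasicRelator c ⁅freeX r a, freeX p b⁆

/-- The relators of `G̃`. -/
def basicRels {n : ℕ} (c : ℕ → ℕ → Root n → Root n → ℝ) : Set (FreeGroup (Root n × ℝ)) :=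
  {g | BasicRelator c g}

/-- The root `L_1 - L_2`. -/
def shortRoot {n : ℕ} (hn : 2 ≤ n) : Root n :=
  .sub ⟨0, by omega⟩ ⟨1, by omega⟩ (by simp)

/-- The root `2 L_n`. -/
def longRoot {n : ℕ} (hn : 2 ≤ n) : Root n := .long ⟨n - 1, by omega⟩

/-- All relators: the basic ones, the multiplicativity of `h_{L_1-L_2}`,
and `h_{2L_n}(-1) h_{2L_n}(-1) = 1`. -/
def allRels {n : ℕ} (hn : 2 ≤ n) (c : ℕ → ℕ → Root n → Root n → ℝ) :
    Set (FreeGroup (Root n × ℝ)) :=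
  basicRels c
    ∪ {g | ∃ a b : ℝ, a ≠ 0 ∧ b ≠ 0 ∧
        g = hElt freeX (shortRoot hn) a * hElt freeX (shortRoot hn) b
          * (hElt freeX (shortRoot hn) (a * b))⁻¹}
    ∪ {hElt freeX (longRoot hn) (-1) * hElt freeX (longRoot hn) (-1)}

/-- The group `G̃` presented by the basic relations only. -/
abbrev GTilde {n : ℕ} (c : ℕ → ℕ → Root n → Root n → ℝ) : Type := PresentedGroup (basicRels c)

/-- The element `x̃_r(t)` of `G̃`. -/
def tildeX {n : ℕ} (c : ℕ → ℕ → Root n → Root n → ℝ) (r : Root n) (t : ℝ) : GTilde c :=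
  PresentedGroup.of (r, t)

/-- The subgroup `H̃_r` of `G̃` generated by the `h̃_r(t)`, `t ≠ 0`. -/
def HTilde {n : ℕ} (c : ℕ → ℕ → Root n → Root n → ℝ) (r : Root n) : Subgroup (GTilde c) :=
  Subgroup.closure {g | ∃ t : ℝ, t ≠ 0 ∧ g = hElt (tildeX c) r t}

/-- The cyclic subgroup `H̃_0` of `G̃` generated by `h̃_{2L_n}(-1) h̃_{2L_n}(-1)`. -/
noncomputable def HTilde0 {n : ℕ} (hn : 2 ≤ n) (c : ℕ → ℕ → Root n → Root n → ℝ) : Subgroup (GTilde c) :=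
  Subgroup.zpowers (hElt (tildeX c) (longRoot hn) (-1) * hElt (tildeX c) (longRoot hn) (-1))

/-- The symbol `{s, t} = h̃_{L_1-L_2}(s) h̃_{L_1-L_2}(t) h̃_{L_1-L_2}(st)⁻¹` in `G̃`. -/
noncomputable def symbol {n : ℕ} (hn : 2 ≤ n) (c : ℕ → ℕ → Root n → Root n → ℝ) (s t : ℝ) :
    GTilde c :=
  hElt (tildeX c) (shortRoot hn) s * hElt (tildeX c) (shortRoot hn) t
    * (hElt (tildeX c) (shortRoot hn) (s * t))⁻¹

end SpPresentation

/-! The argument works in any `Realization`: a group `G` over `Sp n`, generated by additive root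
elements whose commutators lie in the subgroups spanned by the expected roots. The fully presented
group, `GTilde` and its quotients by normal subgroups of the kernel are all realizations, so both
halves of the theorem follow from statements about one `R`.

Unipotent identities lift. On the group spanned by the roots that are positive for some functional,
`π` is injective (`eq_one_of_mem_span`), because the coordinates of an element can be read off its
matrix one root at a time. Hence `w_r(s)` acts on root elements in `G` as it does in `Sp n`. For `p
≠ ±r` a functional vanishing on `r` and positive on `p` shows this; for `p = ±r`, rank at least two
lets `x_p` be written through other roots (`exists_word`, `w_conj_x_lift`). It follows that `h_r(s)`
acts through a character, and that an element of `H` in the kernel is central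
(`mem_center_of_mem_H`).

If every `h_r` is multiplicative, `π` is injective (`π_injective_of_mult`). The Bruhat decomposition
`G = U N U` (`mem_UNU`) reduces the kernel to `N`. The reflection relations in `N / H`, through
Schreier's lemma, reduce it to `H` (`mem_H_of_mem_N`). Finally `H` is an image of the split torus,
on which `π` is injective (`eq_one_of_mem_H`).

Two relations give all multiplicativity (`mult_of_generators`). The Weyl group spreads it over the
short roots. For a long root, conjugation by short `h`'s gives multiplicativity up to squares; over
the reals only the sign `-1` is left, and `h(-1)² = 1` settles it (`Mult.of_short_of_sq`).

This gives (A), as `Sp n` is generated by root elements (`elemSubgroup_eq_top`). For (B), the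
symbols and `h(-1)²` generate a central subgroup of the kernel. Modulo it all `h_r` are
multiplicative, so it is the whole kernel (`ker_eq`). -/

namespace SpPresentation

/-! ### Weights of matrix indices -/

section Weights

variable {n : ℕ}

/-- The weight of a matrix index: `L_i` for `.inl i`, and `-L_i` for `.inr i`. -/
def wt : Fin n ⊕ Fin n → Fin n → ℤ
  | .inl i => Pi.single i 1
  | .inr i => -Pi.single i 1

@[simp] theorem wt_swap (a : Fin n ⊕ Fin n) : wt a.swap = -wt a := by
  cases a <;> simp [wt]

theorem swap_ne_self (a : Fin n ⊕ Fin n) : a.swap ≠ a := by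
  cases a <;> simp

theorem wt_dot (a b : Fin n ⊕ Fin n) :
    wt a ⬝ᵥ wt b = if a = b then 1 else if a = b.swap then -1 else 0 := by
  cases a <;> cases b <;> simp [wt, Pi.single_apply, eq_comm, apply_ite]

theorem wt_dot_self (a : Fin n ⊕ Fin n) : wt a ⬝ᵥ wt a = 1 := by simp [wt_dot]

theorem wt_injective : Function.Injective (wt : Fin n ⊕ Fin n → Fin n → ℤ) := by
  intro a b h
  have h1 := wt_dot a b
  rw [h, wt_dot_self] at h1
  split_ifs at h1 <;> first | assumption | omega

/-- The vectors `± L_i` are pairwise orthogonal, equal or opposite. Pairing the equation with `wt a`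
makes the left side at least 1, so `a` must reappear on the right. -/
theorem wt_add_eq {a b c d : Fin n ⊕ Fin n} (h : wt a + wt b = wt c + wt d) (hab : a ≠ b.swap) :
    (a = c ∧ b = d) ∨ (a = d ∧ b = c) := by
  have h1 : wt a ⬝ᵥ (wt a + wt b) = wt a ⬝ᵥ (wt c + wt d) := by rw [h]
  simp only [dotProduct_add, wt_dot] at h1
  have h2 : a = c ∨ a = d := by
    split_ifs at h1 <;> first | omega | simp_all
  rcases h2 with rfl | rfl
  · exact Or.inl ⟨rfl, wt_injective (add_left_cancel h)⟩
  · exact Or.inr ⟨rfl, wt_injective (add_left_cancel (h.trans (add_comm _ _)))⟩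

/-- A root determines its pair of indices up to `(a, b) ↦ (b.swap, a.swap)`. These are the positions
of the entries of `f_r`; they coincide for long roots. -/
theorem wt_sub_eq {a b c d : Fin n ⊕ Fin n} (h : wt a - wt b = wt c - wt d) (hab : a ≠ b) :
    (a = c ∧ b = d) ∨ (a = d.swap ∧ b = c.swap) := by
  have h' : wt a + wt b.swap = wt c + wt d.swap := by
    simpa [sub_eq_add_neg] using h
  rcases wt_add_eq h' (by simpa using hab) with ⟨h1, h2⟩ | ⟨h1, h2⟩
  · exact Or.inl ⟨h1, by simpa using congrArg Sum.swap h2⟩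
  · exact Or.inr ⟨h1, by simpa using congrArg Sum.swap h2⟩

/-- Short roots have squared length 2 and long ones 4. This makes squared length a test for whether
a vector can be a root. -/
theorem wt_sub_norm (a b : Fin n ⊕ Fin n) :
    (wt a - wt b) ⬝ᵥ (wt a - wt b) = if a = b then 0 else if a = b.swap then 4 else 2 := by
  simp only [sub_dotProduct, dotProduct_sub, wt_dot]
  have : b = a.swap ↔ a = b.swap := by
    constructor <;> rintro rfl <;> simp
  have h2 : b = a ↔ a = b := eq_comm
  simp only [this, h2, if_true]
  by_cases h : a = b
  · simp [h]
  · by_cases h' : a = b.swap <;> simp [h, h', swap_ne_self]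

theorem wt_sub_norm_cases (a b : Fin n ⊕ Fin n) :
    (wt a - wt b) ⬝ᵥ (wt a - wt b) = 0 ∨ (wt a - wt b) ⬝ᵥ (wt a - wt b) = 2 ∨
      (wt a - wt b) ⬝ᵥ (wt a - wt b) = 4 := by
  rw [wt_sub_norm]; split_ifs <;> simp

theorem dot_self_pos {v : Fin n → ℤ} (hv : v ≠ 0) : 0 < v ⬝ᵥ v := by
  have h0 : 0 ≤ v ⬝ᵥ v := Finset.sum_nonneg fun i _ => mul_self_nonneg _
  have h1 : v ⬝ᵥ v ≠ 0 := fun h => hv (dotProduct_self_eq_zero.1 h)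
  omega

end Weights

/-! ### Roots as differences of weights -/

namespace Root

variable {n : ℕ}

/-- Row index of the first nonzero entry of `f_r`. -/
def fst : Root n → Fin n ⊕ Fin n
  | add i _ _ => .inl i
  | sub i _ _ => .inl i
  | negAdd i _ _ => .inr i
  | long i => .inl i
  | negLong i => .inr i

/-- Column index of the entry of `f_r` in row `r.fst`. -/
def snd : Root n → Fin n ⊕ Fin n
  | add _ j _ => .inr j
  | sub _ j _ => .inl j
  | negAdd _ j _ => .inl j
  | long i => .inr i
  | negLong i => .inl i

theorem fst_ne_snd (r : Root n) : r.fst ≠ r.snd := by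
  cases r <;> simp [fst, snd]; assumption

theorem vec_eq (r : Root n) : r.vec = wt r.fst - wt r.snd := by
  cases r <;> simp only [vec, fst, snd, wt, sub_neg_eq_add]
  · rw [← Pi.single_add]; norm_num
  · rw [← neg_add', ← Pi.single_add]; norm_num

theorem vec_injective : Function.Injective (vec : Root n → Fin n → ℤ) := by
  intro r p h
  rw [vec_eq, vec_eq] at h
  have h' := wt_sub_eq h (fst_ne_snd r)
  cases r <;> cases p <;> simp [fst, snd] at h' ⊢ <;> grind

theorem exists_vec_eq {a b : Fin n ⊕ Fin n} (h : a ≠ b) : ∃ r : Root n, r.vec = wt a - wt b := by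
  rcases a with i | i <;> rcases b with j | j
  · exact ⟨sub i j (by simpa using h), by simp [vec_eq, fst, snd]⟩
  · rcases lt_trichotomy i j with hij | rfl | hij
    · exact ⟨add i j hij, by simp [vec_eq, fst, snd]⟩
    · exact ⟨long i, by simp [vec_eq, fst, snd]⟩
    · exact ⟨add j i hij, by simp [vec_eq, fst, snd, wt, add_comm]⟩
  · rcases lt_trichotomy i j with hij | rfl | hij
    · exact ⟨negAdd i j hij, by simp [vec_eq, fst, snd]⟩
    · exact ⟨negLong i, by simp [vec_eq, fst, snd]⟩
    · exact ⟨negAdd j i hij, by simp [vec_eq, fst, snd, wt]; abel⟩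
  · exact ⟨sub j i (by rintro rfl; simp at h), by simp [vec_eq, fst, snd, wt]; abel⟩

theorem norm_eq (r : Root n) : r.vec ⬝ᵥ r.vec = 2 ∨ r.vec ⬝ᵥ r.vec = 4 := by
  rw [vec_eq, wt_sub_norm, if_neg r.fst_ne_snd]
  split_ifs <;> simp

theorem vec_ne_zero (r : Root n) : r.vec ≠ 0 := by
  intro h
  have := r.norm_eq
  simp [h] at this

@[simp] theorem neg_neg (r : Root n) : r.neg.neg = r := by cases r <;> rfl

instance : Finite (Root n) :=
  Finite.of_injective (fun r : Root n => (r.fst, r.snd)) fun r p h => by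
    apply vec_injective
    simp only [Prod.mk.injEq] at h
    rw [vec_eq, vec_eq, h.1, h.2]

theorem mat_ne_zero_iff (r : Root n) (a b : Fin n ⊕ Fin n) :
    r.mat a b ≠ 0 ↔ wt a - wt b = r.vec := by
  have key : wt a - wt b = r.vec ↔
      (a = r.fst ∧ b = r.snd) ∨ (a = r.snd.swap ∧ b = r.fst.swap) := by
    rw [vec_eq]
    constructor
    · intro h
      have := wt_sub_eq h.symm r.fst_ne_snd
      rcases this with ⟨h1, h2⟩ | ⟨h1, h2⟩
      · exact Or.inl ⟨h1.symm, h2.symm⟩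
      · exact Or.inr ⟨by simp [h2], by simp [h1]⟩
    · rintro (⟨rfl, rfl⟩ | ⟨rfl, rfl⟩)
      · rfl
      · simp; abel
  rw [key]
  cases r <;> rcases a with a | a <;> rcases b with b | b <;>
    simp [mat, fst, snd, Matrix.single_apply] <;> grind

theorem mat_apply_cases (r : Root n) (a b : Fin n ⊕ Fin n) :
    r.mat a b = 0 ∨ r.mat a b = 1 ∨ r.mat a b = -1 := by
  cases r <;> rcases a with a | a <;> rcases b with b | b <;>
    simp [mat, Matrix.single_apply] <;> grind

theorem mat_neg (r : Root n) : r.neg.mat = r.mat.transpose := by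
  cases r <;> simp [mat, neg, Matrix.transpose_add, Matrix.transpose_sub, add_comm]

end Root

/-! ### Coroots and reflections -/

section Reflections

variable {n : ℕ}

/-- The coroot `2 r / (r, r)`. -/
def Root.co : Root n → Fin n → ℤ
  | .long i => Pi.single i 1
  | .negLong i => -Pi.single i 1
  | r => r.vec

/-- Clears the denominator in the coroot, so that pairings with `r.co` can be computed over `ℤ` from
inner products with `r.vec`. -/
theorem Root.norm_mul_dot_co (r : Root n) (v : Fin n → ℤ) :
    (r.vec ⬝ᵥ r.vec) * (v ⬝ᵥ r.co) = 2 * (v ⬝ᵥ r.vec) := by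
  have h : (r.vec ⬝ᵥ r.vec = 2 ∧ r.co = r.vec) ∨ (r.vec ⬝ᵥ r.vec = 4 ∧ r.vec = r.co + r.co) := by
    have h1 : r.vec ⬝ᵥ r.vec = if r.fst = r.snd.swap then 4 else 2 := by
      rw [r.vec_eq, wt_sub_norm, if_neg r.fst_ne_snd]
    cases r
    case long i => right; exact ⟨by simpa [fst, snd] using h1, by simp [vec, co, ← Pi.single_add]⟩
    case negLong i =>
      right
      refine ⟨by simpa [fst, snd] using h1, ?_⟩
      simp only [vec, co]; rw [← neg_add, ← Pi.single_add]; norm_num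
    all_goals left; refine ⟨?_, rfl⟩; rw [h1, if_neg]; simp [fst, snd]
    all_goals omega
  rcases h with ⟨h1, h2⟩ | ⟨h1, h2⟩
  · rw [h1, h2]
  · rw [h1, h2, dotProduct_add]; ring

theorem Root.vec_dot_co (r : Root n) : r.vec ⬝ᵥ r.co = 2 := by
  have h := r.norm_mul_dot_co r.vec
  rcases r.norm_eq with h' | h' <;> rw [h'] at h <;> omega

/-- The reflection in the root `r`. -/
def refl (r : Root n) (v : Fin n → ℤ) : Fin n → ℤ := v - (v ⬝ᵥ r.co) • r.vec

theorem refl_add (r : Root n) (u v : Fin n → ℤ) : refl r (u + v) = refl r u + refl r v := by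
  simp only [refl, add_dotProduct, add_smul]; abel

theorem refl_sub (r : Root n) (u v : Fin n → ℤ) : refl r (u - v) = refl r u - refl r v := by
  simp only [refl, sub_dotProduct, sub_smul]; abel

theorem refl_neg (r : Root n) (v : Fin n → ℤ) : refl r (-v) = -refl r v := by
  simp only [refl, neg_dotProduct, neg_smul]; abel

theorem refl_refl (r : Root n) (v : Fin n → ℤ) : refl r (refl r v) = v := by
  simp only [refl, sub_dotProduct, smul_dotProduct, r.vec_dot_co, smul_eq_mul, sub_smul]
  rw [mul_comm, mul_smul, two_smul ℤ]; abel

theorem refl_self (r : Root n) : refl r r.vec = -r.vec := by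
  simp only [refl, r.vec_dot_co, two_smul]; abel

theorem refl_dot (r : Root n) (u v : Fin n → ℤ) : refl r u ⬝ᵥ v = u ⬝ᵥ refl r v := by
  have h1 := r.norm_mul_dot_co u
  have h2 := r.norm_mul_dot_co v
  simp only [refl, sub_dotProduct, dotProduct_sub, smul_dotProduct, dotProduct_smul, smul_eq_mul]
  rw [dotProduct_comm r.vec v]
  rcases r.norm_eq with h | h <;> rw [h] at h1 h2
  · have h1 : u ⬝ᵥ r.co = u ⬝ᵥ r.vec := by omega
    have h2 : v ⬝ᵥ r.co = v ⬝ᵥ r.vec := by omega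
    rw [h1, h2]; ring
  · have h1 : u ⬝ᵥ r.vec = 2 * (u ⬝ᵥ r.co) := by omega
    have h2 : v ⬝ᵥ r.vec = 2 * (v ⬝ᵥ r.co) := by omega
    rw [h1, h2]; ring

theorem refl_eq_self {r : Root n} {v : Fin n → ℤ} (h : v ⬝ᵥ r.vec = 0) : refl r v = v := by
  have h1 := r.norm_mul_dot_co v
  rw [h] at h1
  have : v ⬝ᵥ r.co = 0 := by rcases r.norm_eq with h | h <;> rw [h] at h1 <;> omega
  simp [refl, this]

theorem dot_co_of_wt_sub {r : Root n} {a b : Fin n ⊕ Fin n} (h : wt a - wt b = r.vec) :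
    wt a ⬝ᵥ r.co = 1 ∧ wt b ⬝ᵥ r.co = -1 := by
  have h1 := r.norm_mul_dot_co (wt a)
  have h2 := r.norm_mul_dot_co (wt b)
  have h3 := r.norm_eq
  have e := wt_dot_self a
  have e' := wt_dot_self b
  have e'' := dotProduct_comm (wt a) (wt b)
  rw [← h] at h1 h2 h3
  simp only [sub_dotProduct, dotProduct_sub, e, e', ← e''] at h1 h2 h3 ⊢
  generalize wt a ⬝ᵥ wt b = x at *
  rcases h3 with h3 | h3
  · obtain rfl : x = 0 := by omega
    constructor <;> linarith
  · obtain rfl : x = -1 := by omega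
    constructor <;> linarith

/-- An index is either fixed by the reflection in `r` or is the row or the column of a nonzero entry
of `f_r`. -/
theorem dot_co_trichotomy (r : Root n) (a : Fin n ⊕ Fin n) :
    wt a ⬝ᵥ r.co = 0 ∨ (∃ b, wt a - wt b = r.vec) ∨ (∃ b, wt b - wt a = r.vec) := by
  by_cases h0 : wt a ⬝ᵥ r.vec = 0
  · left
    have h1 := r.norm_mul_dot_co (wt a)
    rw [h0] at h1
    rcases r.norm_eq with h | h <;> rw [h] at h1 <;> omega
  · right
    rw [r.vec_eq] at h0 ⊢
    rw [dotProduct_sub, wt_dot, wt_dot] at h0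
    by_cases h1 : a = r.fst
    · exact Or.inl ⟨r.snd, by rw [h1]⟩
    by_cases h2 : a = r.snd
    · exact Or.inr ⟨r.fst, by rw [h2]⟩
    by_cases h3 : a = r.fst.swap
    · exact Or.inr ⟨r.snd.swap, by rw [h3]; simp; abel⟩
    by_cases h4 : a = r.snd.swap
    · exact Or.inl ⟨r.fst.swap, by rw [h4]; simp; abel⟩
    simp [h1, h2, h3, h4] at h0

theorem exists_refl_wt (r : Root n) (a : Fin n ⊕ Fin n) : ∃ b, wt b = refl r (wt a) := by
  rcases dot_co_trichotomy r a with h | ⟨b, hb⟩ | ⟨b, hb⟩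
  · exact ⟨a, by simp [refl, h]⟩
  · exact ⟨b, by rw [refl, (dot_co_of_wt_sub hb).1, ← hb]; simp⟩
  · exact ⟨b, by rw [refl, (dot_co_of_wt_sub hb).2, ← hb]; simp⟩

theorem exists_refl_vec (r p : Root n) : ∃ q : Root n, q.vec = refl r p.vec := by
  obtain ⟨a, ha⟩ := exists_refl_wt r p.fst
  obtain ⟨b, hb⟩ := exists_refl_wt r p.snd
  have hab : a ≠ b := by
    rintro rfl
    apply p.fst_ne_snd
    apply wt_injective
    rw [← refl_refl r (wt p.fst), ← ha, hb, refl_refl]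
  obtain ⟨q, hq⟩ := Root.exists_vec_eq hab
  exact ⟨q, by rw [hq, ha, hb, p.vec_eq, refl_sub]⟩

end Reflections

/-! ### Homogeneous matrices in the symplectic Lie algebra -/

section WeightMatrices

variable {n : ℕ}

/-- The matrix `M` is homogeneous of weight `v`. -/
def HasWeight (v : Fin n → ℤ) (M : Matrix (Fin n ⊕ Fin n) (Fin n ⊕ Fin n) ℝ) : Prop :=
  ∀ a b, M a b ≠ 0 → wt a - wt b = v

theorem HasWeight.mul {u v : Fin n → ℤ} {M N : Matrix (Fin n ⊕ Fin n) (Fin n ⊕ Fin n) ℝ}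
    (hM : HasWeight u M) (hN : HasWeight v N) : HasWeight (u + v) (M * N) := by
  intro a b h
  rw [Matrix.mul_apply] at h
  obtain ⟨c, -, hc⟩ := Finset.exists_ne_zero_of_sum_ne_zero h
  rw [← hM a c (left_ne_zero_of_mul hc), ← hN c b (right_ne_zero_of_mul hc)]
  abel

theorem HasWeight.sub {v : Fin n → ℤ} {M N : Matrix (Fin n ⊕ Fin n) (Fin n ⊕ Fin n) ℝ}
    (hM : HasWeight v M) (hN : HasWeight v N) : HasWeight v (M - N) := by
  intro a b h
  by_cases h1 : M a b = 0
  · by_cases h2 : N a b = 0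
    · simp [h1, h2] at h
    · exact hN a b h2
  · exact hM a b h1

theorem HasWeight.neg {v : Fin n → ℤ} {M : Matrix (Fin n ⊕ Fin n) (Fin n ⊕ Fin n) ℝ}
    (hM : HasWeight v M) : HasWeight v (-M) := by
  intro a b h
  exact hM a b (by simpa using h)

/-- A nonzero entry puts the weight among the differences of two index weights, whose squared
lengths are 0, 2 or 4. The vanishing of products of root vectors is deduced from this count of
lengths. -/
theorem HasWeight.eq_zero {v : Fin n → ℤ} {M : Matrix (Fin n ⊕ Fin n) (Fin n ⊕ Fin n) ℝ}
    (hM : HasWeight v M) (hv : v ⬝ᵥ v ≠ 0 ∧ v ⬝ᵥ v ≠ 2 ∧ v ⬝ᵥ v ≠ 4) : M = 0 := by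
  ext a b
  by_contra h
  have h1 := wt_sub_norm_cases a b
  rw [hM a b h] at h1
  obtain ⟨h2, h3, h4⟩ := hv
  rcases h1 with h1 | h1 | h1
  · exact h2 h1
  · exact h3 h1
  · exact h4 h1

theorem HasWeight.norm_cases {v : Fin n → ℤ} {M : Matrix (Fin n ⊕ Fin n) (Fin n ⊕ Fin n) ℝ}
    (hM : HasWeight v M) (h0 : M ≠ 0) : v ⬝ᵥ v = 0 ∨ v ⬝ᵥ v = 2 ∨ v ⬝ᵥ v = 4 := by
  by_contra! h
  exact h0 (hM.eq_zero h)

theorem hasWeight_mat (r : Root n) : HasWeight r.vec r.mat := fun a b h => (r.mat_ne_zero_iff a b).1 h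

theorem Root.mat_ne_zero (r : Root n) : r.mat ≠ 0 := by
  intro h
  exact (r.mat_ne_zero_iff r.fst r.snd).2 r.vec_eq.symm (by rw [h]; rfl)

/-- `M` lies in the symplectic Lie algebra. -/
def IsInfSymplectic (M : Matrix (Fin n ⊕ Fin n) (Fin n ⊕ Fin n) ℝ) : Prop :=
  M * Matrix.J (Fin n) ℝ = -(Matrix.J (Fin n) ℝ * M.transpose)

/-- The sign in the symplectic form. -/
def sgn : Fin n ⊕ Fin n → ℝ
  | .inl _ => 1
  | .inr _ => -1

theorem sgn_ne_zero (a : Fin n ⊕ Fin n) : sgn a ≠ 0 := by cases a <;> simp [sgn]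

theorem IsInfSymplectic.apply {M : Matrix (Fin n ⊕ Fin n) (Fin n ⊕ Fin n) ℝ}
    (hM : IsInfSymplectic M) (a b : Fin n ⊕ Fin n) :
    M a b * sgn b = -(sgn a * M b.swap a.swap) := by
  have h := congrFun (congrFun hM a) b.swap
  rcases a with a | a <;> rcases b with b | b <;>
    simp [Matrix.mul_apply, Matrix.J, sgn, Matrix.one_apply, Fintype.sum_sum_type,
      Matrix.transpose_apply] at h ⊢ <;> linarith

theorem isInfSymplectic_mat (r : Root n) : IsInfSymplectic r.mat := r.mat_mul_J

theorem IsInfSymplectic.mul_mul {M N : Matrix (Fin n ⊕ Fin n) (Fin n ⊕ Fin n) ℝ}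
    (hM : IsInfSymplectic M) (hN : IsInfSymplectic N) : IsInfSymplectic (M * N * M) := by
  unfold IsInfSymplectic at *
  calc M * N * M * Matrix.J (Fin n) ℝ = M * N * (M * Matrix.J (Fin n) ℝ) := by noncomm_ring
    _ = -(M * (N * Matrix.J (Fin n) ℝ) * M.transpose) := by rw [hM]; noncomm_ring
    _ = M * Matrix.J (Fin n) ℝ * N.transpose * M.transpose := by rw [hN]; noncomm_ring
    _ = _ := by rw [hM]; simp only [Matrix.transpose_mul]; noncomm_ring

theorem IsInfSymplectic.lie {M N : Matrix (Fin n ⊕ Fin n) (Fin n ⊕ Fin n) ℝ}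
    (hM : IsInfSymplectic M) (hN : IsInfSymplectic N) : IsInfSymplectic (M * N - N * M) := by
  unfold IsInfSymplectic at *
  have e1 : M * N * Matrix.J (Fin n) ℝ = Matrix.J (Fin n) ℝ * M.transpose * N.transpose := by
    rw [Matrix.mul_assoc, hN, mul_neg, ← Matrix.mul_assoc, hM]; noncomm_ring
  have e2 : N * M * Matrix.J (Fin n) ℝ = Matrix.J (Fin n) ℝ * N.transpose * M.transpose := by
    rw [Matrix.mul_assoc, hM, mul_neg, ← Matrix.mul_assoc, hN]; noncomm_ring
  rw [sub_mul, e1, e2]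
  simp only [Matrix.transpose_mul, Matrix.transpose_sub]; noncomm_ring

theorem IsInfSymplectic.neg {M : Matrix (Fin n ⊕ Fin n) (Fin n ⊕ Fin n) ℝ}
    (hM : IsInfSymplectic M) : IsInfSymplectic (-M) := by
  unfold IsInfSymplectic at *
  simp [hM]

theorem IsInfSymplectic.conj {M : Matrix (Fin n ⊕ Fin n) (Fin n ⊕ Fin n) ℝ}
    (hM : IsInfSymplectic M) (A : Sp n) :
    IsInfSymplectic ((A : Matrix (Fin n ⊕ Fin n) (Fin n ⊕ Fin n) ℝ) * M *
      ((A⁻¹ : Sp n) : Matrix (Fin n ⊕ Fin n) (Fin n ⊕ Fin n) ℝ)) := by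
  unfold IsInfSymplectic at *
  have h1 := SymplecticGroup.mem_iff.1 A.2
  have h2 : (A : Matrix (Fin n ⊕ Fin n) (Fin n ⊕ Fin n) ℝ) *
      ((A⁻¹ : Sp n) : Matrix (Fin n ⊕ Fin n) (Fin n ⊕ Fin n) ℝ) = 1 := by
    rw [← Submonoid.coe_mul, mul_inv_cancel, Submonoid.coe_one]
  have h2' : ((A⁻¹ : Sp n) : Matrix (Fin n ⊕ Fin n) (Fin n ⊕ Fin n) ℝ) * A = 1 := by
    rw [← Submonoid.coe_mul, inv_mul_cancel, Submonoid.coe_one]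
  generalize ((A⁻¹ : Sp n) : Matrix (Fin n ⊕ Fin n) (Fin n ⊕ Fin n) ℝ) = B at *
  generalize (A : Matrix (Fin n ⊕ Fin n) (Fin n ⊕ Fin n) ℝ) = C at *
  have h3 : B * Matrix.J (Fin n) ℝ = Matrix.J (Fin n) ℝ * C.transpose := by
    conv_lhs => rw [← h1]
    rw [← Matrix.mul_assoc, ← Matrix.mul_assoc, h2', Matrix.one_mul]
  have h4 : C * Matrix.J (Fin n) ℝ = Matrix.J (Fin n) ℝ * B.transpose := by
    have h5 : C.transpose * B.transpose = 1 := by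
      rw [← Matrix.transpose_mul, h2', Matrix.transpose_one]
    conv_rhs => rw [← h1]
    rw [Matrix.mul_assoc _ _ B.transpose, h5, Matrix.mul_one]
  calc C * M * B * Matrix.J (Fin n) ℝ = C * (M * (B * Matrix.J (Fin n) ℝ)) := by noncomm_ring
    _ = C * (M * Matrix.J (Fin n) ℝ) * C.transpose := by rw [h3]; noncomm_ring
    _ = -(C * Matrix.J (Fin n) ℝ * M.transpose * C.transpose) := by rw [hM]; noncomm_ring
    _ = _ := by rw [h4]; simp only [Matrix.transpose_mul]; noncomm_ring

/-- Root spaces are one-dimensional: the symplectic condition ties the entry at `(a, b)` to the one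
at `(b.swap, a.swap)`, and the weight leaves no other positions. -/
theorem IsInfSymplectic.eq_smul_mat {M : Matrix (Fin n ⊕ Fin n) (Fin n ⊕ Fin n) ℝ} {r : Root n}
    (hM : IsInfSymplectic M) (hw : HasWeight r.vec M) : ∃ c : ℝ, M = c • r.mat := by
  have hr : r.mat r.fst r.snd ≠ 0 := (r.mat_ne_zero_iff _ _).2 r.vec_eq.symm
  have h1 := hM.apply r.fst r.snd
  have h2 := (isInfSymplectic_mat r).apply r.fst r.snd
  have e1 : M r.snd.swap r.fst.swap * r.mat r.fst r.snd =
      M r.fst r.snd * r.mat r.snd.swap r.fst.swap := by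
    have hs := sgn_ne_zero r.fst
    have hs' := sgn_ne_zero r.snd
    apply mul_left_cancel₀ hs
    linear_combination r.mat r.fst r.snd * h1 - M r.fst r.snd * h2
  refine ⟨M r.fst r.snd / r.mat r.fst r.snd, ?_⟩
  ext a b
  rw [Matrix.smul_apply, smul_eq_mul]
  by_cases hab : r.mat a b = 0
  · have : M a b = 0 := by
      by_contra h
      exact (r.mat_ne_zero_iff a b).2 (hw a b h) hab
    rw [this, hab, mul_zero]
  · have h := (r.mat_ne_zero_iff a b).1 hab
    rw [r.vec_eq] at h
    rcases wt_sub_eq h.symm r.fst_ne_snd with ⟨ha, hb⟩ | ⟨ha, hb⟩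
    · rw [← ha, ← hb]; field_simp
    · have ha' : a = r.snd.swap := by rw [hb]; simp
      have hb' : b = r.fst.swap := by rw [ha]; simp
      rw [ha', hb']; field_simp; linear_combination e1

theorem HasWeight.mul_eq_zero_of_long {u v : Fin n → ℤ}
    {M N : Matrix (Fin n ⊕ Fin n) (Fin n ⊕ Fin n) ℝ} (hM : HasWeight u M) (hN : HasWeight v N)
    (h : 4 < (u + v) ⬝ᵥ (u + v)) : M * N = 0 :=
  (hM.mul hN).eq_zero (by omega)

end WeightMatrices

/-! ### Root elements of the symplectic group -/

section SymplecticElements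

variable {n : ℕ}

theorem Root.mat_sq (r : Root n) : r.mat * r.mat = 0 := by
  apply (hasWeight_mat r).mul_eq_zero_of_long (hasWeight_mat r)
  simp only [add_dotProduct, dotProduct_add]
  have := r.norm_eq
  omega

/-- As `f_r² = 0`, the exponential series stops after its linear term. -/
theorem coe_spX (r : Root n) (t : ℝ) :
    (spX r t : Matrix (Fin n ⊕ Fin n) (Fin n ⊕ Fin n) ℝ) = 1 + t • r.mat := by
  have hsq : (t • r.mat) ^ 2 = 0 := by
    rw [pow_two, Matrix.smul_mul, Matrix.mul_smul, r.mat_sq]; simp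
  show NormedSpace.exp (t • r.mat) = _
  rw [NormedSpace.exp_eq_tsum ℝ]
  beta_reduce
  rw [tsum_eq_sum (s := Finset.range 2)]
  · simp [Finset.sum_range_succ]
  · intro k hk
    obtain ⟨m, rfl⟩ := Nat.exists_eq_add_of_le' (by simp at hk; omega : 2 ≤ k)
    rw [pow_add, hsq]; simp

theorem spX_ext {A B : Sp n} (h : (A : Matrix (Fin n ⊕ Fin n) (Fin n ⊕ Fin n) ℝ) = B) : A = B :=
  Subtype.ext h

theorem spX_add (r : Root n) (s t : ℝ) : spX r (s + t) = spX r s * spX r t := by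
  apply spX_ext
  rw [Submonoid.coe_mul, coe_spX, coe_spX, coe_spX]
  simp only [add_mul, mul_add, Matrix.smul_mul, Matrix.mul_smul, r.mat_sq, one_mul, mul_one, add_smul]
  simp [add_assoc]

theorem spX_zero (r : Root n) : spX r 0 = 1 := by
  apply spX_ext; rw [coe_spX]; simp

theorem spX_neg (r : Root n) (t : ℝ) : spX r (-t) = (spX r t)⁻¹ := by
  rw [eq_inv_iff_mul_eq_one, ← spX_add, neg_add_cancel, spX_zero]

theorem spX_injective (r : Root n) : Function.Injective (spX r) := by
  intro s t h
  have h1 := congrArg (fun A : Sp n => (A : Matrix (Fin n ⊕ Fin n) (Fin n ⊕ Fin n) ℝ)) h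
  simp only [coe_spX, add_right_inj] at h1
  exact smul_left_injective ℝ r.mat_ne_zero h1

/-- The commutator of two root elements as a matrix. -/
theorem coe_commutator (r p : Root n) (h : r.vec + p.vec ≠ 0) (a b : ℝ) :
    ((⁅(spX r a : Sp n), spX p b⁆ : Sp n) : Matrix (Fin n ⊕ Fin n) (Fin n ⊕ Fin n) ℝ) =
      1 + (a * b) • (r.mat * p.mat - p.mat * r.mat) + (a ^ 2 * b) • (-(r.mat * p.mat * r.mat))
        + (a * b ^ 2) • (p.mat * r.mat * p.mat) := by
  -- The weight of this product is `2 (r + p)`. Since `|r + p|²` is positive and even, its squared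
  -- length is at least 8.
  have h4 : r.mat * p.mat * (r.mat * p.mat) = 0 := by
    have hw := (hasWeight_mat r).mul (hasWeight_mat p)
    apply (hw.mul hw).eq_zero
    have h1 := dot_self_pos h
    have hr := r.norm_eq
    have hp := p.norm_eq
    have e := dotProduct_comm r.vec p.vec
    simp only [add_dotProduct, dotProduct_add, ← e] at h1 ⊢
    omega
  rw [commutatorElement_def, ← spX_neg, ← spX_neg]
  simp only [Submonoid.coe_mul, coe_spX]
  have hr := r.mat_sq
  have hp := p.mat_sq
  generalize r.mat = X at *
  generalize p.mat = Y at *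
  rw [Matrix.mul_assoc] at h4
  simp only [add_mul, mul_add, Matrix.smul_mul, Matrix.mul_smul, one_mul, mul_one, mul_zero,
    neg_smul, smul_neg, mul_neg, neg_mul, Matrix.mul_assoc, hr, hp, h4, smul_zero, add_zero]
  module

end SymplecticElements

/-! ### Existence of structure constants -/

section StructureConstants

variable {n : ℕ}

theorem factor_eq {G : Type*} [Group G] (x : Root n → ℝ → G) {r p q : Root n} {i j : ℕ}
    (h : q.vec = (i : ℤ) • r.vec + (j : ℤ) • p.vec) (s : ℝ) : factor x r p i j s = x q s := by
  have H : ∃ q : Root n, q.vec = (i : ℤ) • r.vec + (j : ℤ) • p.vec := ⟨q, h⟩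
  rw [factor, dif_pos H]
  congr 1
  exact Root.vec_injective (H.choose_spec.trans h.symm)

/-- If `M = 0` the constant 0 works, whether or not `ir + jp` is a root; otherwise `M` spans a root
space. The last hypothesis excludes weight zero, where homogeneous means diagonal. -/
theorem exists_coe_factor {r p : Root n} {i j : ℕ}
    {M : Matrix (Fin n ⊕ Fin n) (Fin n ⊕ Fin n) ℝ} (hM : IsInfSymplectic M)
    (hw : HasWeight ((i : ℤ) • r.vec + (j : ℤ) • p.vec) M)
    (h0 : M ≠ 0 → (i : ℤ) • r.vec + (j : ℤ) • p.vec ≠ 0) :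
    ∃ N : ℝ, ∀ t : ℝ, ((factor spX r p i j (N * t) : Sp n) : Matrix (Fin n ⊕ Fin n) (Fin n ⊕ Fin n) ℝ) =
      1 + t • M := by
  by_cases hz : M = 0
  · refine ⟨0, fun t => ?_⟩
    rw [zero_mul, hz, smul_zero, add_zero, factor]
    split_ifs with H
    · rw [spX_zero]; rfl
    · rfl
  · obtain ⟨a, b, hab⟩ : ∃ a b, M a b ≠ 0 := by
      by_contra! h
      exact hz (Matrix.ext h)
    have hne : a ≠ b := by
      rintro rfl
      exact h0 hz (by rw [← hw a a hab, sub_self])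
    obtain ⟨q, hq⟩ := Root.exists_vec_eq hne
    rw [hw a b hab] at hq
    rw [← hq] at hw
    obtain ⟨c, rfl⟩ := hM.eq_smul_mat hw
    refine ⟨c, fun t => ?_⟩
    rw [factor_eq spX hq, coe_spX, smul_smul, mul_comm]

theorem chevalleyProd_eq {G : Type*} [Group G] (x : Root n → ℝ → G)
    (c : ℕ → ℕ → Root n → Root n → ℝ) (r p : Root n) (a b : ℝ) :
    chevalleyProd x c r p a b = factor x r p 1 1 (c 1 1 r p * a * b) *
      (factor x r p 2 1 (c 2 1 r p * a ^ 2 * b) * factor x r p 1 2 (c 1 2 r p * a * b ^ 2)) := by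
  simp [chevalleyProd]

theorem exists_isStructureConstants (n : ℕ) : ∃ c, IsStructureConstants n c := by
  have key : ∀ r p : Root n, ∃ N : ℕ → ℕ → ℝ, r.vec + p.vec ≠ 0 → ∀ a b : ℝ,
      ⁅(spX r a : Sp n), spX p b⁆ = factor spX r p 1 1 (N 1 1 * a * b) *
      (factor spX r p 2 1 (N 2 1 * a ^ 2 * b) * factor spX r p 1 2 (N 1 2 * a * b ^ 2)) := by
    intro r p
    by_cases h : r.vec + p.vec = 0
    · exact ⟨0, fun h' => absurd h h'⟩
    have hX := hasWeight_mat r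
    have hY := hasWeight_mat p
    have sX := isInfSymplectic_mat r
    have sY := isInfSymplectic_mat p
    have w11 : HasWeight (((1 : ℕ) : ℤ) • r.vec + ((1 : ℕ) : ℤ) • p.vec)
        (r.mat * p.mat - p.mat * r.mat) := by
      have := (hX.mul hY).sub (by rw [add_comm]; exact hY.mul hX)
      simpa using this
    have w21 : HasWeight (((2 : ℕ) : ℤ) • r.vec + ((1 : ℕ) : ℤ) • p.vec)
        (-(r.mat * p.mat * r.mat)) := by
      have := ((hX.mul hY).mul hX).neg
      convert this using 1
      push_cast; rw [two_smul ℤ, one_smul]; abel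
    have w12 : HasWeight (((1 : ℕ) : ℤ) • r.vec + ((2 : ℕ) : ℤ) • p.vec)
        (p.mat * r.mat * p.mat) := by
      have := (hY.mul hX).mul hY
      convert this using 1
      push_cast; rw [two_smul ℤ, one_smul]; abel
    have hr := r.norm_eq
    have hp := p.norm_eq
    have h1 := dot_self_pos h
    have e := dotProduct_comm p.vec r.vec
    simp only [add_dotProduct, dotProduct_add, e] at h1
    -- The term `f_r f_p f_r` survives only if `2r + p` is no longer than a long root, which forces
    -- `r` short, `p` long and an angle of 135 degrees. The other cubic term is symmetric.
    have d21 : r.mat * p.mat * r.mat ≠ 0 → r.vec ⬝ᵥ r.vec = 2 ∧ p.vec ⬝ᵥ p.vec = 4 ∧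
        r.vec ⬝ᵥ p.vec = -2 := by
      intro h0
      have := w21.norm_cases (neg_ne_zero.2 h0)
      simp only [Nat.cast_ofNat, Nat.cast_one, one_smul, add_dotProduct, dotProduct_add,
        smul_dotProduct, dotProduct_smul, smul_eq_mul, e] at this
      omega
    have d12 : p.mat * r.mat * p.mat ≠ 0 → r.vec ⬝ᵥ r.vec = 4 ∧ p.vec ⬝ᵥ p.vec = 2 ∧
        r.vec ⬝ᵥ p.vec = -2 := by
      intro h0
      have := w12.norm_cases h0
      simp only [Nat.cast_ofNat, Nat.cast_one, one_smul, add_dotProduct, dotProduct_add,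
        smul_dotProduct, dotProduct_smul, smul_eq_mul, e] at this
      omega
    have norm_ne : ∀ v : Fin n → ℤ, v ⬝ᵥ v ≠ 0 → v ≠ 0 := by
      rintro _ h rfl; simp at h
    obtain ⟨N11, h11⟩ := exists_coe_factor (sX.lie sY) w11 (fun _ => by simpa using h)
    obtain ⟨N21, h21⟩ := exists_coe_factor (sX.mul_mul sY).neg w21 (fun h0 => by
      have := d21 (neg_ne_zero.1 h0)
      apply norm_ne
      simp only [Nat.cast_ofNat, Nat.cast_one, one_smul, add_dotProduct, dotProduct_add,
        smul_dotProduct, dotProduct_smul, smul_eq_mul, e]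
      omega)
    obtain ⟨N12, h12⟩ := exists_coe_factor (sY.mul_mul sX) w12 (fun h0 => by
      have := d12 h0
      apply norm_ne
      simp only [Nat.cast_ofNat, Nat.cast_one, one_smul, add_dotProduct, dotProduct_add,
        smul_dotProduct, dotProduct_smul, smul_eq_mul, e]
      omega)
    refine ⟨fun i j => if i = 2 then N21 else if j = 2 then N12 else N11, fun _ a b => ?_⟩
    apply spX_ext
    rw [coe_commutator r p h]
    simp only [Submonoid.coe_mul, if_true, if_false, show (1 : ℕ) = 2 ↔ False by simp]
    rw [mul_assoc N11, mul_assoc N21, mul_assoc N12, h11, h21, h12]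
    -- The ordered product of the three factors equals one plus the sum of their nilpotent parts,
    -- since all cross terms vanish by length or because the two cubic terms cannot both occur.
    have z1 : (r.mat * p.mat - p.mat * r.mat) * (-(r.mat * p.mat * r.mat)) = 0 := by
      by_cases h0 : r.mat * p.mat * r.mat = 0
      · simp [h0]
      · have := d21 h0
        apply w11.mul_eq_zero_of_long w21
        simp only [Nat.cast_ofNat, Nat.cast_one, one_smul, add_dotProduct, dotProduct_add,
          smul_dotProduct, dotProduct_smul, smul_eq_mul, e]
        omega
    have z2 : (r.mat * p.mat - p.mat * r.mat) * (p.mat * r.mat * p.mat) = 0 := by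
      by_cases h0 : p.mat * r.mat * p.mat = 0
      · simp [h0]
      · have := d12 h0
        apply w11.mul_eq_zero_of_long w12
        simp only [Nat.cast_ofNat, Nat.cast_one, one_smul, add_dotProduct, dotProduct_add,
          smul_dotProduct, dotProduct_smul, smul_eq_mul, e]
        omega
    have z3 : (-(r.mat * p.mat * r.mat)) * (p.mat * r.mat * p.mat) = 0 := by
      by_cases h0 : p.mat * r.mat * p.mat = 0
      · simp [h0]
      · by_cases h0' : r.mat * p.mat * r.mat = 0
        · simp [h0']
        · have := d12 h0
          have := d21 h0'
          omega
    generalize r.mat * p.mat - p.mat * r.mat = A at *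
    generalize -(r.mat * p.mat * r.mat) = B at *
    generalize p.mat * r.mat * p.mat = C at *
    simp only [add_mul, mul_add, Matrix.smul_mul, Matrix.mul_smul, one_mul, mul_one, z1, z2, z3,
      smul_zero, add_zero]
  choose N hN using key
  refine ⟨fun i j r p => N r p i j, fun r p h a b => ?_⟩
  rw [hN r p h, chevalleyProd_eq]

end StructureConstants

/-! ### The elements `w_r` and `h_r` in the symplectic group -/

section WeylElements

variable {n : ℕ}

theorem Root.co_neg (r : Root n) : r.neg.co = -r.co := by
  cases r <;> simp [neg, co, vec] <;> abel

theorem Root.neg_co_dot (r : Root n) (v : Fin n → ℤ) : v ⬝ᵥ r.neg.co = -(v ⬝ᵥ r.co) := by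
  rw [r.co_neg, dotProduct_neg]

/-- `f_{-r}` is the transpose of `f_r`, which has at most one nonzero entry, equal to `±1`, in each
row and column. -/
theorem Root.mat_mul_neg (r : Root n) :
    r.mat * r.neg.mat = Matrix.diagonal fun a => if wt a ⬝ᵥ r.co = 1 then 1 else 0 := by
  ext a b
  rw [r.mat_neg, Matrix.mul_apply]
  simp only [Matrix.transpose_apply]
  by_cases hab : a = b
  · subst hab
    rw [Matrix.diagonal_apply_eq]
    split_ifs with h
    · obtain ⟨c, hc⟩ : ∃ c, wt a - wt c = r.vec := by
        rcases dot_co_trichotomy r a with h' | h' | ⟨b, hb⟩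
        · omega
        · exact h'
        · have := (dot_co_of_wt_sub hb).2; omega
      rw [Finset.sum_eq_single c]
      · have h0 := (r.mat_ne_zero_iff a c).2 hc
        rcases r.mat_apply_cases a c with h | h | h
        · exact absurd h h0
        all_goals rw [h]; norm_num
      · intro d _ hd
        have : r.mat a d = 0 := by
          by_contra h0
          rw [← ne_eq, r.mat_ne_zero_iff, ← hc] at h0
          exact hd (wt_injective (sub_right_injective h0))
        rw [this, zero_mul]
      · simp
    · apply Finset.sum_eq_zero
      intro c _
      have : r.mat a c = 0 := by
        by_contra h0
        exact h (dot_co_of_wt_sub ((r.mat_ne_zero_iff a c).1 h0)).1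
      rw [this, zero_mul]
  · rw [Matrix.diagonal_apply_ne _ hab]
    apply Finset.sum_eq_zero
    intro c _
    by_contra h0
    have h1 := (r.mat_ne_zero_iff a c).1 (left_ne_zero_of_mul h0)
    have h2 := (r.mat_ne_zero_iff b c).1 (right_ne_zero_of_mul h0)
    exact hab (wt_injective (sub_left_injective (h1.trans h2.symm)))

theorem Root.neg_mat_mul (r : Root n) :
    r.neg.mat * r.mat = Matrix.diagonal fun a => if wt a ⬝ᵥ r.co = -1 then 1 else 0 := by
  have := r.neg.mat_mul_neg
  rw [r.neg_neg] at this
  simp only [r.neg_co_dot, neg_eq_iff_eq_neg] at this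
  exact this

theorem Root.mat_mul_neg_mul (r : Root n) : r.mat * r.neg.mat * r.mat = r.mat := by
  rw [r.mat_mul_neg]
  ext a b
  rw [Matrix.diagonal_mul]
  by_cases h : r.mat a b = 0
  · simp [h]
  · rw [if_pos (dot_co_of_wt_sub ((r.mat_ne_zero_iff a b).1 h)).1, one_mul]

theorem coe_wElt_spX (r : Root n) {s : ℝ} (hs : s ≠ 0) :
    ((wElt spX r s : Sp n) : Matrix (Fin n ⊕ Fin n) (Fin n ⊕ Fin n) ℝ) =
      1 - r.mat * r.neg.mat - r.neg.mat * r.mat + s • r.mat - s⁻¹ • r.neg.mat := by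
  have h1 := r.mat_sq
  have h2 := r.mat_mul_neg_mul
  simp only [wElt, Submonoid.coe_mul, coe_spX]
  generalize r.mat = X at *
  generalize r.neg.mat = Y at *
  rw [Matrix.mul_assoc] at h2
  simp only [add_mul, mul_add, Matrix.smul_mul, Matrix.mul_smul, one_mul, mul_one,
    Matrix.mul_assoc, h1, h2, smul_zero, add_zero, smul_smul, neg_smul, mul_neg, neg_mul,
    inv_mul_cancel₀ hs, mul_inv_cancel₀ hs]
  module

/-- The part `1 - f_r f_{-r} - f_{-r} f_r` projects onto the coordinates fixed by the reflection,
while `f_r` and `f_{-r}` interchange the others in pairs. -/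
theorem wt_eq_refl_of_wElt_ne_zero (r : Root n) {s : ℝ} (hs : s ≠ 0) {a b : Fin n ⊕ Fin n}
    (h : ((wElt spX r s : Sp n) : Matrix (Fin n ⊕ Fin n) (Fin n ⊕ Fin n) ℝ) a b ≠ 0) :
    wt a = refl r (wt b) := by
  rw [coe_wElt_spX r hs] at h
  by_cases h1 : r.mat a b = 0
  · by_cases h2 : r.neg.mat a b = 0
    · simp only [Matrix.sub_apply, Matrix.add_apply, Matrix.smul_apply, h1, h2, smul_zero,
        add_zero, sub_zero, r.mat_mul_neg, r.neg_mat_mul] at h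
      by_cases hab : a = b
      · subst hab
        simp only [Matrix.one_apply_eq, Matrix.diagonal_apply_eq] at h
        rcases dot_co_trichotomy r a with h' | ⟨c, hc⟩ | ⟨c, hc⟩
        · simp [refl, h']
        · rw [(dot_co_of_wt_sub hc).1] at h; norm_num at h
        · rw [(dot_co_of_wt_sub hc).2] at h; norm_num at h
      · simp [hab] at h
    · have h3 := (r.neg.mat_ne_zero_iff a b).1 h2
      have h4 := (dot_co_of_wt_sub h3).2
      rw [r.neg_co_dot] at h4
      rw [r.vec_neg] at h3
      have h5 : wt b ⬝ᵥ r.co = 1 := by omega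
      rw [refl, h5, one_smul, sub_eq_add_neg, ← h3]; abel
  · have h3 := (r.mat_ne_zero_iff a b).1 h1
    rw [refl, (dot_co_of_wt_sub h3).2, ← h3]; simp

theorem coe_hElt_spX (r : Root n) {s : ℝ} (hs : s ≠ 0) :
    ((hElt spX r s : Sp n) : Matrix (Fin n ⊕ Fin n) (Fin n ⊕ Fin n) ℝ) =
      Matrix.diagonal fun a => s ^ (wt a ⬝ᵥ r.co) := by
  have key : ((hElt spX r s : Sp n) : Matrix (Fin n ⊕ Fin n) (Fin n ⊕ Fin n) ℝ) =
      1 - r.mat * r.neg.mat - r.neg.mat * r.mat + s • (r.mat * r.neg.mat)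
        + s⁻¹ • (r.neg.mat * r.mat) := by
    have h1 := r.mat_sq
    have h2 := r.mat_mul_neg_mul
    have h3 := r.neg.mat_sq
    have h4 := r.neg.mat_mul_neg_mul
    rw [r.neg_neg] at h4
    simp only [hElt, Submonoid.coe_mul]
    rw [coe_wElt_spX r hs, coe_wElt_spX r (by norm_num : (-1 : ℝ) ≠ 0)]
    generalize r.mat = X at *
    generalize r.neg.mat = Y at *
    rw [Matrix.mul_assoc] at h2 h4
    have h5 : X * (X * Y) = 0 := by rw [← Matrix.mul_assoc, h1, Matrix.zero_mul]
    have h6 : Y * (Y * X) = 0 := by rw [← Matrix.mul_assoc, h3, Matrix.zero_mul]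
    simp only [add_mul, mul_add, sub_mul, mul_sub, Matrix.smul_mul, one_mul,
      mul_one, mul_zero, Matrix.mul_assoc, h1, h2, h3, h4, h5, h6, smul_zero, add_zero, sub_zero,
      neg_smul, mul_neg, inv_neg, inv_one, one_smul]
    module
  rw [key, r.mat_mul_neg, r.neg_mat_mul]
  ext a b
  by_cases hab : a = b
  · subst hab
    simp only [Matrix.sub_apply, Matrix.add_apply, Matrix.smul_apply, Matrix.one_apply_eq,
      Matrix.diagonal_apply_eq]
    rcases dot_co_trichotomy r a with h' | ⟨c, hc⟩ | ⟨c, hc⟩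
    · simp [h']
    · simp [(dot_co_of_wt_sub hc).1]
    · simp [(dot_co_of_wt_sub hc).2]
  · simp [hab]

theorem wElt_spX_neg (r : Root n) (s : ℝ) : wElt spX r (-s) = (wElt spX r s)⁻¹ := by
  simp [wElt, spX_neg, mul_assoc, inv_neg]

theorem conj_spX {A : Sp n} {r : Root n} {M : Matrix (Fin n ⊕ Fin n) (Fin n ⊕ Fin n) ℝ}
    (h : (A : Matrix (Fin n ⊕ Fin n) (Fin n ⊕ Fin n) ℝ) * r.mat *
      ((A⁻¹ : Sp n) : Matrix (Fin n ⊕ Fin n) (Fin n ⊕ Fin n) ℝ) = M) (t : ℝ) :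
    ((A * spX r t * A⁻¹ : Sp n) : Matrix (Fin n ⊕ Fin n) (Fin n ⊕ Fin n) ℝ) = 1 + t • M := by
  simp only [Submonoid.coe_mul, coe_spX, mul_add, add_mul, mul_one, Matrix.mul_smul,
    Matrix.smul_mul, h]
  rw [← Submonoid.coe_mul, mul_inv_cancel, Submonoid.coe_one]

/-- Conjugation preserves the symplectic Lie algebra and reflects weights, so it carries `f_p` to a
multiple of `f_q`. Transporting `f_p f_{-p} f_p = f_p` shows that the scalars for `p` and `-p` are
inverse to each other. -/
theorem exists_wElt_conj_spX (r p q : Root n) (hq : q.vec = refl r p.vec) {s : ℝ} (hs : s ≠ 0) :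
    ∃ η : ℝ, η ≠ 0 ∧
      (∀ t, wElt spX r s * spX p t * (wElt spX r s)⁻¹ = spX q (η * t)) ∧
      (∀ t, wElt spX r s * spX p.neg t * (wElt spX r s)⁻¹ = spX q.neg (η⁻¹ * t)) := by
  set A := wElt spX r s with hA
  have hinv : A⁻¹ = wElt spX r (-s) := by rw [wElt_spX_neg]
  have key : ∀ p q : Root n, q.vec = refl r p.vec → ∃ η : ℝ,
      (A : Matrix (Fin n ⊕ Fin n) (Fin n ⊕ Fin n) ℝ) * p.mat *
      ((A⁻¹ : Sp n) : Matrix (Fin n ⊕ Fin n) (Fin n ⊕ Fin n) ℝ) = η • q.mat := by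
    intro p q hq
    apply ((isInfSymplectic_mat p).conj A).eq_smul_mat
    intro a b hab
    rw [Matrix.mul_apply] at hab
    obtain ⟨d, -, hd⟩ := Finset.exists_ne_zero_of_sum_ne_zero hab
    have hd1 := left_ne_zero_of_mul hd
    have hd2 := right_ne_zero_of_mul hd
    rw [Matrix.mul_apply] at hd1
    obtain ⟨c, -, hc⟩ := Finset.exists_ne_zero_of_sum_ne_zero hd1
    have h1 := wt_eq_refl_of_wElt_ne_zero r hs (left_ne_zero_of_mul hc)
    have h2 := (p.mat_ne_zero_iff _ _).1 (right_ne_zero_of_mul hc)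
    rw [hinv] at hd2
    have h3 := wt_eq_refl_of_wElt_ne_zero r (neg_ne_zero.2 hs) hd2
    rw [hq, ← h2, h1, h3, refl_sub, refl_refl]
  obtain ⟨η, hη⟩ := key p q hq
  obtain ⟨η', hη'⟩ := key p.neg q.neg (by rw [q.vec_neg, p.vec_neg, hq, refl_neg])
  have hAA : ((A⁻¹ : Sp n) : Matrix (Fin n ⊕ Fin n) (Fin n ⊕ Fin n) ℝ) * A = 1 := by
    rw [← Submonoid.coe_mul, inv_mul_cancel, Submonoid.coe_one]
  have h1 : (η * η' * η) • q.mat = η • q.mat := by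
    calc (η * η' * η) • q.mat = (η • q.mat) * (η' • q.neg.mat) * (η • q.mat) := by
          conv_lhs => rw [← q.mat_mul_neg_mul]
          simp only [Matrix.smul_mul, Matrix.mul_smul, smul_smul]
          ring_nf
      _ = η • q.mat := by
          rw [← hη, ← hη']
          conv_rhs => rw [← p.mat_mul_neg_mul]
          generalize ((A⁻¹ : Sp n) : Matrix (Fin n ⊕ Fin n) (Fin n ⊕ Fin n) ℝ) = B at *
          generalize (A : Matrix (Fin n ⊕ Fin n) (Fin n ⊕ Fin n) ℝ) = C at *
          calc C * p.mat * B * (C * p.neg.mat * B) * (C * p.mat * B)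
              = C * p.mat * (B * C) * p.neg.mat * (B * C) * p.mat * B := by noncomm_ring
            _ = _ := by rw [hAA]; noncomm_ring
  have hη0 : η ≠ 0 := by
    rintro rfl
    rw [zero_smul] at hη
    apply p.mat_ne_zero
    generalize ((A⁻¹ : Sp n) : Matrix (Fin n ⊕ Fin n) (Fin n ⊕ Fin n) ℝ) = B at *
    generalize (A : Matrix (Fin n ⊕ Fin n) (Fin n ⊕ Fin n) ℝ) = C at *
    calc p.mat = (B * C) * p.mat * (B * C) := by rw [hAA]; simp
      _ = B * (C * p.mat * B) * C := by noncomm_ring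
      _ = 0 := by rw [hη]; simp
  have h2 : η * η' * η = η := smul_left_injective ℝ q.mat_ne_zero h1
  have h3 : η' = η⁻¹ := by
    field_simp
    apply mul_left_cancel₀ hη0
    linear_combination h2
  refine ⟨η, hη0, fun t => ?_, fun t => ?_⟩
  · apply spX_ext
    rw [conj_spX hη, coe_spX, smul_smul, mul_comm]
  · apply spX_ext
    rw [conj_spX hη', coe_spX, smul_smul, mul_comm, h3]

theorem hElt_conj_spX (r p : Root n) {s : ℝ} (hs : s ≠ 0) (t : ℝ) :
    hElt spX r s * spX p t * (hElt spX r s)⁻¹ = spX p (s ^ (p.vec ⬝ᵥ r.co) * t) := by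
  rw [mul_inv_eq_iff_eq_mul]
  apply spX_ext
  simp only [Submonoid.coe_mul, coe_spX, coe_hElt_spX r hs, mul_add, add_mul, mul_one, one_mul]
  congr 1
  ext a b
  rw [Matrix.diagonal_mul, Matrix.mul_diagonal]
  by_cases h : p.mat a b = 0
  · simp [h]
  · have h1 := (p.mat_ne_zero_iff a b).1 h
    have h2 : s ^ (wt a ⬝ᵥ r.co) = s ^ (p.vec ⬝ᵥ r.co) * s ^ (wt b ⬝ᵥ r.co) := by
      rw [← zpow_add₀ hs, ← h1, ← add_dotProduct]; simp
    rw [h2]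
    simp only [Matrix.smul_apply, smul_eq_mul]; ring

end WeylElements

/-! ### Realizations and their unipotent subgroups -/

/-- A group over `Sp(2n, ℝ)` generated by root elements which satisfy the additivity relations and
commutator relations of Chevalley type. -/
structure Realization (n : ℕ) (G : Type*) [Group G] where
  /-- the root elements -/
  x : Root n → ℝ → G
  /-- the projection -/
  π : G →* Sp n
  π_x : ∀ r t, π (x r t) = spX r t
  x_add : ∀ r s t, x r (s + t) = x r s * x r t
  comm_mem : ∀ r p : Root n, r.vec + p.vec ≠ 0 → ∀ a b : ℝ, ⁅x r a, x p b⁆ ∈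
    Subgroup.closure {g | ∃ q : Root n, (∃ i j : ℕ, 0 < i ∧ 0 < j ∧
      q.vec = (i : ℤ) • r.vec + (j : ℤ) • p.vec) ∧ ∃ t, g = x q t}
  generates : Subgroup.closure {g | ∃ r t, g = x r t} = ⊤

namespace Realization

variable {n : ℕ} {G : Type*} [Group G] (R : Realization n G)

/-- The subgroup generated by the root elements with roots in `S`. -/
def span (S : Set (Root n)) : Subgroup G := Subgroup.closure {g | ∃ q ∈ S, ∃ t, g = R.x q t}

theorem x_mem_span {S : Set (Root n)} {q : Root n} (hq : q ∈ S) (t : ℝ) : R.x q t ∈ R.span S :=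
  Subgroup.subset_closure ⟨q, hq, t, rfl⟩

@[simp] theorem x_zero (r : Root n) : R.x r 0 = 1 := by
  have := R.x_add r 0 0
  simpa using this

theorem x_neg (r : Root n) (t : ℝ) : R.x r (-t) = (R.x r t)⁻¹ := by
  rw [eq_inv_iff_mul_eq_one, ← R.x_add, neg_add_cancel, R.x_zero]

@[elab_as_elim]
theorem span_induction {S : Set (Root n)} {P : (g : G) → g ∈ R.span S → Prop}
    (one : P 1 (one_mem _))
    (mul : ∀ q (hq : q ∈ S) t g hg, P g hg → P (R.x q t * g) (mul_mem (R.x_mem_span hq t) hg))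
    {g : G} (hg : g ∈ R.span S) : P g hg := by
  induction hg using Subgroup.closure_induction_left with
  | one => exact one
  | mul_left y hy g hg hP =>
    obtain ⟨q, hq, t, rfl⟩ := hy
    exact mul q hq t g hg hP
  | inv_mul_cancel y hy g hg hP =>
    obtain ⟨q, hq, t, rfl⟩ := hy
    have := mul q hq (-t) g hg hP
    simpa only [R.x_neg] using this

theorem conj_mem_span {S T : Set (Root n)} (g : G)
    (h : ∀ q ∈ S, ∀ t, g * R.x q t * g⁻¹ ∈ R.span T) {v : G} (hv : v ∈ R.span S) :
    g * v * g⁻¹ ∈ R.span T := by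
  induction hv using R.span_induction with
  | one => simp
  | mul q hq t v _ hP =>
    have : g * (R.x q t * v) * g⁻¹ = (g * R.x q t * g⁻¹) * (g * v * g⁻¹) := by group
    rw [this]
    exact mul_mem (h q hq t) hP

/-- `X_r` normalizes the group spanned by `S` if all combinations `i r + j q`, `q ∈ S`, lie
in `S`. -/
theorem x_conj_mem_span {S : Set (Root n)} {r : Root n} (h0 : ∀ q ∈ S, r.vec + q.vec ≠ 0)
    (hS : ∀ q ∈ S, ∀ q' : Root n, ∀ i j : ℕ, 0 < i → 0 < j →
      q'.vec = (i : ℤ) • r.vec + (j : ℤ) • q.vec → q' ∈ S) (t : ℝ) {v : G} (hv : v ∈ R.span S) :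
    R.x r t * v * (R.x r t)⁻¹ ∈ R.span S := by
  refine R.conj_mem_span _ (fun q hq s => ?_) hv
  have h1 := R.comm_mem r q (h0 q hq) t s
  have h2 : ⁅R.x r t, R.x q s⁆ ∈ R.span S := by
    refine Subgroup.closure_mono ?_ h1
    rintro _ ⟨q', ⟨i, j, hi, hj, hq'⟩, u, rfl⟩
    exact ⟨q', hS q hq q' i j hi hj hq', u, rfl⟩
  have h3 : R.x r t * R.x q s * (R.x r t)⁻¹ = ⁅R.x r t, R.x q s⁆ * R.x q s := by
    rw [commutatorElement_def]; group
  rw [h3]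
  exact mul_mem h2 (R.x_mem_span hq s)

/-- If `X_r` normalizes the group spanned by `S`, then every element of the group spanned by
`S` and `r` is of the form `v x_r(t)`. -/
theorem exists_eq_mul_x {S T : Set (Root n)} {r : Root n} (hT : T ⊆ insert r S)
    (h : ∀ t v, v ∈ R.span S → R.x r t * v * (R.x r t)⁻¹ ∈ R.span S) {g : G}
    (hg : g ∈ R.span T) : ∃ v ∈ R.span S, ∃ t, g = v * R.x r t := by
  induction hg using R.span_induction with
  | one => exact ⟨1, one_mem _, 0, by simp⟩
  | mul q hq t g _ hP =>
    obtain ⟨v, hv, s, rfl⟩ := hP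
    rcases hT hq with rfl | hq
    · refine ⟨_, h t v hv, t + s, ?_⟩
      rw [R.x_add]; group
    · exact ⟨R.x q t * v, mul_mem (R.x_mem_span hq t) hv, s, by group⟩

/-- `S` is closed under positive integral combinations. -/
def _root_.SpPresentation.IsClosedRoots (S : Set (Root n)) : Prop :=
  ∀ r ∈ S, ∀ p ∈ S, ∀ q : Root n, ∀ i j : ℕ, 0 < i → 0 < j →
    q.vec = (i : ℤ) • r.vec + (j : ℤ) • p.vec → q ∈ S

theorem map_combo (φ : (Fin n → ℤ) →+ ℤ) {q r p : Root n} {i j : ℤ}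
    (h : q.vec = i • r.vec + j • p.vec) : φ q.vec = i * φ r.vec + j * φ p.vec := by
  rw [h, map_add, map_zsmul, map_zsmul, smul_eq_mul, smul_eq_mul]

theorem isClosedRoots_pos (φ : (Fin n → ℤ) →+ ℤ) : IsClosedRoots {r : Root n | 0 < φ r.vec} := by
  intro r hr p hp q i j hi hj h
  rw [Set.mem_ofPred_eq] at *
  rw [map_combo φ h]
  positivity

/-- The matrices over a unipotent group of root elements. -/
theorem exists_root_of_mem_span (φ : (Fin n → ℤ) →+ ℤ) {S : Set (Root n)}
    (hpos : ∀ r ∈ S, 0 < φ r.vec) (hS : IsClosedRoots S) {v : G} (hv : v ∈ R.span S)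
    {a b : Fin n ⊕ Fin n}
    (h : ((R.π v : Matrix (Fin n ⊕ Fin n) (Fin n ⊕ Fin n) ℝ) - 1) a b ≠ 0) :
    ∃ q ∈ S, q.vec = wt a - wt b := by
  revert a b
  induction hv using R.span_induction with
  | one => intro a b h; simp at h
  | mul q hq t v _ ih =>
    intro a b h
    rw [map_mul, R.π_x, Submonoid.coe_mul, coe_spX] at h
    generalize (R.π v : Matrix (Fin n ⊕ Fin n) (Fin n ⊕ Fin n) ℝ) = M at *
    have e : (1 + t • q.mat) * M - 1 = (M - 1) + t • q.mat + t • (q.mat * (M - 1)) := by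
      rw [add_mul, one_mul, Matrix.smul_mul, mul_sub, smul_sub, mul_one]; abel
    rw [e] at h
    by_cases h1 : (M - 1) a b = 0
    · by_cases h2 : q.mat a b = 0
      · have h3 : (q.mat * (M - 1)) a b ≠ 0 := by
          intro h3
          simp [Matrix.add_apply, h1, h2, h3] at h
        rw [Matrix.mul_apply] at h3
        obtain ⟨c, -, hc⟩ := Finset.exists_ne_zero_of_sum_ne_zero h3
        have h4 := (q.mat_ne_zero_iff a c).1 (left_ne_zero_of_mul hc)
        obtain ⟨p, hp, hp'⟩ := ih (right_ne_zero_of_mul hc)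
        have hsum : wt a - wt b = ((1 : ℕ) : ℤ) • q.vec + ((1 : ℕ) : ℤ) • p.vec := by
          rw [hp', ← h4]; simp
        have hne : a ≠ b := by
          rintro rfl
          have h5 := congrArg φ hsum
          simp only [sub_self, map_zero, map_add, Nat.cast_one, one_smul] at h5
          have := hpos q hq
          have := hpos p hp
          omega
        obtain ⟨s, hs⟩ := Root.exists_vec_eq hne
        exact ⟨s, hS q hq p hp s 1 1 one_pos one_pos (hs.trans hsum), hs⟩
      · exact ⟨q, hq, ((q.mat_ne_zero_iff a b).1 h2).symm⟩
    · exact ih h1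

/-- `π` is injective on unipotent groups of root elements. -/
theorem eq_one_of_mem_span (φ : (Fin n → ℤ) →+ ℤ) {S : Set (Root n)}
    (hpos : ∀ r ∈ S, 0 < φ r.vec) (hS : IsClosedRoots S) {g : G} (hg : g ∈ R.span S)
    (h1 : R.π g = 1) : g = 1 := by
  induction hk : S.ncard using Nat.strong_induction_on generalizing S g with
  | _ k ih =>
  rcases S.eq_empty_or_nonempty with rfl | hne
  · have : R.span (∅ : Set (Root n)) = ⊥ := by simp [span]
    rw [this] at hg
    exact Subgroup.mem_bot.1 hg
  -- A root `r` of least value cannot be a positive combination of roots in `S`. So `S \ {r}` stays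
  -- closed, `X_r` normalizes its span, and `g = v x_r(t)` with `v` in that span.
  · obtain ⟨r, hr, hmin⟩ := S.toFinite.exists_minimalFor (fun r => φ r.vec) S hne
    have hmin' : ∀ q ∈ S, φ r.vec ≤ φ q.vec := fun q hq => by
      rcases le_total (φ r.vec) (φ q.vec) with h | h
      · exact h
      · exact hmin hq h
    have hr0 := hpos r hr
    set S' := S \ {r} with hS'
    have hlt : ∀ q : Root n, φ r.vec < φ q.vec → q ≠ r := by
      rintro q h rfl; exact lt_irrefl _ h
    have hpos' : ∀ q ∈ S', 0 < φ q.vec := fun q hq => hpos q hq.1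
    have hcl : IsClosedRoots S' := by
      intro q hq p hp s i j hi hj h
      refine ⟨hS q hq.1 p hp.1 s i j hi hj h, hlt s ?_⟩
      rw [map_combo φ h]
      have := hmin' q hq.1
      have := hpos p hp.1
      have hi' : (1 : ℤ) ≤ i := by exact_mod_cast hi
      have hj' : (1 : ℤ) ≤ j := by exact_mod_cast hj
      nlinarith
    have hnorm : ∀ t v, v ∈ R.span S' → R.x r t * v * (R.x r t)⁻¹ ∈ R.span S' := by
      intro t v hv
      refine R.x_conj_mem_span (fun q hq h => ?_) (fun q hq s i j hi hj h => ?_) t hv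
      · have := congrArg φ h
        rw [map_add, map_zero] at this
        have := hpos q hq.1
        omega
      · refine ⟨hS r hr q hq.1 s i j hi hj h, hlt s ?_⟩
        rw [map_combo φ h]
        have := hpos q hq.1
        have hi' : (1 : ℤ) ≤ i := by exact_mod_cast hi
        have hj' : (1 : ℤ) ≤ j := by exact_mod_cast hj
        nlinarith
    obtain ⟨v, hv, t, rfl⟩ := R.exists_eq_mul_x (S := S') (T := S) (r := r)
      (fun q hq => by
        by_cases h : q = r
        · exact Or.inl h
        · exact Or.inr ⟨hq, h⟩) hnorm hg
    have ht : t = 0 := by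
      by_contra ht
      have h2 : R.π v = spX r (-t) := by
        rw [map_mul, R.π_x] at h1
        rw [spX_neg, eq_inv_iff_mul_eq_one, h1]
      -- If `t ≠ 0`, the matrix of `v` would have a nonzero entry in the position of `r`, although
      -- `r` is not among the roots spanning `v`.
      have h3 : ((R.π v : Matrix (Fin n ⊕ Fin n) (Fin n ⊕ Fin n) ℝ) - 1) r.fst r.snd ≠ 0 := by
        rw [h2, coe_spX, add_sub_cancel_left, Matrix.smul_apply, smul_eq_mul]
        exact mul_ne_zero (neg_ne_zero.2 ht) ((r.mat_ne_zero_iff _ _).2 r.vec_eq.symm)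
      obtain ⟨q, hq, hq'⟩ := R.exists_root_of_mem_span φ hpos' hcl hv h3
      exact hq.2 (Root.vec_injective (hq'.trans r.vec_eq.symm))
    subst ht
    rw [R.x_zero, mul_one] at h1 ⊢
    refine ih S'.ncard ?_ hpos' hcl hv h1 rfl
    rw [← hk]
    exact Set.ncard_sdiff_singleton_lt_of_mem hr

/-- Two elements of a unipotent group of root elements with the same image are equal. -/
theorem eq_of_mem_span (φ : (Fin n → ℤ) →+ ℤ) {g h : G}
    (hg : g ∈ R.span {r | 0 < φ r.vec}) (hh : h ∈ R.span {r | 0 < φ r.vec})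
    (e : R.π g = R.π h) : g = h := by
  rw [← mul_inv_eq_one]
  exact R.eq_one_of_mem_span φ (fun r hr => hr) (isClosedRoots_pos φ) (mul_mem hg (inv_mem hh))
    (by rw [map_mul, map_inv, e, mul_inv_cancel])

/-- `w_r(t)` -/
noncomputable def w (r : Root n) (t : ℝ) : G := wElt R.x r t

/-- `h_r(t)` -/
noncomputable def h (r : Root n) (t : ℝ) : G := hElt R.x r t

theorem π_w (r : Root n) (t : ℝ) : R.π (R.w r t) = wElt spX r t := by
  simp [w, wElt, R.π_x]

theorem π_h (r : Root n) (t : ℝ) : R.π (R.h r t) = hElt spX r t := by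
  simp [h, hElt, wElt, R.π_x]

theorem w_neg (r : Root n) (t : ℝ) : R.w r (-t) = (R.w r t)⁻¹ := by
  simp [w, wElt, R.x_neg, mul_assoc, inv_neg]

theorem h_eq (r : Root n) (t : ℝ) : R.h r t = R.w r t * (R.w r 1)⁻¹ := by
  rw [← R.w_neg]; rfl

theorem h_one (r : Root n) : R.h r 1 = 1 := by rw [R.h_eq, mul_inv_cancel]

end Realization

/-! ### Functionals and the lifting of Weyl conjugation -/

section Functionals

variable {n : ℕ}

/-- The functional `(·, v)`. -/
def dotHom (v : Fin n → ℤ) : (Fin n → ℤ) →+ ℤ where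
  toFun u := u ⬝ᵥ v
  map_zero' := zero_dotProduct v
  map_add' a b := add_dotProduct a b v

@[simp] theorem dotHom_apply (u v : Fin n → ℤ) : dotHom v u = u ⬝ᵥ v := rfl

/-- A functional vanishing on `r` and positive on `p`, for nonproportional roots. -/
theorem exists_functional (r p : Root n) (h1 : p.vec ≠ r.vec) (h2 : p.vec ≠ -r.vec) :
    ∃ φ : (Fin n → ℤ) →+ ℤ, φ r.vec = 0 ∧ 0 < φ p.vec := by
  -- The component of `p` orthogonal to `r`, scaled to be integral. Its positivity is the strict
  -- Cauchy–Schwarz inequality, checked on the finitely many possible inner products.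
  refine ⟨dotHom ((r.vec ⬝ᵥ r.vec) • p.vec - (r.vec ⬝ᵥ p.vec) • r.vec), ?_, ?_⟩
  · simp only [dotHom_apply, dotProduct_sub, dotProduct_smul, smul_eq_mul]; ring
  · have hr := r.norm_eq
    have hp := p.norm_eq
    have e := dotProduct_comm p.vec r.vec
    have k1 := dot_self_pos (sub_ne_zero.2 h1)
    have k2 := dot_self_pos (v := p.vec + r.vec) (fun h => h2 (eq_neg_of_add_eq_zero_left h))
    have k3 : 0 ≤ (p.vec + p.vec - r.vec) ⬝ᵥ (p.vec + p.vec - r.vec) :=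
      Finset.sum_nonneg fun i _ => mul_self_nonneg _
    have k4 : 0 ≤ (p.vec + p.vec + r.vec) ⬝ᵥ (p.vec + p.vec + r.vec) :=
      Finset.sum_nonneg fun i _ => mul_self_nonneg _
    have k5 : 0 ≤ (p.vec - r.vec - r.vec) ⬝ᵥ (p.vec - r.vec - r.vec) :=
      Finset.sum_nonneg fun i _ => mul_self_nonneg _
    have k6 : 0 ≤ (p.vec + r.vec + r.vec) ⬝ᵥ (p.vec + r.vec + r.vec) :=
      Finset.sum_nonneg fun i _ => mul_self_nonneg _
    simp only [dotHom_apply, dotProduct_sub, dotProduct_smul, smul_eq_mul, sub_dotProduct,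
      add_dotProduct, dotProduct_add, e] at *
    generalize r.vec ⬝ᵥ p.vec = d at *
    have h3 : -4 < d := by omega
    have h4 : d < 4 := by omega
    rcases hr with hr | hr <;> rcases hp with hp | hp <;> rw [hr, hp] <;>
      interval_cases d <;> omega

end Functionals

namespace Realization

variable {n : ℕ} {G : Type*} [Group G] (R : Realization n G)

/-- As `φ` vanishes on `r` and `-r`, the combinations `ir + jq` keep the sign of `φ q`, so both root
subgroups `X_r` and `X_{-r}` normalize this span. -/
theorem w_conj_mem_span (φ : (Fin n → ℤ) →+ ℤ) {r : Root n} (hφ : φ r.vec = 0) (s : ℝ) {v : G}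
    (hv : v ∈ R.span {q | 0 < φ q.vec}) :
    R.w r s * v * (R.w r s)⁻¹ ∈ R.span {q | 0 < φ q.vec} := by
  have key : ∀ r : Root n, φ r.vec = 0 → ∀ t v, v ∈ R.span {q | 0 < φ q.vec} →
      R.x r t * v * (R.x r t)⁻¹ ∈ R.span {q | 0 < φ q.vec} := by
    intro r hr t v hv
    refine R.x_conj_mem_span (fun q hq h0 => ?_) (fun q hq q' i j hi hj h => ?_) t hv
    · have := congrArg φ h0
      rw [map_add, hr, map_zero, zero_add] at this
      rw [Set.mem_ofPred_eq, this] at hq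
      exact lt_irrefl _ hq
    · rw [Set.mem_ofPred_eq] at hq ⊢
      rw [map_combo φ h, hr, mul_zero, zero_add]
      positivity
  have hneg : φ r.neg.vec = 0 := by rw [r.vec_neg, map_neg, hφ, neg_zero]
  have := key r hφ s _ (key r.neg hneg (-s⁻¹) _ (key r hφ s v hv))
  convert this using 1
  simp only [w, wElt]; group

/-- Lifting a conjugation formula by `w_r(s)` from `Sp(2n, ℝ)`, for nonproportional roots. -/
theorem w_conj_x_of_ne {r p q : Root n} (h1 : p.vec ≠ r.vec) (h2 : p.vec ≠ -r.vec)
    (hq : q.vec = refl r p.vec) {s t u : ℝ}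
    (h : wElt spX r s * spX p t * (wElt spX r s)⁻¹ = spX q u) :
    R.w r s * R.x p t * (R.w r s)⁻¹ = R.x q u := by
  obtain ⟨φ, hφ, hφ'⟩ := exists_functional r p h1 h2
  refine R.eq_of_mem_span φ (R.w_conj_mem_span φ hφ s (R.x_mem_span hφ' t)) (R.x_mem_span ?_ u) ?_
  · rw [Set.mem_ofPred_eq, hq, refl, map_sub, map_zsmul, hφ, smul_zero, sub_zero]
    exact hφ'
  · rw [map_mul, map_mul, map_inv, R.π_w, R.π_x, R.π_x, h]

end Realization

/-! ### The rank two commutator and proportional roots -/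

section LongShortCommutator

variable {n : ℕ}

theorem HasWeight.mul_apply {v : Fin n → ℤ} {N : Matrix (Fin n ⊕ Fin n) (Fin n ⊕ Fin n) ℝ}
    (hN : HasWeight v N) (M : Matrix (Fin n ⊕ Fin n) (Fin n ⊕ Fin n) ℝ) {a b : Fin n ⊕ Fin n}
    (h : wt a - wt b = v) (d : Fin n ⊕ Fin n) : (N * M) a d = N a b * M b d := by
  rw [Matrix.mul_apply, Finset.sum_eq_single b]
  · intro c _ hc
    have : N a c = 0 := by
      by_contra h0
      exact hc (wt_injective (sub_right_injective ((hN a c h0).trans h.symm)))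
    rw [this, zero_mul]
  · simp

/-- The commutator formula for a long root `-2L` and a short root `L' - L''` at an angle of
135 degrees. -/
theorem exists_long_short_commutator {a b : Fin n ⊕ Fin n} (hab : b ≠ a) (hab' : b ≠ a.swap)
    {p q r₁ r₂ : Root n} (hp : p.vec = wt b - wt b.swap) (hq : q.vec = wt a - wt b)
    (h₁ : r₁.vec = wt a - wt b.swap) (h₂ : r₂.vec = wt a - wt a.swap) :
    ∃ α γ : ℝ, α ≠ 0 ∧ γ ≠ 0 ∧ ∀ s t : ℝ,
      ⁅(spX p s : Sp n), spX q t⁆ = spX r₁ (α * (s * t)) * spX r₂ (γ * (s * t ^ 2)) := by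
  have hX := hasWeight_mat p
  have hY := hasWeight_mat q
  have sX := isInfSymplectic_mat p
  have sY := isInfSymplectic_mat q
  have hAA := wt_dot_self a
  have hBB := wt_dot_self b
  have hAB : wt a ⬝ᵥ wt b = 0 := by
    rw [wt_dot, if_neg hab.symm, if_neg]
    rintro rfl; simp at hab'
  have hBA : wt b ⬝ᵥ wt a = 0 := by rw [dotProduct_comm, hAB]
  have e1 : p.vec + q.vec = r₁.vec := by rw [hp, hq, h₁]; simp; abel
  have e2 : q.vec + p.vec + q.vec = r₂.vec := by rw [hp, hq, h₂]; simp
  obtain ⟨α, hα⟩ : ∃ α : ℝ, p.mat * q.mat - q.mat * p.mat = α • r₁.mat := by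
    apply (sX.lie sY).eq_smul_mat
    rw [← e1]
    exact (hX.mul hY).sub (by rw [add_comm]; exact hY.mul hX)
  obtain ⟨γ, hγ⟩ : ∃ γ : ℝ, q.mat * p.mat * q.mat = γ • r₂.mat := by
    apply (sY.mul_mul sX).eq_smul_mat
    rw [← e2]
    exact (hY.mul hX).mul hY
  have hz : p.mat * q.mat * p.mat = 0 := by
    apply (hX.mul hY).mul_eq_zero_of_long hX
    simp only [hp, hq, wt_swap, add_dotProduct, dotProduct_add, sub_dotProduct, dotProduct_sub,
      neg_dotProduct, dotProduct_neg, hAA, hBB, hAB, hBA]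
    norm_num
  have hz' : r₁.mat * r₂.mat = 0 := by
    apply (hasWeight_mat r₁).mul_eq_zero_of_long (hasWeight_mat r₂)
    simp only [h₁, h₂, wt_swap, add_dotProduct, dotProduct_add, sub_dotProduct, dotProduct_sub,
      neg_dotProduct, dotProduct_neg, hAA, hBB, hAB, hBA]
    norm_num
  have y1 : q.mat a b ≠ 0 := (q.mat_ne_zero_iff _ _).2 hq.symm
  have x1 : p.mat b b.swap ≠ 0 := (p.mat_ne_zero_iff _ _).2 hp.symm
  have y2 : q.mat b.swap a.swap ≠ 0 := (q.mat_ne_zero_iff _ _).2 (by rw [hq]; simp; abel)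
  refine ⟨α, γ, ?_, ?_, ?_⟩
  · rintro rfl
    have h := congrFun (congrFun hα a) b.swap
    rw [zero_smul, Matrix.sub_apply, hY.mul_apply _ hq.symm] at h
    have h0 : (p.mat * q.mat) a b.swap = 0 := by
      rw [Matrix.mul_apply]
      apply Finset.sum_eq_zero
      intro c _
      have : p.mat a c = 0 := by
        by_contra h0
        have h3 := (p.mat_ne_zero_iff a c).1 h0
        rw [hp] at h3
        rcases wt_sub_eq h3.symm (swap_ne_self b).symm with ⟨h4, -⟩ | ⟨-, h4⟩
        · exact hab h4
        · exact hab (Sum.swap_leftInverse.injective h4)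
      rw [this, zero_mul]
    rw [h0, zero_sub, Matrix.zero_apply, neg_eq_zero] at h
    exact mul_ne_zero y1 x1 h
  · rintro rfl
    have h := congrFun (congrFun hγ a) a.swap
    rw [zero_smul, Matrix.mul_assoc, hY.mul_apply _ hq.symm, hX.mul_apply _ hp.symm] at h
    exact mul_ne_zero y1 (mul_ne_zero x1 y2) h
  · intro s t
    have hne : p.vec + q.vec ≠ 0 := by rw [e1]; exact r₁.vec_ne_zero
    apply spX_ext
    rw [coe_commutator p q hne, hα, hz, hγ, Submonoid.coe_mul, coe_spX, coe_spX]
    simp only [add_mul, mul_add, Matrix.smul_mul, Matrix.mul_smul, one_mul, mul_one, hz']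
    module

end LongShortCommutator

namespace Realization

variable {n : ℕ} {G : Type*} [Group G] (R : Realization n G)

theorem π_commutator (r p : Root n) (s t : ℝ) :
    R.π ⁅R.x r s, R.x p t⁆ = ⁅(spX r s : Sp n), spX p t⁆ := by
  simp [commutatorElement_def, R.π_x]

theorem commutator_mem {K : Subgroup G} {g h : G} (hg : g ∈ K) (hh : h ∈ K) : ⁅g, h⁆ ∈ K := by
  rw [commutatorElement_def]
  exact mul_mem (mul_mem (mul_mem hg hh) (inv_mem hg)) (inv_mem hh)

/-- In rank at least two, root elements are words in root elements for other roots. -/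
theorem exists_word (hn : 2 ≤ n) (r : Root n) : ∃ (φ : (Fin n → ℤ) →+ ℤ) (S : Set (Root n)),
    0 < φ r.vec ∧ (∀ q ∈ S, 0 < φ q.vec ∧ q.vec ≠ r.vec ∧ q.vec ≠ -r.vec) ∧
    ∀ u, R.x r u ∈ R.span S := by
  -- Every root has the form `a + b` or `2a` for weights `a` and `b ≠ ±a`, so it occurs on the right
  -- of the commutator of `2b` with `a - b`. Rank at least two supplies `b` in the long case.
  obtain ⟨a, b, hab, hab', hr⟩ : ∃ a b : Fin n ⊕ Fin n, b ≠ a ∧ b ≠ a.swap ∧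
      (r.vec = wt a - wt b.swap ∨ r.vec = wt a - wt a.swap) := by
    by_cases h : r.snd = r.fst.swap
    · have h2 : ∃ b : Fin n ⊕ Fin n, b ≠ r.fst ∧ b ≠ r.fst.swap := by
        have : Nontrivial (Fin n) := Fin.nontrivial_iff_two_le.2 hn
        rcases r.fst with i | i <;> obtain ⟨j, hj⟩ := exists_ne i <;>
          exact ⟨.inl j, by simp [hj], by simp [hj]⟩
      obtain ⟨b, hb, hb'⟩ := h2
      exact ⟨r.fst, b, hb, hb', Or.inr (by rw [r.vec_eq, h])⟩
    · refine ⟨r.fst, r.snd.swap, ?_, ?_, Or.inl (by rw [r.vec_eq]; simp)⟩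
      · rintro h'; apply h; rw [← h']; simp
      · intro h'; exact r.fst_ne_snd (Sum.swap_leftInverse.injective h').symm
  obtain ⟨p, hp⟩ := Root.exists_vec_eq (swap_ne_self b).symm
  obtain ⟨q, hq⟩ := Root.exists_vec_eq hab.symm
  obtain ⟨r₁, h₁⟩ : ∃ r : Root n, r.vec = wt a - wt b.swap :=
    Root.exists_vec_eq (by rintro rfl; simp at hab')
  obtain ⟨r₂, h₂⟩ := Root.exists_vec_eq (swap_ne_self a).symm
  obtain ⟨α, γ, hα, hγ, H⟩ := exists_long_short_commutator hab hab' hp hq h₁ h₂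
  have hAA := wt_dot_self a
  have hBB := wt_dot_self b
  have hAB : wt a ⬝ᵥ wt b = 0 := by
    rw [wt_dot, if_neg hab.symm, if_neg]
    rintro rfl; simp at hab'
  have hBA : wt b ⬝ᵥ wt a = 0 := by rw [dotProduct_comm, hAB]
  -- On `2b`, `a - b`, `a + b`, `2a` this functional takes the distinct positive values 2, 1, 3, 4.
  -- So all four lie in one unipotent group and no two are equal or opposite.
  set φ := dotHom (wt a + wt a + wt b) with hφ
  have φp : φ p.vec = 2 := by
    simp only [dotHom_apply, wt_swap, dotProduct_add, sub_dotProduct, neg_dotProduct, *]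
    norm_num
  have φq : φ q.vec = 1 := by
    simp only [dotHom_apply, dotProduct_add, sub_dotProduct, *]
    norm_num
  have φ1 : φ r₁.vec = 3 := by
    simp only [dotHom_apply, wt_swap, dotProduct_add, sub_dotProduct, neg_dotProduct, *]
    norm_num
  have φ2 : φ r₂.vec = 4 := by
    simp only [dotHom_apply, wt_swap, dotProduct_add, sub_dotProduct, neg_dotProduct, *]
    norm_num
  have hne : ∀ q r : Root n, φ q.vec ≠ φ r.vec → 0 < φ q.vec → 0 < φ r.vec →
      0 < φ q.vec ∧ q.vec ≠ r.vec ∧ q.vec ≠ -r.vec := by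
    intro q r h h1 h2
    refine ⟨h1, fun e => h (by rw [e]), fun e => ?_⟩
    rw [e, map_neg] at h1
    omega
  have mp : ∀ t, R.x p t ∈ R.span {r | 0 < φ r.vec} :=
    R.x_mem_span (by rw [Set.mem_ofPred_eq, φp]; norm_num)
  have mq : ∀ t, R.x q t ∈ R.span {r | 0 < φ r.vec} :=
    R.x_mem_span (by rw [Set.mem_ofPred_eq, φq]; norm_num)
  have m1 : ∀ t, R.x r₁ t ∈ R.span {r | 0 < φ r.vec} :=
    R.x_mem_span (by rw [Set.mem_ofPred_eq, φ1]; norm_num)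
  have m2 : ∀ t, R.x r₂ t ∈ R.span {r | 0 < φ r.vec} :=
    R.x_mem_span (by rw [Set.mem_ofPred_eq, φ2]; norm_num)
  have HG : ∀ s t, ⁅R.x p s, R.x q t⁆ = R.x r₁ (α * (s * t)) * R.x r₂ (γ * (s * t ^ 2)) := by
    intro s t
    refine R.eq_of_mem_span φ (commutator_mem (mp s) (mq t)) (mul_mem (m1 _) (m2 _)) ?_
    rw [R.π_commutator, H, map_mul, R.π_x, R.π_x]
  rcases hr with hr | hr
  · obtain rfl : r = r₁ := Root.vec_injective (hr.trans h₁.symm)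
    refine ⟨φ, {p, q, r₂}, by rw [φ1]; norm_num, ?_, fun u => ?_⟩
    · rintro _ (rfl | rfl | rfl) <;> apply hne <;> simp [φp, φq, φ1, φ2]
    · have h3 : R.x r u = ⁅R.x p (u / α), R.x q 1⁆ * (R.x r₂ (γ * (u / α * 1 ^ 2)))⁻¹ := by
        rw [HG, mul_inv_cancel_right]
        congr 1
        field_simp
      rw [h3]
      exact mul_mem (commutator_mem (R.x_mem_span (by simp) _) (R.x_mem_span (by simp) _))
        (inv_mem (R.x_mem_span (by simp) _))
  · obtain rfl : r = r₂ := Root.vec_injective (hr.trans h₂.symm)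
    refine ⟨φ, {p, q, r₁}, by rw [φ2]; norm_num, ?_, fun u => ?_⟩
    · rintro _ (rfl | rfl | rfl) <;> apply hne <;> simp [φp, φq, φ1, φ2]
    · have h3 : R.x r u = (R.x r₁ (α * (u / γ * 1)))⁻¹ * ⁅R.x p (u / γ), R.x q 1⁆ := by
        rw [HG, inv_mul_cancel_left]
        congr 1
        field_simp
      rw [h3]
      exact mul_mem (inv_mem (R.x_mem_span (by simp) _))
        (commutator_mem (R.x_mem_span (by simp) _) (R.x_mem_span (by simp) _))

/-- The reflection as an additive map. -/
def _root_.SpPresentation.reflHom (r : Root n) : (Fin n → ℤ) →+ (Fin n → ℤ) :=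
  AddMonoidHom.mk' (refl r) (refl_add r)

/-- Lifting a conjugation formula by `w_r(s)` from `Sp(2n, ℝ)`. -/
theorem w_conj_x_lift (hn : 2 ≤ n) {r p q : Root n} (hq : q.vec = refl r p.vec) {s t u : ℝ}
    (hs : s ≠ 0) (h : wElt spX r s * spX p t * (wElt spX r s)⁻¹ = spX q u) :
    R.w r s * R.x p t * (R.w r s)⁻¹ = R.x q u := by
  by_cases hpr : p.vec ≠ r.vec ∧ p.vec ≠ -r.vec
  · exact R.w_conj_x_of_ne hpr.1 hpr.2 hq h
  · have hpr : p.vec = r.vec ∨ p.vec = -r.vec := by tauto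
    obtain ⟨φ, S, hφ, hS, hw⟩ := R.exists_word hn p
    -- Here `p = ±r`. The word for `x_p(t)` uses only roots not proportional to `r`, where
    -- conjugation is known; the reflected roots are positive for `φ` composed with the reflection.
    set ψ := φ.comp (reflHom r) with hψ
    have hψ' : ∀ v, ψ (refl r v) = φ v := fun v => congrArg φ (refl_refl r v)
    refine R.eq_of_mem_span ψ ?_ (R.x_mem_span ?_ u) ?_
    · refine R.conj_mem_span (S := S) _ (fun p' hp' t' => ?_) (hw t)
      obtain ⟨q', hq'⟩ := exists_refl_vec r p'
      obtain ⟨η, -, h1, -⟩ := exists_wElt_conj_spX r p' q' hq' hs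
      obtain ⟨h2, h3, h4⟩ := hS p' hp'
      rw [R.w_conj_x_of_ne ?_ ?_ hq' (h1 t')]
      · apply R.x_mem_span
        rw [Set.mem_ofPred_eq, hq', hψ']
        exact h2
      · rcases hpr with e | e <;> rw [e] at h3 h4
        · exact h3
        · simpa using h4
      · rcases hpr with e | e <;> rw [e] at h3 h4
        · exact h4
        · exact h3
    · rw [Set.mem_ofPred_eq, hq, hψ']
      exact hφ
    · rw [map_mul, map_mul, map_inv, R.π_w, R.π_x, R.π_x, h]

/-! ### Actions on root subgroups and the subgroup `H` -/

/-- `g` conjugates `x_p(t)` to `x_q(η t)` and `x_{-p}(t)` to `x_{-q}(η⁻¹ t)`. -/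
def ActsBy (g : G) (p q : Root n) (η : ℝ) : Prop :=
  η ≠ 0 ∧ (∀ t, g * R.x p t * g⁻¹ = R.x q (η * t)) ∧
    ∀ t, g * R.x p.neg t * g⁻¹ = R.x q.neg (η⁻¹ * t)

variable {R}

theorem ActsBy.mul {g g' : G} {p q r : Root n} {η η' : ℝ} (h : R.ActsBy g q r η)
    (h' : R.ActsBy g' p q η') : R.ActsBy (g * g') p r (η * η') := by
  obtain ⟨h0, h1, h2⟩ := h
  obtain ⟨h0', h1', h2'⟩ := h'
  refine ⟨mul_ne_zero h0 h0', fun t => ?_, fun t => ?_⟩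
  · rw [mul_assoc η, ← h1, ← h1']; group
  · rw [mul_inv, mul_assoc η⁻¹, ← h2, ← h2']; group

theorem ActsBy.inv {g : G} {p q : Root n} {η : ℝ} (h : R.ActsBy g p q η) :
    R.ActsBy g⁻¹ q p η⁻¹ := by
  obtain ⟨h0, h1, h2⟩ := h
  refine ⟨inv_ne_zero h0, fun t => ?_, fun t => ?_⟩
  · have := h1 (η⁻¹ * t)
    rw [mul_inv_cancel_left₀ h0] at this
    rw [← this]; group
  · have := h2 (η⁻¹⁻¹ * t)
    rw [mul_inv_cancel_left₀ (inv_ne_zero h0)] at this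
    rw [← this]; group

theorem ActsBy.neg {g : G} {p q : Root n} {η : ℝ} (h : R.ActsBy g p q η) :
    R.ActsBy g p.neg q.neg η⁻¹ := by
  obtain ⟨h0, h1, h2⟩ := h
  exact ⟨inv_ne_zero h0, h2, by simpa using h1⟩

variable (R) in
theorem actsBy_one (p : Root n) : R.ActsBy 1 p p 1 := by
  refine ⟨one_ne_zero, fun t => ?_, fun t => ?_⟩ <;> simp

theorem ActsBy.w_conj {g : G} {p q : Root n} {η : ℝ} (h : R.ActsBy g p q η) (t : ℝ) :
    g * R.w p t * g⁻¹ = R.w q (η * t) := by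
  obtain ⟨h0, h1, h2⟩ := h
  have h3 : η⁻¹ * (-t⁻¹) = -(η * t)⁻¹ := by rw [mul_inv]; ring
  rw [w, w, wElt, wElt, ← h3, ← h1, ← h2]; group

/-- Since `h_p(t) = w_p(t) w_p(1)⁻¹`, the scalar `η` enters twice. It does not cancel unless `h_q`
is multiplicative. -/
theorem ActsBy.h_conj {g : G} {p q : Root n} {η : ℝ} (h : R.ActsBy g p q η) (t : ℝ) :
    g * R.h p t * g⁻¹ = R.h q (η * t) * (R.h q η)⁻¹ := by
  have h1 := h.w_conj t
  have h2 := h.w_conj 1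
  rw [mul_one] at h2
  rw [R.h_eq, R.h_eq, R.h_eq, ← h1, ← h2]; group

theorem exists_actsBy_w (hn : 2 ≤ n) {r p q : Root n} (hq : q.vec = refl r p.vec) {s : ℝ}
    (hs : s ≠ 0) : ∃ η, R.ActsBy (R.w r s) p q η := by
  obtain ⟨η, h0, h1, h2⟩ := exists_wElt_conj_spX r p q hq hs
  refine ⟨η, h0, fun t => R.w_conj_x_lift hn hq hs (h1 t), fun t => R.w_conj_x_lift hn ?_ hs (h2 t)⟩
  rw [q.vec_neg, p.vec_neg, hq, refl_neg]

/-- Being a product of two `w_r`'s, `h_r(s)` scales `X_p` by some factor. Projecting to `Sp n`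
identifies the factor, because root elements there determine their parameter. -/
theorem actsBy_h (hn : 2 ≤ n) (r p : Root n) {s : ℝ} (hs : s ≠ 0) :
    R.ActsBy (R.h r s) p p (s ^ (p.vec ⬝ᵥ r.co)) := by
  obtain ⟨q, hq⟩ := exists_refl_vec r p
  obtain ⟨η, hη⟩ := exists_actsBy_w (R := R) hn hq (neg_ne_zero.2 one_ne_zero)
  obtain ⟨η', hη'⟩ := exists_actsBy_w (R := R) hn (r := r) (p := q) (q := p)
    (by rw [hq, refl_refl]) hs
  have h1 : R.ActsBy (R.h r s) p p (η' * η) := hη'.mul hη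
  have h2 := congrArg R.π (h1.2.1 1)
  rw [map_mul, map_mul, map_inv, R.π_h, R.π_x, R.π_x, hElt_conj_spX r p hs] at h2
  have h3 := spX_injective p h2
  rw [mul_one, mul_one] at h3
  rw [h3]
  exact h1

variable (R) in
/-- The subgroup generated by the `h_r(t)`. -/
def H : Subgroup G := Subgroup.closure {g | ∃ r t, t ≠ 0 ∧ g = R.h r t}

theorem h_mem_H (r : Root n) {t : ℝ} (ht : t ≠ 0) : R.h r t ∈ R.H :=
  Subgroup.subset_closure ⟨r, t, ht, rfl⟩

theorem exists_actsBy_of_mem_H (hn : 2 ≤ n) {z : G} (hz : z ∈ R.H) (p : Root n) :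
    ∃ χ, R.ActsBy z p p χ := by
  induction hz using Subgroup.closure_induction with
  | mem z hz =>
    obtain ⟨r, t, ht, rfl⟩ := hz
    exact ⟨_, actsBy_h hn r p ht⟩
  | one => exact ⟨1, R.actsBy_one p⟩
  | mul g g' _ _ h h' =>
    obtain ⟨χ, h⟩ := h
    obtain ⟨χ', h'⟩ := h'
    exact ⟨_, h.mul h'⟩
  | inv g _ h =>
    obtain ⟨χ, h⟩ := h
    exact ⟨_, h.inv⟩

/-- Such an element scales each root subgroup, and the scalar is 1 because it is already visible in
`Sp n`. The root elements generate `G`. -/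
theorem mem_center_of_mem_H (hn : 2 ≤ n) {z : G} (hz : z ∈ R.H) (h1 : R.π z = 1) :
    z ∈ Subgroup.center G := by
  have key : (⊤ : Subgroup G) ≤ Subgroup.centralizer {z} := by
    rw [← R.generates, Subgroup.closure_le]
    rintro _ ⟨r, t, rfl⟩
    rw [SetLike.mem_coe, Subgroup.mem_centralizer_singleton_iff]
    obtain ⟨χ, h0, h2, -⟩ := exists_actsBy_of_mem_H hn hz r
    have h3 := congrArg R.π (h2 t)
    rw [map_mul, map_mul, h1, one_mul, map_inv, h1, inv_one, mul_one, R.π_x, R.π_x] at h3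
    have h4 := h2 t
    rw [← spX_injective r h3, mul_inv_eq_iff_eq_mul] at h4
    exact h4.symm
  rw [Subgroup.mem_center_iff]
  intro g
  exact (Subgroup.mem_centralizer_singleton_iff.1 (key (Subgroup.mem_top g)))

end Realization

section ReflectionsOfWeights

variable {n : ℕ}

theorem refl_wt_of_sub {r : Root n} {a b : Fin n ⊕ Fin n} (h : r.vec = wt a - wt b) :
    refl r (wt a) = wt b := by
  rw [refl, (dot_co_of_wt_sub h.symm).1, h]; simp

theorem refl_wt_of_sub' {r : Root n} {a b : Fin n ⊕ Fin n} (h : r.vec = wt a - wt b) :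
    refl r (wt b) = wt a := by
  rw [refl, (dot_co_of_wt_sub h.symm).2, h]; simp

theorem refl_injective (r : Root n) : Function.Injective (refl r) :=
  Function.LeftInverse.injective (refl_refl r)

end ReflectionsOfWeights

/-! ### Multiplicativity of the `h_r` -/

namespace Realization

variable {n : ℕ} {G : Type*} [Group G] {R : Realization n G}

variable (R) in
/-- `h_r` is multiplicative. -/
def Mult (r : Root n) : Prop := ∀ s t : ℝ, s ≠ 0 → t ≠ 0 → R.h r s * R.h r t = R.h r (s * t)

theorem Mult.commute {r : Root n} (h : R.Mult r) {s t : ℝ} (hs : s ≠ 0) (ht : t ≠ 0) :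
    R.h r s * R.h r t = R.h r t * R.h r s := by
  rw [h s t hs ht, h t s ht hs, mul_comm]

/-- The Weyl group preserves multiplicativity. -/
theorem Mult.w_conj {g : G} {p q : Root n} {η : ℝ} (hp : R.Mult p) (h : R.ActsBy g p q η) {t : ℝ}
    (ht : t ≠ 0) : g * R.h p t * g⁻¹ = R.h q t := by
  have h0 := h.1
  have e1 : ∀ t, R.h q (η * t) = g * R.h p t * g⁻¹ * R.h q η := fun t => by
    rw [h.h_conj, inv_mul_cancel_right]
  -- Taking the parameter `η⁻¹` and using `h_q(1) = 1` expresses the unknown `h_q(η)` through `h_p`,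
  -- where multiplicativity applies.
  have e2 := e1 η⁻¹
  rw [mul_inv_cancel₀ h0, R.h_one] at e2
  have e3 : R.h q η = g * (R.h p η⁻¹)⁻¹ * g⁻¹ := by
    rw [eq_inv_of_mul_eq_one_right e2.symm]; group
  have e4 : (R.h p η⁻¹)⁻¹ = R.h p η := by
    rw [inv_eq_iff_mul_eq_one, hp _ _ (inv_ne_zero h0) h0, inv_mul_cancel₀ h0, R.h_one]
  have e5 := e1 (η⁻¹ * t)
  rw [mul_inv_cancel_left₀ h0, e3, e4] at e5
  rw [e5]
  have e6 : R.h p (η⁻¹ * t) * R.h p η = R.h p t := by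
    rw [hp _ _ (mul_ne_zero (inv_ne_zero h0) ht) h0]
    congr 1
    field_simp
  rw [← e6]; group

theorem Mult.of_refl (hn : 2 ≤ n) {r p q : Root n} (hp : R.Mult p) (hq : q.vec = refl r p.vec) :
    R.Mult q := by
  obtain ⟨η, h⟩ := exists_actsBy_w (R := R) hn hq one_ne_zero
  intro s t hs ht
  rw [← hp.w_conj h hs, ← hp.w_conj h ht, ← hp.w_conj h (mul_ne_zero hs ht), ← hp s t hs ht]
  group

/-- The Weyl group is transitive on short roots: one reflection moves the first weight to `a`, and a
second, orthogonal to `a`, moves the other weight to `b`. -/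
theorem Mult.short (hn : 2 ≤ n) {p : Root n} (hp : R.Mult p) {c d : Fin n ⊕ Fin n}
    (hcd : d ≠ c.swap) (hpv : p.vec = wt c - wt d) {r : Root n} {a b : Fin n ⊕ Fin n}
    (hab : b ≠ a.swap) (hr : r.vec = wt a - wt b) : R.Mult r := by
  have hba : b ≠ a := by rintro rfl; exact r.vec_ne_zero (by rw [hr, sub_self])
  obtain ⟨p', d', hp', hd', hp'v⟩ : ∃ (p' : Root n) (d' : Fin n ⊕ Fin n),
      R.Mult p' ∧ d' ≠ a.swap ∧ p'.vec = wt a - wt d' := by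
    by_cases hca : c = a
    · exact ⟨p, d, hp, hca ▸ hcd, hca ▸ hpv⟩
    · obtain ⟨q, hq⟩ := Root.exists_vec_eq hca
      obtain ⟨d', hd'⟩ := exists_refl_wt q d
      obtain ⟨p', hp'⟩ := exists_refl_vec q p
      refine ⟨p', d', hp.of_refl hn hp', ?_, ?_⟩
      · rintro rfl
        apply hcd
        apply wt_injective
        apply refl_injective q
        rw [← hd', wt_swap, wt_swap, refl_neg, refl_wt_of_sub hq]
      · rw [hp', hpv, refl_sub, refl_wt_of_sub hq, hd']
  by_cases hdb : d' = b
  · subst hdb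
    obtain rfl : p' = r := Root.vec_injective (hp'v.trans hr.symm)
    exact hp'
  · obtain ⟨q, hq⟩ := Root.exists_vec_eq hdb
    refine hp'.of_refl hn (r := q) ?_
    have hda : d' ≠ a := by rintro rfl; exact p'.vec_ne_zero (by rw [hp'v, sub_self])
    have h0 : wt a ⬝ᵥ q.vec = 0 := by
      rw [hq, dotProduct_sub, wt_dot, wt_dot, if_neg hda.symm, if_neg hba.symm, if_neg, if_neg]
      · rfl
      · rintro rfl; simp at hab
      · rintro rfl; simp at hd'
    rw [hp'v, refl_sub, refl_eq_self h0, refl_wt_of_sub hq, hr]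

theorem Mult.long (hn : 2 ≤ n) {p : Root n} (hp : R.Mult p) {c : Fin n ⊕ Fin n}
    (hpv : p.vec = wt c - wt c.swap) {r : Root n} {a : Fin n ⊕ Fin n}
    (hr : r.vec = wt a - wt a.swap) : R.Mult r := by
  by_cases hca : c = a
  · subst hca
    obtain rfl : p = r := Root.vec_injective (hpv.trans hr.symm)
    exact hp
  · obtain ⟨q, hq⟩ := Root.exists_vec_eq hca
    refine hp.of_refl hn (r := q) ?_
    rw [hpv, refl_sub, wt_swap, refl_neg, refl_wt_of_sub hq, hr, wt_swap]

theorem h_conj_h (hn : 2 ≤ n) (r p : Root n) {s : ℝ} (hs : s ≠ 0) (t : ℝ) :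
    R.h r s * R.h p t * (R.h r s)⁻¹ =
      R.h p (s ^ (p.vec ⬝ᵥ r.co) * t) * (R.h p (s ^ (p.vec ⬝ᵥ r.co)))⁻¹ :=
  (actsBy_h hn r p hs).h_conj t

/-- Multiplicativity for a short root and `h(-1)² = 1` imply multiplicativity for a long root. -/
theorem Mult.of_short_of_sq (hn : 2 ≤ n) {p r : Root n} (hp : R.Mult p)
    {a b : Fin n ⊕ Fin n} (hab : b ≠ a.swap) (hpv : p.vec = wt a - wt b)
    (hr : r.vec = wt a - wt a.swap) (h1 : R.h r (-1) * R.h r (-1) = 1) : R.Mult r := by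
  have hba : b ≠ a := by rintro rfl; exact p.vec_ne_zero (by rw [hpv, sub_self])
  have hAB : wt a ⬝ᵥ wt b = 0 := by
    rw [wt_dot, if_neg hba.symm, if_neg]
    rintro rfl; simp at hab
  have hBA : wt b ⬝ᵥ wt a = 0 := by rw [dotProduct_comm, hAB]
  have hAA := wt_dot_self a
  have hBB := wt_dot_self b
  have k1 : r.vec ⬝ᵥ p.co = 2 := by
    have := p.norm_mul_dot_co r.vec
    rw [hpv, hr] at this
    rw [hr]
    simp only [wt_swap, sub_dotProduct, dotProduct_sub, neg_dotProduct, hAA, hBB, hAB, hBA] at this ⊢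
    omega
  have k2 : p.vec ⬝ᵥ r.co = 1 := by
    have := r.norm_mul_dot_co p.vec
    rw [hpv, hr] at this
    rw [hpv]
    simp only [wt_swap, sub_dotProduct, dotProduct_sub, neg_dotProduct, dotProduct_neg,
      hAA, hBA] at this ⊢
    omega
  -- Since `⟨p, r^∨⟩ = 1`, conjugating `h_p(s)` by `h_r(t)` gives `h_p(ts) h_p(t)⁻¹`, which is
  -- `h_p(s)` by multiplicativity of the short root.
  have comm : ∀ s t : ℝ, s ≠ 0 → t ≠ 0 → R.h p s * R.h r t = R.h r t * R.h p s := by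
    intro s t hs ht
    have e := h_conj_h (R := R) hn r p ht s
    rw [k2, zpow_one, ← hp t s ht hs, hp.commute ht hs, mul_inv_cancel_right,
      mul_inv_eq_iff_eq_mul] at e
    exact e.symm
  -- Since `⟨r, p^∨⟩ = 2`, the same conjugation the other way produces squares; as the two elements
  -- commute, it reads as multiplicativity with one argument a square.
  have sq : ∀ s t : ℝ, s ≠ 0 → t ≠ 0 → R.h r t * R.h r (s ^ 2) = R.h r (s ^ 2 * t) := by
    intro s t hs ht
    have e := h_conj_h (R := R) hn p r hs t
    rw [comm s t hs ht, mul_inv_cancel_right, k1, eq_mul_inv_iff_mul_eq] at e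
    exact e
  have hc : ∀ s t : ℝ, s ≠ 0 → t ≠ 0 → R.h r s * R.h r t = R.h r t * R.h r s := by
    intro s t hs ht
    have e := h_conj_h (R := R) hn r r hs t
    rw [r.vec_dot_co, mul_inv_eq_iff_eq_mul, zpow_ofNat, ← sq s t hs ht,
      mul_inv_cancel_right] at e
    exact e
  -- Positive reals are squares. Only the product of two negative arguments remains, and `h_r(-1)² =
  -- 1` takes care of it.
  have pos : ∀ u t : ℝ, 0 < u → t ≠ 0 → R.h r u * R.h r t = R.h r (u * t) := by
    intro u t hu ht
    rw [hc u t hu.ne' ht]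
    have := sq (Real.sqrt u) t (Real.sqrt_pos.2 hu).ne' ht
    rwa [Real.sq_sqrt hu.le] at this
  intro s t hs ht
  rcases lt_or_gt_of_ne hs with hs' | hs'
  · rcases lt_or_gt_of_ne ht with ht' | ht'
    · have e1 := pos (-s) (-1) (by linarith) (by norm_num)
      have e2 := pos (-t) (-1) (by linarith) (by norm_num)
      have e3 := pos (-s) (-t) (by linarith) (neg_ne_zero.2 ht)
      simp only [mul_neg, mul_one, neg_mul, neg_neg] at e1 e2 e3
      rw [← e1, ← e2, ← e3, hc (-t) (-1) (neg_ne_zero.2 ht) (by norm_num)]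
      rw [mul_assoc, ← mul_assoc (R.h r (-1)), h1, one_mul]
    · rw [hc s t hs ht, pos t s ht' hs, mul_comm]
  · exact pos s t hs' ht

theorem h_comm (hn : 2 ≤ n) (hM : ∀ r, R.Mult r) (r p : Root n) {s t : ℝ} (hs : s ≠ 0) (ht : t ≠ 0) :
    R.h r s * R.h p t = R.h p t * R.h r s := by
  have e := h_conj_h (R := R) hn r p hs t
  have h0 : s ^ (p.vec ⬝ᵥ r.co) ≠ 0 := zpow_ne_zero _ hs
  rw [← hM p _ _ h0 ht, (hM p).commute h0 ht, mul_inv_cancel_right, mul_inv_eq_iff_eq_mul] at e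
  exact e

/-- The relation between the `h_r` under reflections. -/
theorem h_refl (hn : 2 ≤ n) (hM : ∀ r, R.Mult r) {r p q : Root n} (hq : q.vec = refl p r.vec) {t : ℝ} (ht : t ≠ 0) :
    R.h q t = R.h r t * R.h p (t ^ (-(p.vec ⬝ᵥ r.co))) := by
  obtain ⟨η, h⟩ := exists_actsBy_w (R := R) hn hq one_ne_zero
  rw [← (hM r).w_conj h ht]
  -- With `w = w_p(1)`, write `w h_r(t) w⁻¹ = h_r(t) · (h_r(t)⁻¹ w h_r(t)) w⁻¹`. The bracket is
  -- `w_p` with a rescaled parameter, so the last two factors form an `h_p`.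
  have h2 := (actsBy_h (R := R) hn r p ht).inv.w_conj 1
  rw [mul_one, ← zpow_neg, inv_inv] at h2
  rw [R.h_eq p, ← h2]; group

end Realization

/-! ### Reflection relations and the stabilizer chain -/

section WeylGroup

variable {n : ℕ}

/-- The roots in the coordinates `≥ k`. -/
def tailRoots (n k : ℕ) : Set (Root n) := {r | ∀ i : Fin n, (i : ℕ) < k → r.vec i = 0}

theorem mem_tailRoots_of_refl {k : ℕ} {p r q : Root n} (hp : p ∈ tailRoots n k)
    (hr : r ∈ tailRoots n k) (hq : q.vec = refl p r.vec) : q ∈ tailRoots n k := by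
  intro i hi
  rw [hq, refl, Pi.sub_apply, Pi.smul_apply, hp i hi, hr i hi]; simp

theorem mem_tailRoots_of_neg {k : ℕ} {p r : Root n} (hp : p ∈ tailRoots n k)
    (h : p.vec = r.vec ∨ p.vec = -r.vec) : r ∈ tailRoots n k := by
  intro i hi
  have := hp i hi
  rcases h with h | h <;> rw [h] at this
  · exact this
  · simpa using this

theorem mem_tailRoots_succ {k : ℕ} (hk : k < n) {r : Root n} (hr : r ∈ tailRoots n k)
    (h : r.vec ⬝ᵥ wt (.inl ⟨k, hk⟩) = 0) : r ∈ tailRoots n (k + 1) := by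
  intro i hi
  rcases Nat.lt_succ_iff_lt_or_eq.1 hi with h' | h'
  · exact hr i h'
  · have : i = ⟨k, hk⟩ := Fin.ext h'
    simpa [wt, this] using h

theorem exists_root_of_dot_ne_zero {p : Root n} {c : Fin n ⊕ Fin n} (h : p.vec ⬝ᵥ wt c ≠ 0) :
    ∃ (d : Fin n ⊕ Fin n) (r : Root n), d ≠ c ∧ r.vec = wt c - wt d ∧
      (p.vec = r.vec ∨ p.vec = -r.vec) := by
  have h0 : wt c ⬝ᵥ p.co ≠ 0 := by
    intro h0
    have := p.norm_mul_dot_co (wt c)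
    rw [h0, mul_zero, dotProduct_comm] at this
    omega
  rcases dot_co_trichotomy p c with h1 | ⟨d, hd⟩ | ⟨d, hd⟩
  · exact absurd h1 h0
  · refine ⟨d, p, ?_, hd.symm, Or.inl rfl⟩
    rintro rfl; exact p.vec_ne_zero (by rw [← hd, sub_self])
  · refine ⟨d, p.neg, ?_, ?_, Or.inr ?_⟩
    · rintro rfl; exact p.vec_ne_zero (by rw [← hd, sub_self])
    · rw [p.vec_neg, ← hd, neg_sub]
    · rw [p.vec_neg, neg_neg]

theorem wt_dot_eq_zero {a b : Fin n ⊕ Fin n} (h : a ≠ b) (h' : a ≠ b.swap) : wt a ⬝ᵥ wt b = 0 := by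
  rw [wt_dot, if_neg h, if_neg h']

/-- Schreier's lemma along the stabilizer chain of the coordinate vectors, for a group generated
by elements satisfying the relations of reflections. -/
theorem mem_closure_tailRoots_succ {Q : Type*} [Group Q] (s : Root n → Q)
    (hsq : ∀ r, s r * s r = 1) (hneg : ∀ r p : Root n, p.vec = r.vec ∨ p.vec = -r.vec → s p = s r)
    (hconj : ∀ p r q : Root n, q.vec = refl p r.vec → s p * s r = s q * s p) {k : ℕ} (hk : k < n)
    {g : Q} (hg : g ∈ Subgroup.closure (s '' tailRoots n k)) :
    g ∈ Subgroup.closure (s '' tailRoots n (k + 1)) ∨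
      ∃ (c : Fin n ⊕ Fin n) (r : Root n), c ≠ .inl ⟨k, hk⟩ ∧ r ∈ tailRoots n k ∧
        r.vec = wt (.inl ⟨k, hk⟩) - wt c ∧
        ∃ m ∈ Subgroup.closure (s '' tailRoots n (k + 1)), g = s r * m := by
  set e : Fin n ⊕ Fin n := .inl ⟨k, hk⟩ with he
  set K := Subgroup.closure (s '' tailRoots n (k + 1)) with hK
  have memK : ∀ r ∈ tailRoots n (k + 1), s r ∈ K := fun r hr =>
    Subgroup.subset_closure ⟨r, hr, rfl⟩
  have hcancel : ∀ r g, s r * (s r * g) = g := fun r g => by rw [← mul_assoc, hsq, one_mul]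
  -- The coset representative taking `e` to `c` is `s_{e - c}`. Left multiplication by `s_p` must be
  -- rewritten as a representative times an element of `K`, which is generated by reflections
  -- orthogonal to `e`.
  have step : ∀ p ∈ tailRoots n k, ∀ g : Q, (g ∈ K ∨ ∃ (c : Fin n ⊕ Fin n) (r : Root n),
      c ≠ e ∧ r ∈ tailRoots n k ∧ r.vec = wt e - wt c ∧ ∃ m ∈ K, g = s r * m) →
      (s p * g ∈ K ∨ ∃ (c : Fin n ⊕ Fin n) (r : Root n),
      c ≠ e ∧ r ∈ tailRoots n k ∧ r.vec = wt e - wt c ∧ ∃ m ∈ K, s p * g = s r * m) := by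
    rintro p hp g (hg | ⟨c, r, hc, hr, hrv, m, hm, rfl⟩)
    · by_cases h0 : p.vec ⬝ᵥ wt e = 0
      · exact Or.inl (mul_mem (memK p (mem_tailRoots_succ hk hp h0)) hg)
      · obtain ⟨c, r, hc, hr, hpr⟩ := exists_root_of_dot_ne_zero h0
        exact Or.inr ⟨c, r, hc, mem_tailRoots_of_neg hp hpr, hr, g, hg, by rw [hneg r p hpr]⟩
    · by_cases h0 : p.vec ⬝ᵥ wt c = 0
      · obtain ⟨q, hq⟩ := exists_refl_vec r p
        have hqe : q.vec ⬝ᵥ wt e = 0 := by rw [hq, refl_dot, refl_wt_of_sub hrv, h0]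
        refine Or.inr ⟨c, r, hc, hr, hrv, s q * m,
          mul_mem (memK q (mem_tailRoots_succ hk (mem_tailRoots_of_refl hr hp hq) hqe)) hm, ?_⟩
        have h2 := hconj r p q hq
        have h3 : s p * s r = s r * s q := by
          rw [← hcancel r (s p), h2, mul_assoc, mul_assoc, hsq, mul_one]
        rw [← mul_assoc, h3, mul_assoc]
      -- Up to sign `p = c - d`, so the new representative should be `s_{e - d}`. The cases `d = e`,
      -- `c = -e` and `d = -e` need separate relations; otherwise `p` is orthogonal to `e` and `s_p`
      -- simply moves past the representative.
      · obtain ⟨d, p', hd, hpv', hpp'⟩ := exists_root_of_dot_ne_zero h0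
        rw [hneg p' p hpp']
        replace hp := mem_tailRoots_of_neg hp hpp'
        clear h0 hpp' p
        rename' p' => p, hpv' => hpv
        by_cases hde : d = e
        · subst hde
          left
          rw [hneg r p (Or.inr (by rw [hpv, hrv, neg_sub])), hcancel]
          exact hm
        by_cases hce : c = e.swap
        · obtain ⟨r', hr'⟩ := Root.exists_vec_eq (Ne.symm hde)
          have hdc : d ≠ e.swap := hce ▸ hd
          have hrd : r.vec ⬝ᵥ wt d = 0 := by
            rw [hrv, hce, sub_dotProduct, wt_dot_eq_zero (Ne.symm hde), wt_dot_eq_zero, sub_zero]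
            · exact hdc.symm
            · intro h; exact hde (Sum.swap_leftInverse.injective h).symm
            · intro h; apply hdc; rw [h]; simp
          have e1 : r'.vec = refl r p.vec := by
            rw [hpv, refl_sub, refl_wt_of_sub' hrv, refl_eq_self (by rw [dotProduct_comm, hrd]), hr']
          obtain ⟨q, hq⟩ := exists_refl_vec r' r
          have hr'k := mem_tailRoots_of_refl hr hp e1
          have hqe : q.vec ⬝ᵥ wt e = 0 := by rw [hq, refl_dot, refl_wt_of_sub hr', hrd]
          refine Or.inr ⟨d, r', hde, hr'k, hr', s q * m,
            mul_mem (memK q (mem_tailRoots_succ hk (mem_tailRoots_of_refl hr'k hr hq) hqe)) hm, ?_⟩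
          have h1 := hconj r p r' e1
          have h2 := hconj r' q r (by rw [hq, refl_refl])
          rw [← mul_assoc (s r'), h2, ← mul_assoc, ← hcancel r (s p), h1, mul_assoc (s r),
            mul_assoc (s r'), hsq, mul_one]
        · have hrc : wt e ⬝ᵥ wt c = 0 :=
            wt_dot_eq_zero hc.symm (by rintro h; apply hce; rw [h]; simp)
          by_cases hde' : d = e.swap
          · obtain ⟨t, ht⟩ := Root.exists_vec_eq (Ne.symm hde)
            have htk : t ∈ tailRoots n k := by
              intro i hi
              have : t.vec = r.vec + p.vec := by rw [ht, hrv, hpv]; abel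
              rw [this, Pi.add_apply, hr i hi, hp i hi, add_zero]
            have htc : t.vec ⬝ᵥ wt c = 0 := by
              rw [ht, hde', wt_swap, sub_neg_eq_add, add_dotProduct, hrc, add_zero]
            have e1 : p.neg.vec = refl t r.vec := by
              rw [hrv, refl_sub, refl_wt_of_sub ht,
                refl_eq_self (by rw [dotProduct_comm, htc]), p.vec_neg, hpv, neg_sub]
            obtain ⟨q, hq⟩ := exists_refl_vec r t
            have hqe : q.vec ⬝ᵥ wt e = 0 := by rw [hq, refl_dot, refl_wt_of_sub hrv, htc]
            refine Or.inr ⟨d, t, hde, htk, ht, s q * m,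
              mul_mem (memK q (mem_tailRoots_succ hk (mem_tailRoots_of_refl hr htk hq) hqe)) hm, ?_⟩
            -- With `t = 2e` one has `s_p = s_t s_r s_t`, hence `s_p s_r = s_t (s_r s_t s_r) = s_t
            -- s_q`.
            have h1 := hconj t r p.neg e1
            rw [hneg p p.neg (Or.inr p.vec_neg)] at h1
            have h2 := hconj r t q hq
            have h3 : s p = s t * (s r * s t) := by
              rw [← mul_assoc, h1, mul_assoc, hsq, mul_one]
            rw [h3, h2, mul_assoc, mul_assoc, hcancel]
          · have hpe : p.vec ⬝ᵥ wt e = 0 := by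
              rw [hpv, sub_dotProduct, wt_dot_eq_zero hc hce, wt_dot_eq_zero hde hde', sub_zero]
            obtain ⟨r', hr'⟩ := exists_refl_vec p r
            refine Or.inr ⟨d, r', hde, mem_tailRoots_of_refl hp hr hr', ?_, s p * m,
              mul_mem (memK p (mem_tailRoots_succ hk hp hpe)) hm, ?_⟩
            · rw [hr', hrv, refl_sub, refl_wt_of_sub hpv,
                refl_eq_self (by rw [dotProduct_comm, hpe])]
            · rw [← mul_assoc, hconj p r r' hr', mul_assoc]
  induction hg using Subgroup.closure_induction_left with
  | one => exact Or.inl (one_mem _)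
  | mul_left y hy g _ ih =>
    obtain ⟨p, hp, rfl⟩ := hy
    exact step p hp g ih
  | inv_mul_cancel y hy g _ ih =>
    obtain ⟨p, hp, rfl⟩ := hy
    rw [inv_eq_of_mul_eq_one_right (hsq p)]
    exact step p hp g ih

end WeylGroup

/-! ### The torus `H` and the monomial subgroup `N` -/

namespace Realization

variable {n : ℕ} {G : Type*} [Group G] {R : Realization n G}

section Torus

variable (R) in
/-- `h_r` as a homomorphism, if it is multiplicative. -/
noncomputable def hHom (hM : ∀ r, R.Mult r) (r : Root n) : ℝˣ →* G :=
  MonoidHom.mk' (fun t => R.h r t) fun s t => by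
    rw [Units.val_mul, hM r s t s.ne_zero t.ne_zero]

variable (R) in
/-- The torus parametrized by the coroots of the long roots. -/
noncomputable def torus (hn : 2 ≤ n) (hM : ∀ r, R.Mult r) : (Fin n → ℝˣ) →* G :=
  MonoidHom.noncommPiCoprod (fun i => R.hHom hM (.long i)) fun i j _ s t =>
    h_comm hn hM (.long i) (.long j) s.ne_zero t.ne_zero

theorem torus_mulSingle (hn : 2 ≤ n) (hM : ∀ r, R.Mult r) (i : Fin n) (t : ℝˣ) :
    R.torus hn hM (Pi.mulSingle i t) = R.h (.long i) t :=
  MonoidHom.noncommPiCoprod_mulSingle _ _ _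

/-- The coroots `L_i` of the roots `2L_i` span all coroots over `ℤ`; `h_refl` turns this into
products of the corresponding `h`'s. -/
theorem H_le_range_torus (hn : 2 ≤ n) (hM : ∀ r, R.Mult r) : R.H ≤ (R.torus hn hM).range := by
  rw [H, Subgroup.closure_le]
  rintro _ ⟨r, t, ht, rfl⟩
  have hpos : ∀ (i : Fin n) (t : ℝ), t ≠ 0 → R.h (.long i) t ∈ (R.torus hn hM).range :=
    fun i t ht => ⟨Pi.mulSingle i (Units.mk0 t ht), torus_mulSingle hn hM i _⟩
  have hlong : ∀ (a : Fin n ⊕ Fin n) (r : Root n), r.vec = wt a - wt a.swap → ∀ t : ℝ, t ≠ 0 →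
      R.h r t ∈ (R.torus hn hM).range := by
    rintro (i | i) r hr t ht
    · obtain rfl : r = .long i := Root.vec_injective (hr.trans (Root.vec_eq (.long i)).symm)
      exact hpos i t ht
    · obtain rfl : r = .negLong i := Root.vec_injective (hr.trans (Root.vec_eq (.negLong i)).symm)
      rw [h_refl hn hM (r := .long i) (p := .long i) (by rw [refl_self]; rfl) ht]
      exact mul_mem (hpos i t ht) (hpos i _ (zpow_ne_zero _ ht))
  by_cases hs : r.snd = r.fst.swap
  · exact hlong r.fst r (by rw [r.vec_eq, hs]) t ht
  · obtain ⟨p, hp⟩ := Root.exists_vec_eq (swap_ne_self r.snd).symm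
    obtain ⟨q, hq⟩ := Root.exists_vec_eq (swap_ne_self r.fst).symm
    have hr := r.vec_eq
    -- For `r = a - b` the reflection in `r` carries `2b` to `2a`, which gives `h_{2a}(t) =
    -- h_{2b}(t) h_r(t)`.
    have e := h_refl hn hM (r := p) (p := r) (q := q) (t := t)
      (by rw [hq, hp, refl_sub, wt_swap, wt_swap, refl_neg, refl_wt_of_sub' hr]) ht
    have k : r.vec ⬝ᵥ p.co = -1 := by
      have h1 := (dot_co_of_wt_sub hp.symm).1
      have h2 := p.norm_mul_dot_co (wt r.fst)
      have h3 : wt r.fst ⬝ᵥ wt r.snd = 0 :=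
        wt_dot_eq_zero r.fst_ne_snd (fun h => hs (by rw [h]; simp))
      rw [hp, wt_sub_norm, if_neg (swap_ne_self r.snd).symm, if_pos (by simp), wt_swap,
        dotProduct_sub, dotProduct_neg, h3] at h2
      rw [hr, sub_dotProduct, h1]
      omega
    rw [k, neg_neg, zpow_one] at e
    rw [← inv_mul_eq_iff_eq_mul.2 e]
    exact mul_mem (inv_mem (hlong _ p hp t ht)) (hlong _ q hq t ht)

/-- The diagonal torus of `Sp(2n, ℝ)`. -/
noncomputable def _root_.SpPresentation.diagTorus (n : ℕ) :
    (Fin n → ℝˣ) →* Matrix (Fin n ⊕ Fin n) (Fin n ⊕ Fin n) ℝ where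
  toFun f := Matrix.diagonal (Sum.elim (fun i => (f i : ℝ)) fun i => (f i : ℝ)⁻¹)
  map_one' := by
    rw [← Matrix.diagonal_one]; congr 1; ext (i | i) <;> simp
  map_mul' f g := by
    rw [Matrix.diagonal_mul_diagonal]; congr 1; ext (i | i) <;> simp [mul_comm]

theorem coe_π_torus (hn : 2 ≤ n) (hM : ∀ r, R.Mult r) (f : Fin n → ℝˣ) :
    (R.π (R.torus hn hM f) : Matrix (Fin n ⊕ Fin n) (Fin n ⊕ Fin n) ℝ) = diagTorus n f := by
  have key : (Submonoid.subtype _).comp (R.π.comp (R.torus hn hM)) = diagTorus n := by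
    refine MonoidHom.pi_ext fun i t => ?_
    simp only [MonoidHom.comp_apply, torus_mulSingle, R.π_h, Submonoid.subtype_apply]
    rw [coe_hElt_spX _ t.ne_zero]
    simp only [diagTorus, MonoidHom.coe_mk, OneHom.coe_mk]
    congr 1
    ext (j | j) <;> by_cases h : j = i
    · subst h; simp [wt, Root.co]
    · simp [wt, Root.co, h]
    · subst h; simp [wt, Root.co]
    · simp [wt, Root.co, h]
  exact DFunLike.congr_fun key f

/-- The torus parametrization followed by `π` is the diagonal torus, whose entries determine the
parameters. -/
theorem eq_one_of_mem_H (hn : 2 ≤ n) (hM : ∀ r, R.Mult r) {z : G} (hz : z ∈ R.H)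
    (h1 : R.π z = 1) : z = 1 := by
  obtain ⟨f, rfl⟩ := H_le_range_torus hn hM hz
  have h := coe_π_torus hn hM f
  rw [h1] at h
  have hf : f = 1 := by
    funext i
    have := congrFun (congrFun h (.inl i)) (.inl i)
    simp [diagTorus] at this
    exact Units.ext this.symm
  rw [hf, map_one]

end Torus

section Monomial

variable (R) in
/-- The subgroup generated by the `w_r(t)`. -/
def N : Subgroup G := Subgroup.closure {g | ∃ r t, t ≠ 0 ∧ g = R.w r t}

theorem w_mem_N (r : Root n) {t : ℝ} (ht : t ≠ 0) : R.w r t ∈ R.N :=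
  Subgroup.subset_closure ⟨r, t, ht, rfl⟩

@[elab_as_elim]
theorem N_induction {P : (g : G) → g ∈ R.N → Prop} (one : P 1 (one_mem _))
    (mul : ∀ r t (ht : t ≠ 0) g hg, P g hg → P (R.w r t * g) (mul_mem (w_mem_N r ht) hg)) {g : G}
    (hg : g ∈ R.N) : P g hg := by
  induction hg using Subgroup.closure_induction_left with
  | one => exact one
  | mul_left y hy g hg hP =>
    obtain ⟨r, t, ht, rfl⟩ := hy
    exact mul r t ht g hg hP
  | inv_mul_cancel y hy g hg hP =>
    obtain ⟨r, t, ht, rfl⟩ := hy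
    have := mul r (-t) (neg_ne_zero.2 ht) g hg hP
    simpa only [R.w_neg] using this

theorem exists_actsBy_of_mem_N (hn : 2 ≤ n) {g : G} (hg : g ∈ R.N) (p : Root n) :
    ∃ q η, R.ActsBy g p q η := by
  induction hg using N_induction with
  | one => exact ⟨p, 1, R.actsBy_one p⟩
  | mul r t ht g _ ih =>
    obtain ⟨q, η, h⟩ := ih
    obtain ⟨q', hq'⟩ := exists_refl_vec r q
    obtain ⟨η', h'⟩ := exists_actsBy_w (R := R) hn hq' ht
    exact ⟨q', _, h'.mul h⟩

theorem N_conj_mem_H (hn : 2 ≤ n) {g z : G} (hg : g ∈ R.N) (hz : z ∈ R.H) :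
    g * z * g⁻¹ ∈ R.H := by
  induction hz using Subgroup.closure_induction with
  | mem z hz =>
    obtain ⟨r, t, ht, rfl⟩ := hz
    obtain ⟨q, η, h⟩ := exists_actsBy_of_mem_N hn hg r
    rw [h.h_conj]
    exact mul_mem (h_mem_H q (mul_ne_zero h.1 ht)) (inv_mem (h_mem_H q h.1))
  | one => simp
  | mul x y _ _ hx hy =>
    have : g * (x * y) * g⁻¹ = (g * x * g⁻¹) * (g * y * g⁻¹) := by group
    rw [this]; exact mul_mem hx hy
  | inv x _ hx =>
    have : g * x⁻¹ * g⁻¹ = (g * x * g⁻¹)⁻¹ := by group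
    rw [this]; exact inv_mem hx

/-- Elements of `N` map to monomial matrices. -/
theorem exists_column_of_mem_N {g : G} (hg : g ∈ R.N) (b : Fin n ⊕ Fin n) :
    ∃ c, ∀ a, (R.π g : Matrix (Fin n ⊕ Fin n) (Fin n ⊕ Fin n) ℝ) a b ≠ 0 → a = c := by
  induction hg using N_induction with
  | one =>
    refine ⟨b, fun a h => ?_⟩
    by_contra hab
    simp [hab] at h
  | mul r t ht g _ ih =>
    obtain ⟨c, hc⟩ := ih
    obtain ⟨d, hd⟩ := exists_refl_wt r c
    refine ⟨d, fun a h => ?_⟩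
    rw [map_mul, Submonoid.coe_mul, Matrix.mul_apply] at h
    obtain ⟨x, -, hx⟩ := Finset.exists_ne_zero_of_sum_ne_zero h
    have h1 := hc x (right_ne_zero_of_mul hx)
    have h2 := left_ne_zero_of_mul hx
    rw [R.π_w] at h2
    have h3 := wt_eq_refl_of_wElt_ne_zero r ht h2
    rw [h1, ← hd] at h3
    exact wt_injective h3

/-- Elements of the tail Weyl group fix the coordinate line. -/
theorem column_of_mem_closure_tail {k : ℕ} (hk : k < n) {m : G}
    (hm : m ∈ Subgroup.closure ((fun r => R.w r 1) '' tailRoots n (k + 1))) {a : Fin n ⊕ Fin n}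
    (h : (R.π m : Matrix (Fin n ⊕ Fin n) (Fin n ⊕ Fin n) ℝ) a (.inl ⟨k, hk⟩) ≠ 0) :
    a = .inl ⟨k, hk⟩ := by
  have step : ∀ r ∈ tailRoots n (k + 1), ∀ t : ℝ, t ≠ 0 → ∀ m : G,
      (∀ a, (R.π m : Matrix (Fin n ⊕ Fin n) (Fin n ⊕ Fin n) ℝ) a (.inl ⟨k, hk⟩) ≠ 0 →
        a = .inl ⟨k, hk⟩) →
      ∀ a, (R.π (R.w r t * m) : Matrix (Fin n ⊕ Fin n) (Fin n ⊕ Fin n) ℝ) a (.inl ⟨k, hk⟩) ≠ 0 →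
        a = .inl ⟨k, hk⟩ := by
    intro r hr t ht m hm a h
    rw [map_mul, Submonoid.coe_mul, Matrix.mul_apply] at h
    obtain ⟨x, -, hx⟩ := Finset.exists_ne_zero_of_sum_ne_zero h
    have h1 := hm x (right_ne_zero_of_mul hx)
    have h2 := left_ne_zero_of_mul hx
    rw [R.π_w, h1] at h2
    have h3 := wt_eq_refl_of_wElt_ne_zero r ht h2
    rw [refl_eq_self] at h3
    · exact wt_injective h3
    · have := hr ⟨k, hk⟩ (Nat.lt_succ_self k)
      rw [dotProduct_comm]
      simp [wt, this]
  revert a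
  induction hm using Subgroup.closure_induction_left with
  | one =>
    intro a h
    by_contra hab
    simp [hab] at h
  | mul_left y hy g _ ih =>
    obtain ⟨r, hr, rfl⟩ := hy
    intro a h
    exact step r hr 1 one_ne_zero g (fun a h => ih h) a h
  | inv_mul_cancel y hy g _ ih =>
    obtain ⟨r, hr, rfl⟩ := hy
    intro a h
    beta_reduce at h
    rw [← R.w_neg] at h
    exact step r hr (-1) (by norm_num) g (fun a h => ih h) a h

theorem coe_π_apply_of_mem_H {z : G} (hz : z ∈ R.H) {a b : Fin n ⊕ Fin n} (hab : a ≠ b) :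
    (R.π z : Matrix (Fin n ⊕ Fin n) (Fin n ⊕ Fin n) ℝ) a b = 0 := by
  have key : ∃ d, (R.π z : Matrix (Fin n ⊕ Fin n) (Fin n ⊕ Fin n) ℝ) = Matrix.diagonal d := by
    clear hab
    induction hz using Subgroup.closure_induction_left with
    | one => exact ⟨1, by simp⟩
    | mul_left y hy g _ ih =>
      obtain ⟨r, t, ht, rfl⟩ := hy
      obtain ⟨d, hd⟩ := ih
      rw [map_mul, Submonoid.coe_mul, hd, R.π_h, coe_hElt_spX r ht]
      exact ⟨_, Matrix.diagonal_mul_diagonal _ _⟩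
    | inv_mul_cancel y hy g _ ih =>
      obtain ⟨r, t, ht, rfl⟩ := hy
      obtain ⟨d, hd⟩ := ih
      set A := (R.π ((R.h r t)⁻¹ * g) : Matrix (Fin n ⊕ Fin n) (Fin n ⊕ Fin n) ℝ) with hA
      have h1 : Matrix.diagonal (fun a => t ^ (wt a ⬝ᵥ r.co)) * A = Matrix.diagonal d := by
        rw [← coe_hElt_spX r ht, ← R.π_h, hA, ← Submonoid.coe_mul, ← map_mul,
          mul_inv_cancel_left, hd]
      have h2 : Matrix.diagonal (fun a => (t ^ (wt a ⬝ᵥ r.co))⁻¹) *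
          Matrix.diagonal (fun a : Fin n ⊕ Fin n => t ^ (wt a ⬝ᵥ r.co)) = 1 := by
        rw [Matrix.diagonal_mul_diagonal, ← Matrix.diagonal_one]
        congr 1
        funext a
        exact inv_mul_cancel₀ (zpow_ne_zero _ ht)
      exact ⟨_, by rw [← Matrix.one_mul A, ← h2, Matrix.mul_assoc, h1,
        Matrix.diagonal_mul_diagonal]⟩
  obtain ⟨d, hd⟩ := key
  rw [hd, Matrix.diagonal_apply_ne _ hab]

/-- The kernel of `π` on `N` is contained in `H`. -/
theorem mem_H_of_mem_N (hn : 2 ≤ n) {g : G} (hg : g ∈ R.N) (h1 : R.π g = 1) : g ∈ R.H := by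
  have hnormal : (R.H.subgroupOf R.N).Normal := ⟨fun z hz m => by
    rw [Subgroup.mem_subgroupOf] at hz ⊢
    exact N_conj_mem_H hn m.2 hz⟩
  set mk := QuotientGroup.mk' (R.H.subgroupOf R.N) with hmk
  set s : Root n → R.N ⧸ (R.H.subgroupOf R.N) := fun r => mk ⟨R.w r 1, w_mem_N r one_ne_zero⟩
    with hs
  have mk_one : ∀ z : R.N, mk z = 1 ↔ (z : G) ∈ R.H := fun z => by
    rw [hmk, QuotientGroup.mk'_apply, QuotientGroup.eq_one_iff, Subgroup.mem_subgroupOf]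
  -- Modulo `H` the class of `w_r(t)` does not depend on `t`, because `w_r(t) w_r(1)⁻¹ = h_r(t)`.
  -- The classes therefore satisfy the relations of the reflections.
  have mk_w : ∀ r t (ht : t ≠ 0), mk ⟨R.w r t, w_mem_N r ht⟩ = s r := by
    intro r t ht
    rw [← mul_inv_eq_one, hs, ← map_inv, ← map_mul, mk_one]
    change R.w r t * (R.w r 1)⁻¹ ∈ R.H
    rw [← R.h_eq]
    exact h_mem_H r ht
  have hconj' : ∀ p r q : Root n, q.vec = refl p r.vec → s p * s r * (s p)⁻¹ = s q := by
    intro p r q hq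
    obtain ⟨η, h⟩ := exists_actsBy_w (R := R) hn hq one_ne_zero
    have h2 := h.w_conj 1
    rw [mul_one] at h2
    rw [← mk_w q η h.1, hs]
    simp only [← map_mul, ← map_inv]
    congr 1
    exact Subtype.ext h2
  have hsq : ∀ r, s r * s r = 1 := by
    intro r
    have h2 := mk_w r (-1) (by norm_num)
    have h3 : (⟨R.w r (-1), w_mem_N r (by norm_num)⟩ : R.N) =
        (⟨R.w r 1, w_mem_N r one_ne_zero⟩ : R.N)⁻¹ := Subtype.ext (R.w_neg r 1)
    rw [h3, map_inv] at h2
    conv_lhs => arg 1; rw [← h2]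
    exact inv_mul_cancel _
  have hneg : ∀ r p : Root n, p.vec = r.vec ∨ p.vec = -r.vec → s p = s r := by
    rintro r p (h | h)
    · rw [Root.vec_injective h]
    · rw [← hconj' r r p (by rw [refl_self, h]), mul_inv_cancel_right]
  have hconj : ∀ p r q : Root n, q.vec = refl p r.vec → s p * s r = s q * s p := by
    intro p r q hq
    rw [← hconj' p r q hq, inv_mul_cancel_right]
  have hstart : mk ⟨g, hg⟩ ∈ Subgroup.closure (s '' tailRoots n 0) := by
    clear h1
    induction hg using N_induction with
    | one =>
      have : mk ⟨1, one_mem R.N⟩ = 1 := map_one mk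
      rw [this]; exact one_mem _
    | mul r t ht g hg ih =>
      have : (⟨R.w r t * g, mul_mem (w_mem_N r ht) hg⟩ : R.N) =
        ⟨R.w r t, w_mem_N r ht⟩ * ⟨g, hg⟩ := rfl
      rw [this, map_mul, mk_w r t ht]
      exact mul_mem (Subgroup.subset_closure ⟨r, fun i hi => absurd hi (Nat.not_lt_zero _), rfl⟩) ih
  have lift : ∀ (k : ℕ), ∀ q ∈ Subgroup.closure (s '' tailRoots n k), ∃ (m : G) (hm : m ∈ R.N),
      mk ⟨m, hm⟩ = q ∧ m ∈ Subgroup.closure ((fun r => R.w r 1) '' tailRoots n k) := by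
    intro k q hq
    induction hq using Subgroup.closure_induction with
    | mem q hq =>
      obtain ⟨r, hr, rfl⟩ := hq
      exact ⟨_, w_mem_N r one_ne_zero, rfl, Subgroup.subset_closure ⟨r, hr, rfl⟩⟩
    | one => exact ⟨1, one_mem _, map_one mk, one_mem _⟩
    | mul x y _ _ hx hy =>
      obtain ⟨m, hm, e, hm'⟩ := hx
      obtain ⟨l, hl, e', hl'⟩ := hy
      refine ⟨m * l, mul_mem hm hl, ?_, mul_mem hm' hl'⟩
      rw [← e, ← e', ← map_mul]; rfl
    | inv x _ hx =>
      obtain ⟨m, hm, e, hm'⟩ := hx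
      refine ⟨m⁻¹, inv_mem hm, ?_, inv_mem hm'⟩
      rw [← e, ← map_inv]; rfl
  have chain : ∀ k, k ≤ n → mk ⟨g, hg⟩ ∈ Subgroup.closure (s '' tailRoots n k) := by
    intro k
    induction k with
    | zero => exact fun _ => hstart
    | succ k ih =>
      intro hk
      rcases mem_closure_tailRoots_succ s hsq hneg hconj hk (ih (by omega)) with
        h | ⟨c, r, hc, hr, hrv, q, hq, e⟩
      · exact h
      · exfalso
        obtain ⟨m, hm, rfl, hm'⟩ := lift _ q hq
        have hz : (R.w r (-1) * g)⁻¹ * m ∈ R.H := by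
          have : mk (((⟨R.w r (-1), w_mem_N r (by norm_num)⟩ : R.N) * ⟨g, hg⟩)⁻¹ * ⟨m, hm⟩) = 1 := by
            rw [map_mul, map_inv, map_mul, mk_w r (-1) (by norm_num), e, ← mul_assoc, hsq, one_mul, inv_mul_cancel]
          exact (mk_one _).1 this
        have hw : R.π (R.w r (-1)) = R.π m * (R.π ((R.w r (-1) * g)⁻¹ * m))⁻¹ := by
          rw [map_mul, map_inv, map_mul, h1, mul_one]; group
        rw [← map_inv, ← map_mul] at hw
        rw [← inv_mem_iff] at hz
        generalize ((R.w r (-1) * g)⁻¹ * m)⁻¹ = z at hz hw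
        -- Column `k` of `w_r(-1)` is supported in row `c`, but `w_r(-1)` also equals `m` times a
        -- diagonal matrix, and `m` preserves the `k`-th coordinate line. As `c` is a different
        -- index, the column would vanish, against invertibility.
        have hcol : ∀ a, (R.π (R.w r (-1)) : Matrix (Fin n ⊕ Fin n) (Fin n ⊕ Fin n) ℝ) a
            (.inl ⟨k, hk⟩) = 0 := by
          intro a
          by_contra h0
          have h2 := h0
          rw [R.π_w] at h2
          have h3 := wt_eq_refl_of_wElt_ne_zero r (by norm_num) h2
          rw [refl_wt_of_sub hrv] at h3
          rw [hw, map_mul, Submonoid.coe_mul, Matrix.mul_apply] at h0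
          obtain ⟨x, -, hx⟩ := Finset.exists_ne_zero_of_sum_ne_zero h0
          have h4 : x = .inl ⟨k, hk⟩ := by
            by_contra hne
            exact right_ne_zero_of_mul hx (coe_π_apply_of_mem_H hz hne)
          have h5 := left_ne_zero_of_mul hx
          rw [h4] at h5
          have h6 := column_of_mem_closure_tail hk hm' h5
          rw [h6] at h3
          exact hc (wt_injective h3).symm
        have hinv : ((R.π (R.w r (-1)))⁻¹ * R.π (R.w r (-1)) : Sp n) = 1 := inv_mul_cancel _
        have h7 := congrFun (congrFun (congrArg (fun A : Sp n =>
          (A : Matrix (Fin n ⊕ Fin n) (Fin n ⊕ Fin n) ℝ)) hinv) (.inl ⟨k, hk⟩)) (.inl ⟨k, hk⟩)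
        simp only [Submonoid.coe_mul, Matrix.mul_apply, hcol, mul_zero, Finset.sum_const_zero,
          Submonoid.coe_one, Matrix.one_apply_eq] at h7
        exact zero_ne_one h7
  have hend := chain n le_rfl
  have hempty : tailRoots n n = ∅ := by
    ext r
    simp only [tailRoots, Set.mem_ofPred_eq, Set.mem_empty_iff_false, iff_false]
    exact fun h => r.vec_ne_zero (funext fun i => h i i.2)
  rw [hempty, Set.image_empty, Subgroup.closure_empty, Subgroup.mem_bot, mk_one] at hend
  exact hend

end Monomial

end Realization

/-! ### Heights and simple reflections -/

section Height

variable {n : ℕ}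

/-- A regular functional, which takes the value `2` exactly on the simple roots. -/
def height (n : ℕ) : (Fin n → ℤ) →+ ℤ := dotHom fun i => 2 * ((n : ℤ) - (i : ℕ)) - 1

theorem height_inl (i : Fin n) : height n (wt (.inl i)) = 2 * ((n : ℤ) - (i : ℕ)) - 1 := by
  simp [height, wt]

theorem height_inr (i : Fin n) : height n (wt (.inr i)) = -(2 * ((n : ℤ) - (i : ℕ)) - 1) := by
  simp [height, wt]

theorem height_odd (a : Fin n ⊕ Fin n) : height n (wt a) % 2 = 1 := by
  rcases a with i | i
  · rw [height_inl]; omega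
  · rw [height_inr]; omega

theorem height_injective {a b : Fin n ⊕ Fin n} (h : height n (wt a) = height n (wt b)) : a = b := by
  rcases a with i | i <;> rcases b with j | j <;> have hi := i.2 <;> have hj := j.2 <;>
    simp only [height_inl, height_inr] at h
  · exact congrArg Sum.inl (Fin.ext (by omega))
  · omega
  · omega
  · exact congrArg Sum.inr (Fin.ext (by omega))

/-- The heights of the weights are the odd numbers from `-(2n - 1)` to `2n - 1`, so each weight but
the highest has one exactly 2 above it. -/
theorem exists_height_succ {a b : Fin n ⊕ Fin n} (h : height n (wt b) < height n (wt a)) :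
    ∃ c, height n (wt c) = height n (wt b) + 2 := by
  have ha : height n (wt a) ≤ 2 * n - 1 := by
    rcases a with i | i <;> have hi := i.2
    · rw [height_inl]; omega
    · rw [height_inr]; omega
  rcases b with i | i <;> have hi := i.2
  · rw [height_inl] at *
    refine ⟨.inl ⟨i - 1, by omega⟩, ?_⟩
    rw [height_inl]; push_cast; omega
  · rw [height_inr] at *
    by_cases hlast : (i : ℕ) + 1 = n
    · exact ⟨.inl i, by rw [height_inl]; omega⟩
    · refine ⟨.inr ⟨i + 1, by omega⟩, ?_⟩
      rw [height_inr]; push_cast; omega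

theorem height_vec_ne_zero (r : Root n) : height n r.vec ≠ 0 := by
  intro h
  rw [r.vec_eq, map_sub, sub_eq_zero] at h
  exact r.fst_ne_snd (height_injective h)

/-- The reflection in a simple root permutes the other positive roots. -/
theorem height_refl_pos {α r q : Root n} (hα : height n α.vec = 2) (hr : 0 < height n r.vec)
    (hne : r ≠ α) (hq : q.vec = refl α r.vec) : 0 < height n q.vec := by
  have hdiff : ∀ {x y : Fin n ⊕ Fin n}, wt x - wt y = α.vec →
      height n (wt x) = height n (wt y) + 2 := by
    intro x y h
    have := congrArg (height n) h
    rw [map_sub, hα] at this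
    omega
  have hmove : ∀ a : Fin n ⊕ Fin n, height n (refl α (wt a)) = height n (wt a) ∨
      (∃ x, wt a - wt x = α.vec ∧ refl α (wt a) = wt x ∧
        height n (refl α (wt a)) = height n (wt a) - 2) ∨
      height n (refl α (wt a)) = height n (wt a) + 2 := by
    intro a
    rcases dot_co_trichotomy α a with h | ⟨x, hx⟩ | ⟨x, hx⟩
    · left; simp [refl, h]
    · right; left
      have h1 := refl_wt_of_sub hx.symm
      have := hdiff hx
      exact ⟨x, hx, h1, by rw [h1]; omega⟩
    · right; right
      have := hdiff hx
      rw [refl_wt_of_sub' hx.symm]; omega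
  have hr' := hr
  rw [r.vec_eq, map_sub] at hr'
  rw [hq, r.vec_eq, refl_sub, map_sub]
  have oa := height_odd r.fst
  have ob := height_odd r.snd
  by_contra hneg
  have h0 : height n q.vec ≠ 0 := height_vec_ne_zero q
  rw [hq, r.vec_eq, refl_sub, map_sub] at h0
  -- A simple reflection moves the height of each end by at most 2. The even positive difference can
  -- turn negative only if it was 2 and the two ends change places, which means `r = α`.
  rcases hmove r.fst with h1 | ⟨x, hx, hx', h1⟩ | h1
  · rcases hmove r.snd with h2 | ⟨y, -, -, h2⟩ | h2 <;> omega
  · have hxb : height n (wt x) = height n (wt r.snd) := by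
      rw [hx'] at h1 h0 hneg
      rcases hmove r.snd with h2 | ⟨y, -, -, h2⟩ | h2 <;> omega
    rw [height_injective hxb, ← r.vec_eq] at hx
    exact hne (Root.vec_injective hx)
  · rcases hmove r.snd with h2 | ⟨y, -, -, h2⟩ | h2 <;> omega

/-- A positive root which is not simple is lowered by some simple reflection. -/
theorem exists_height_refl_lt {r : Root n} (hr : 0 < height n r.vec) (h2 : height n r.vec ≠ 2) :
    ∃ α q : Root n, height n α.vec = 2 ∧ q.vec = refl α r.vec ∧
      height n q.vec < height n r.vec := by
  -- Of the two presentations of `r`, this one guarantees that raising `b` to the next weight by a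
  -- simple reflection does not also raise `a`.
  obtain ⟨a, b, hab, hsum⟩ : ∃ a b : Fin n ⊕ Fin n, r.vec = wt a - wt b ∧
      0 ≤ height n (wt a) + height n (wt b) := by
    rcases le_total 0 (height n (wt r.fst) + height n (wt r.snd)) with h | h
    · exact ⟨r.fst, r.snd, r.vec_eq, h⟩
    · refine ⟨r.snd.swap, r.fst.swap, by rw [r.vec_eq]; simp; abel, ?_⟩
      rw [wt_swap, wt_swap, map_neg, map_neg]; omega
  rw [hab, map_sub] at hr h2
  obtain ⟨c, hc⟩ := exists_height_succ (a := a) (b := b) (by omega)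
  obtain ⟨α, hα⟩ : ∃ α : Root n, α.vec = wt c - wt b :=
    Root.exists_vec_eq (by rintro rfl; omega)
  obtain ⟨q, hq⟩ := exists_refl_vec α r
  have hα2 : height n α.vec = 2 := by rw [hα, map_sub]; omega
  refine ⟨α, q, hα2, hq, ?_⟩
  rw [hq, hab, refl_sub, refl_wt_of_sub' hα, map_sub, map_sub]
  rcases dot_co_trichotomy α a with h | ⟨x, hx⟩ | ⟨x, hx⟩
  · have : refl α (wt a) = wt a := by simp [refl, h]
    rw [this]; omega
  · rw [refl_wt_of_sub hx.symm]
    have := congrArg (height n) hx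
    rw [map_sub] at this
    omega
  · exfalso
    rw [hα] at hx
    have hcb : c ≠ b := by rintro rfl; omega
    rcases wt_sub_eq hx.symm hcb with ⟨-, h⟩ | ⟨h, -⟩
    · rw [h] at hr; omega
    · rw [h, wt_swap, map_neg] at hc
      omega

end Height

/-! ### Bruhat decomposition and injectivity -/

namespace Realization

variable {n : ℕ} {G : Type*} [Group G] {R : Realization n G}

variable (R) in
/-- The unipotent subgroup. -/
def U : Subgroup G := R.span {r | 0 < height n r.vec}

variable (R) in
/-- The double coset space `U N U`. -/
def UNU : Set G := {g | ∃ u ∈ R.U, ∃ m ∈ R.N, ∃ u' ∈ R.U, g = u * m * u'}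

theorem x_mem_U {r : Root n} (hr : 0 < height n r.vec) (t : ℝ) : R.x r t ∈ R.U :=
  R.x_mem_span hr t

theorem mul_mem_UNU {u g : G} (hu : u ∈ R.U) (hg : g ∈ R.UNU) : u * g ∈ R.UNU := by
  obtain ⟨v, hv, m, hm, v', hv', rfl⟩ := hg
  exact ⟨u * v, mul_mem hu hv, m, hm, v', hv', by group⟩

theorem x_neg_eq {r : Root n} (t : ℝ) :
    R.x r.neg t = R.x r t⁻¹ * R.w r (-t⁻¹) * R.x r t⁻¹ := by
  simp only [w, wElt, R.x_neg, inv_neg, neg_neg, inv_inv]; group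

theorem w_mul_mem_UNU (hn : 2 ≤ n) {α : Root n} (hα : height n α.vec = 2) {s : ℝ} (hs : s ≠ 0)
    {g : G} (hg : g ∈ R.UNU) : R.w α s * g ∈ R.UNU := by
  obtain ⟨u, hu, m, hm, u', hu', rfl⟩ := hg
  have hαpos : 0 < height n α.vec := by omega
  set S : Set (Root n) := {r | 0 < height n r.vec ∧ r ≠ α} with hS
  have hnorm : ∀ t v, v ∈ R.span S → R.x α t * v * (R.x α t)⁻¹ ∈ R.span S := by
    intro t v hv
    refine R.x_conj_mem_span (fun q hq h => ?_) (fun q hq q' i j hi hj h => ?_) t hv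
    · have := congrArg (height n) h
      rw [map_add, map_zero] at this
      have := hq.1
      omega
    · have hq := hq.1
      have hi' : (1 : ℤ) ≤ i := by exact_mod_cast hi
      have hj' : (1 : ℤ) ≤ j := by exact_mod_cast hj
      have h1 : 2 < height n q'.vec := by
        rw [map_combo _ h, hα]; nlinarith
      exact ⟨by omega, by rintro rfl; omega⟩
  obtain ⟨v, hv, t, rfl⟩ := R.exists_eq_mul_x (S := S) (r := α) (fun q hq => by
    by_cases h : q = α
    · exact Or.inl h
    · exact Or.inr ⟨hq, h⟩) hnorm hu
  have hv' : R.w α s * v * (R.w α s)⁻¹ ∈ R.U := by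
    refine R.conj_mem_span _ (fun q hq t => ?_) hv
    obtain ⟨q', hq'⟩ := exists_refl_vec α q
    obtain ⟨η, h⟩ := exists_actsBy_w (R := R) hn hq' hs
    rw [h.2.1]
    exact R.x_mem_span (height_refl_pos hα hq.1 hq.2 hq') _
  have e : R.w α s * (v * R.x α t * m * u') =
      (R.w α s * v * (R.w α s)⁻¹) * (R.w α s * R.x α t * m * u') := by group
  rw [e]
  apply mul_mem_UNU hv'
  have hwN := w_mem_N (R := R) α hs
  obtain ⟨q, η, hact⟩ := exists_actsBy_of_mem_N hn (inv_mem hm) α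
  -- The factor `x_α(t)` is to be moved right through `m`. If `m⁻¹` keeps `α` positive it lands in
  -- `U`. If not, `w x_α(t) w⁻¹` is an `x_{-α}`, expanded by `x_neg_eq`; its trailing `x_α`, pulled
  -- through both `w` and `m`, lands in `U`.
  rcases lt_or_gt_of_ne (height_vec_ne_zero q) with hq | hq
  · by_cases ht : t = 0
    · subst ht
      exact ⟨1, one_mem _, R.w α s * m, mul_mem hwN hm, u', hu', by rw [R.x_zero]; group⟩
    · obtain ⟨η', h'⟩ := exists_actsBy_w (R := R) hn (r := α) (p := α) (q := α.neg)
        (by rw [refl_self, α.vec_neg]) hs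
      have e1 := h'.2.1 t
      have e2 := (h'.inv.neg).2.1
      have hη' : η' * t ≠ 0 := mul_ne_zero h'.1 ht
      have hqn : 0 < height n q.neg.vec := by rw [q.vec_neg, map_neg]; omega
      rw [Root.neg_neg] at e2
      have e3 : R.w α s * R.x α t * m * u' =
          R.x α (η' * t)⁻¹ * (R.w α (-(η' * t)⁻¹) * R.w α s * m) *
            (m⁻¹ * ((R.w α s)⁻¹ * R.x α (η' * t)⁻¹ * (R.w α s)⁻¹⁻¹) * m⁻¹⁻¹ * u') := by
        have : R.w α s * R.x α t * m * u' =
          (R.w α s * R.x α t * (R.w α s)⁻¹) * R.w α s * m * u' := by group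
        rw [this, e1, x_neg_eq]; group
      rw [e3, e2, hact.2.2]
      exact ⟨_, x_mem_U hαpos _, _, mul_mem (mul_mem (w_mem_N α (neg_ne_zero.2 (inv_ne_zero hη')))
        hwN) hm, _, mul_mem (x_mem_U hqn _) hu', rfl⟩
  · refine ⟨1, one_mem _, R.w α s * m, mul_mem hwN hm, R.x q (η * t) * u',
      mul_mem (x_mem_U hq _) hu', ?_⟩
    rw [← hact.2.1]; group

/-- A negative root element is handled by induction on the height of the opposite root: simple
reflections lower it to a simple root, where `x_{-α}` is a product of `x_α`, `w_α` and `x_α`. -/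
theorem x_mul_mem_UNU (hn : 2 ≤ n) (r : Root n) (t : ℝ) {g : G} (hg : g ∈ R.UNU) :
    R.x r t * g ∈ R.UNU := by
  have key : ∀ (k : ℕ) (r : Root n), 0 < height n r.vec → height n r.vec ≤ k → ∀ (t : ℝ) (g : G),
      g ∈ R.UNU → R.x r.neg t * g ∈ R.UNU := by
    intro k
    induction k with
    | zero => intro r h1 h2; push_cast at h2; omega
    | succ k ih =>
      intro r h1 h2 t g hg
      by_cases hs : height n r.vec = 2
      · by_cases ht : t = 0
        · rw [ht, R.x_zero, one_mul]; exact hg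
        · rw [x_neg_eq, mul_assoc, mul_assoc]
          exact mul_mem_UNU (x_mem_U h1 _) (w_mul_mem_UNU hn hs
            (neg_ne_zero.2 (inv_ne_zero ht)) (mul_mem_UNU (x_mem_U h1 _) hg))
      · obtain ⟨α, q, hα, hq, hlt⟩ := exists_height_refl_lt h1 hs
        have hqpos := height_refl_pos hα h1 (by rintro rfl; exact hs hα) hq
        obtain ⟨η, h⟩ := exists_actsBy_w (R := R) hn hq one_ne_zero
        have h3 := h.inv.neg.2.1 (η⁻¹⁻¹⁻¹ * t)
        rw [mul_inv_cancel_left₀ (inv_ne_zero (inv_ne_zero h.1))] at h3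
        simp only [inv_inv] at h3
        rw [← h3, ← R.w_neg, mul_assoc, mul_assoc]
        refine w_mul_mem_UNU hn hα (neg_ne_zero.2 one_ne_zero) (ih q hqpos (by push_cast at h2; omega) _ _
          (w_mul_mem_UNU hn hα one_ne_zero hg))
  rcases lt_or_gt_of_ne (height_vec_ne_zero r) with hr | hr
  · have h1 : 0 < height n r.neg.vec := by rw [r.vec_neg, map_neg]; omega
    have := key (height n r.neg.vec).toNat r.neg h1 (by omega) t g hg
    rwa [Root.neg_neg] at this
  · exact mul_mem_UNU (x_mem_U hr t) hg

/-- The Bruhat decomposition. -/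
theorem mem_UNU (hn : 2 ≤ n) (g : G) : g ∈ R.UNU := by
  have hg : g ∈ Subgroup.closure {g | ∃ r t, g = R.x r t} := by
    rw [R.generates]; exact Subgroup.mem_top g
  induction hg using Subgroup.closure_induction_left with
  | one => exact ⟨1, one_mem _, 1, one_mem _, 1, one_mem _, by simp⟩
  | mul_left y hy g _ ih =>
    obtain ⟨r, t, rfl⟩ := hy
    exact x_mul_mem_UNU hn r t ih
  | inv_mul_cancel y hy g _ ih =>
    obtain ⟨r, t, rfl⟩ := hy
    rw [← R.x_neg]
    exact x_mul_mem_UNU hn r (-t) ih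

/-- If all `h_r` are multiplicative, then the projection to `Sp(2n, ℝ)` is injective. -/
theorem π_injective_of_mult (hn : 2 ≤ n) (hM : ∀ r, R.Mult r) : Function.Injective R.π := by
  rw [injective_iff_map_eq_one]
  intro g h1
  obtain ⟨u, hu, m, hm, u', hu', rfl⟩ := mem_UNU hn g (R := R)
  have hinj := fun v (hv : v ∈ R.U) => R.eq_one_of_mem_span (height n) (fun r hr => hr)
    (isClosedRoots_pos _) hv
  have hm1 : R.π m = R.π (u⁻¹ * u'⁻¹) := by
    rw [map_mul, map_mul] at h1
    calc R.π m = (R.π u)⁻¹ * (R.π u * R.π m * R.π u') * (R.π u')⁻¹ := by group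
      _ = _ := by rw [h1, mul_one, map_mul, map_inv, map_inv]
  -- In `Sp n` the factor `m` equals a product of elements of `U`, so its diagonal consists of ones.
  -- A monomial matrix with this diagonal is the identity.
  have hdiag : ∀ b, (R.π m : Matrix (Fin n ⊕ Fin n) (Fin n ⊕ Fin n) ℝ) b b = 1 := by
    intro b
    by_contra hb
    have h2 : ((R.π (u⁻¹ * u'⁻¹) : Matrix (Fin n ⊕ Fin n) (Fin n ⊕ Fin n) ℝ) - 1) b b ≠ 0 := by
      rw [← hm1, Matrix.sub_apply, Matrix.one_apply_eq]
      exact sub_ne_zero.2 hb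
    obtain ⟨q, -, hq⟩ := R.exists_root_of_mem_span (height n) (fun r hr => hr)
      (isClosedRoots_pos _) (mul_mem (inv_mem hu) (inv_mem hu')) h2
    exact q.vec_ne_zero (by rw [hq, sub_self])
  have hm2 : R.π m = 1 := by
    apply spX_ext
    ext a b
    rw [Submonoid.coe_one]
    by_cases hab : a = b
    · rw [hab, hdiag, Matrix.one_apply_eq]
    · rw [Matrix.one_apply_ne hab]
      by_contra h0
      obtain ⟨c, hc⟩ := exists_column_of_mem_N hm b
      exact hab ((hc a h0).trans (hc b (by rw [hdiag]; exact one_ne_zero)).symm)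
  have hm3 : m = 1 := eq_one_of_mem_H hn hM (mem_H_of_mem_N hn hm hm2) hm2
  rw [hm3, mul_one] at h1 ⊢
  exact hinj _ (mul_mem hu hu') h1

end Realization

/-! ### Generation of the symplectic group by elimination -/

section Generation

variable {n : ℕ}

/-- The column `b` of `A` is the `b`-th basis vector. -/
def IsStdCol (A : Sp n) (b : Fin n ⊕ Fin n) : Prop :=
  ∀ a, (A : Matrix (Fin n ⊕ Fin n) (Fin n ⊕ Fin n) ℝ) a b = if a = b then 1 else 0

/-- Column `b` paired under the form with every column gives row `b.swap`, by `Aᵀ J A = J`. -/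
theorem IsStdCol.row {A : Sp n} {b : Fin n ⊕ Fin n} (h : IsStdCol A b) (c : Fin n ⊕ Fin n) :
    (A : Matrix (Fin n ⊕ Fin n) (Fin n ⊕ Fin n) ℝ) b.swap c = if b.swap = c then 1 else 0 := by
  have h1 := congrFun (congrFun (SymplecticGroup.mem_iff'.1 A.2) b) c
  have h2 : ∀ y, ((A : Matrix (Fin n ⊕ Fin n) (Fin n ⊕ Fin n) ℝ).transpose * Matrix.J (Fin n) ℝ) b y
      = Matrix.J (Fin n) ℝ b y := by
    intro y
    simp [Matrix.mul_apply, h _]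
  rw [Matrix.mul_apply] at h1
  simp only [h2] at h1
  rcases b with i | i <;> rcases c with j | j <;>
    simpa [Matrix.J, Matrix.one_apply, Fintype.sum_sum_type] using h1

theorem coe_spX_mul_apply {r : Root n} {x y : Fin n ⊕ Fin n} (hr : r.vec = wt x - wt y) (t : ℝ)
    (A : Sp n) (c : Fin n ⊕ Fin n) :
    ((spX r t * A : Sp n) : Matrix (Fin n ⊕ Fin n) (Fin n ⊕ Fin n) ℝ) x c =
      (A : Matrix (Fin n ⊕ Fin n) (Fin n ⊕ Fin n) ℝ) x c +
        t * (r.mat x y * (A : Matrix (Fin n ⊕ Fin n) (Fin n ⊕ Fin n) ℝ) y c) := by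
  rw [Submonoid.coe_mul, coe_spX, add_mul, one_mul, Matrix.add_apply, Matrix.smul_mul,
    Matrix.smul_apply, (hasWeight_mat r).mul_apply _ hr.symm, smul_eq_mul]

theorem coe_spX_mul_apply_of_ne {r : Root n} {x y : Fin n ⊕ Fin n} (hr : r.vec = wt x - wt y)
    (hxy : x ≠ y) (t : ℝ) (A : Sp n) {a : Fin n ⊕ Fin n} (hx : a ≠ x) (hy : a ≠ y.swap)
    (c : Fin n ⊕ Fin n) :
    ((spX r t * A : Sp n) : Matrix (Fin n ⊕ Fin n) (Fin n ⊕ Fin n) ℝ) a c =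
      (A : Matrix (Fin n ⊕ Fin n) (Fin n ⊕ Fin n) ℝ) a c := by
  have h0 : ∀ d, r.mat a d = 0 := by
    intro d
    by_contra h
    have h1 := (r.mat_ne_zero_iff a d).1 h
    rw [hr] at h1
    rcases wt_sub_eq h1.symm hxy with ⟨h2, -⟩ | ⟨-, h2⟩
    · exact hx h2.symm
    · exact hy (by rw [h2]; simp)
  rw [Submonoid.coe_mul, coe_spX, add_mul, one_mul, Matrix.add_apply, Matrix.smul_mul,
    Matrix.smul_apply, Matrix.mul_apply]
  simp [h0]

theorem IsStdCol.spX_mul {A : Sp n} {b : Fin n ⊕ Fin n} (h : IsStdCol A b) {r : Root n}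
    {x y : Fin n ⊕ Fin n} (hr : r.vec = wt x - wt y) (hxy : x ≠ y) (hy : b ≠ y) (hx : b ≠ x.swap)
    (t : ℝ) : IsStdCol (spX r t * A) b := by
  intro a
  have h0 : r.mat a b = 0 := by
    by_contra h
    have h1 := (r.mat_ne_zero_iff a b).1 h
    rw [hr] at h1
    rcases wt_sub_eq h1.symm hxy with ⟨-, h2⟩ | ⟨h2, -⟩
    · exact hy h2.symm
    · exact hx (by rw [h2]; simp)
  rw [Submonoid.coe_mul, coe_spX, add_mul, one_mul, Matrix.add_apply, Matrix.smul_mul,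
    Matrix.smul_apply, Matrix.mul_apply, h a]
  simp [h _, h0]

/-- The subgroup of `Sp(2n, ℝ)` generated by the root elements. -/
def elemSubgroup (n : ℕ) : Subgroup (Sp n) := Subgroup.closure {g | ∃ r t, g = spX r t}

theorem spX_mem_elemSubgroup (r : Root n) (t : ℝ) : spX r t ∈ elemSubgroup n :=
  Subgroup.subset_closure ⟨r, t, rfl⟩

/-- Clearing the column of a pivot entry. -/
theorem exists_clear_column {P : Set (Fin n ⊕ Fin n)} {A : Sp n} {c : Fin n ⊕ Fin n} (hc : c ∉ P)
    (hP : ∀ b ∈ P, IsStdCol A b)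
    (h1 : (A : Matrix (Fin n ⊕ Fin n) (Fin n ⊕ Fin n) ℝ) c c = 1) :
    ∃ g ∈ elemSubgroup n, ∀ b ∈ insert c P, IsStdCol (g * A) b := by
  -- Left multiplication by `x_{a - c}` changes only rows `a` and `c.swap`. Row `c.swap` is
  -- therefore cleared last, by a long root element that touches no other row.
  have kill : ∀ T : Finset (Fin n ⊕ Fin n), c ∉ T → c.swap ∉ T →
      ∃ g ∈ elemSubgroup n, (∀ b ∈ P, IsStdCol (g * A) b) ∧
        ((g * A : Sp n) : Matrix (Fin n ⊕ Fin n) (Fin n ⊕ Fin n) ℝ) c c = 1 ∧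
        ∀ a ∈ T, ((g * A : Sp n) : Matrix (Fin n ⊕ Fin n) (Fin n ⊕ Fin n) ℝ) a c = 0 := by
    intro T
    induction T using Finset.induction_on with
    | empty => exact fun _ _ => ⟨1, one_mem _, by simpa using hP, by simpa using h1, by simp⟩
    | insert a T haT ih =>
      intro hcT hcT'
      rw [Finset.mem_insert, not_or] at hcT hcT'
      obtain ⟨g, hg, hgP, hg1, hgT⟩ := ih hcT.2 hcT'.2
      by_cases h0 : ((g * A : Sp n) : Matrix (Fin n ⊕ Fin n) (Fin n ⊕ Fin n) ℝ) a c = 0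
      · refine ⟨g, hg, hgP, hg1, fun d hd => ?_⟩
        rcases Finset.mem_insert.1 hd with rfl | hd
        · exact h0
        · exact hgT d hd
      · obtain ⟨r, hr⟩ := Root.exists_vec_eq (Ne.symm hcT.1)
        have hf := (r.mat_ne_zero_iff a c).2 hr.symm
        refine ⟨spX r (-(((g * A : Sp n) : Matrix (Fin n ⊕ Fin n) (Fin n ⊕ Fin n) ℝ) a c /
          r.mat a c)) * g, mul_mem (spX_mem_elemSubgroup _ _) hg, fun b hb => ?_, ?_, fun d hd => ?_⟩
        · rw [mul_assoc]
          refine (hgP b hb).spX_mul hr (Ne.symm hcT.1) (by rintro rfl; exact hc hb) ?_ _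
          rintro rfl
          have := (hgP _ hb).row c
          rw [Sum.swap_swap, if_neg (Ne.symm hcT.1)] at this
          exact h0 this
        · rw [mul_assoc, coe_spX_mul_apply_of_ne hr (Ne.symm hcT.1) _ _ hcT.1
            (swap_ne_self c).symm, hg1]
        · rw [mul_assoc]
          rcases Finset.mem_insert.1 hd with rfl | hd'
          · rw [coe_spX_mul_apply hr, hg1]
            field_simp
            ring
          · rw [coe_spX_mul_apply_of_ne hr (Ne.symm hcT.1), hgT d hd']
            · rintro rfl; exact haT hd'
            · rintro rfl; exact hcT'.2 hd'
  obtain ⟨g, hg, hgP, hg1, hgT⟩ := kill (Finset.univ.filter fun a => a ≠ c ∧ a ≠ c.swap)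
    (by simp) (by simp)
  obtain ⟨r, hr⟩ := Root.exists_vec_eq (swap_ne_self c)
  have hf := (r.mat_ne_zero_iff _ _).2 hr.symm
  refine ⟨spX r (-(((g * A : Sp n) : Matrix (Fin n ⊕ Fin n) (Fin n ⊕ Fin n) ℝ) c.swap c /
          r.mat c.swap c)) * g, mul_mem (spX_mem_elemSubgroup _ _) hg, fun b hb => ?_⟩
  rw [mul_assoc]
  rcases hb with rfl | hb
  · intro a
    by_cases ha : a = b.swap
    · subst ha
      rw [coe_spX_mul_apply hr, hg1, if_neg (swap_ne_self b)]
      field_simp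
      ring
    · rw [coe_spX_mul_apply_of_ne hr (swap_ne_self b) _ _ ha ha]
      split_ifs with hab
      · rw [hab, hg1]
      · exact hgT a (by simp [hab, ha])
  · have hbc : b ≠ c := by rintro rfl; exact hc hb
    exact (hgP b hb).spX_mul hr (swap_ne_self c) hbc (by simpa using hbc) _

/-- Producing a pivot entry. -/
theorem exists_pivot {P : Set (Fin n ⊕ Fin n)} {A : Sp n} {e : Fin n ⊕ Fin n} (he : e ∉ P)
    (hswap : ∀ b ∈ P, b.swap ∈ P) (hP : ∀ b ∈ P, IsStdCol A b) :
    ∃ g ∈ elemSubgroup n, (∀ b ∈ P, IsStdCol (g * A) b) ∧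
      ((g * A : Sp n) : Matrix (Fin n ⊕ Fin n) (Fin n ⊕ Fin n) ℝ) e e = 1 := by
  have he' : e.swap ∉ P := fun h => he (by simpa using hswap _ h)
  have step : ∀ A : Sp n, (∀ b ∈ P, IsStdCol A b) → ∀ a, a ≠ e →
      (A : Matrix (Fin n ⊕ Fin n) (Fin n ⊕ Fin n) ℝ) a e ≠ 0 →
      ∃ g ∈ elemSubgroup n, (∀ b ∈ P, IsStdCol (g * A) b) ∧
      ((g * A : Sp n) : Matrix (Fin n ⊕ Fin n) (Fin n ⊕ Fin n) ℝ) e e = 1 := by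
    intro A hP a hae ha
    obtain ⟨r, hr⟩ := Root.exists_vec_eq hae.symm
    have hf := (r.mat_ne_zero_iff _ _).2 hr.symm
    refine ⟨spX r ((1 - (A : Matrix (Fin n ⊕ Fin n) (Fin n ⊕ Fin n) ℝ) e e) / (r.mat e a *
      (A : Matrix (Fin n ⊕ Fin n) (Fin n ⊕ Fin n) ℝ) a e)), spX_mem_elemSubgroup _ _,
      fun b hb => (hP b hb).spX_mul hr hae.symm ?_ ?_ _, ?_⟩
    · rintro rfl
      have := (hP _ (hswap _ hb)).row e
      rw [Sum.swap_swap, if_neg hae] at this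
      exact ha this
    · rintro rfl; exact he' hb
    · rw [coe_spX_mul_apply hr]
      field_simp
      ring
  by_cases h : ∃ a, a ≠ e ∧ (A : Matrix (Fin n ⊕ Fin n) (Fin n ⊕ Fin n) ℝ) a e ≠ 0
  · obtain ⟨a, ha, ha'⟩ := h
    exact step A hP a ha ha'
  · push Not at h
    have hee : (A : Matrix (Fin n ⊕ Fin n) (Fin n ⊕ Fin n) ℝ) e e ≠ 0 := by
      intro h0
      have hinv : (A⁻¹ * A : Sp n) = 1 := inv_mul_cancel _
      have h7 := congrFun (congrFun (congrArg (fun A : Sp n =>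
        (A : Matrix (Fin n ⊕ Fin n) (Fin n ⊕ Fin n) ℝ)) hinv) e) e
      have hcol : ∀ a, (A : Matrix (Fin n ⊕ Fin n) (Fin n ⊕ Fin n) ℝ) a e = 0 := by
        intro a
        by_cases ha : a = e
        · rw [ha, h0]
        · exact h a ha
      simp only [Submonoid.coe_mul, Matrix.mul_apply, hcol, mul_zero, Finset.sum_const_zero,
        Submonoid.coe_one, Matrix.one_apply_eq] at h7
      exact zero_ne_one h7
    -- When the only nonzero entry of the column is on the diagonal, a long root element first
    -- creates a second one, which then corrects the diagonal entry to 1.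
    obtain ⟨r, hr⟩ := Root.exists_vec_eq (swap_ne_self e)
    have hf := (r.mat_ne_zero_iff _ _).2 hr.symm
    have hP' : ∀ b ∈ P, IsStdCol (spX r 1 * A) b := fun b hb => by
      have hbe : b ≠ e := by rintro rfl; exact he hb
      exact (hP b hb).spX_mul hr (swap_ne_self e) hbe (by simpa using hbe) _
    obtain ⟨g, hg, h1, h2⟩ := step (spX r 1 * A) hP' e.swap (swap_ne_self e) (by
      rw [coe_spX_mul_apply hr, h _ (swap_ne_self e), zero_add, one_mul]
      exact mul_ne_zero hf hee)
    exact ⟨g * spX r 1, mul_mem hg (spX_mem_elemSubgroup _ _),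
      fun b hb => by rw [mul_assoc]; exact h1 b hb, by rw [mul_assoc]; exact h2⟩

/-- `Sp(2n, ℝ)` is generated by the root elements. -/
theorem elemSubgroup_eq_top (n : ℕ) : elemSubgroup n = ⊤ := by
  rw [eq_top_iff]
  intro A _
  have key : ∀ I : Finset (Fin n), ∃ g ∈ elemSubgroup n,
      ∀ i ∈ I, IsStdCol (g * A) (.inl i) ∧ IsStdCol (g * A) (.inr i) := by
    intro I
    induction I using Finset.induction_on with
    | empty => exact ⟨1, one_mem _, by simp⟩
    | insert k I hk ih =>
      obtain ⟨g, hg, hI⟩ := ih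
      set P : Set (Fin n ⊕ Fin n) := {b | Sum.elim id id b ∈ I} with hPdef
      have hP : ∀ b ∈ P, IsStdCol (g * A) b := by
        rintro (i | i) hi
        · exact (hI i hi).1
        · exact (hI i hi).2
      obtain ⟨g', hg', hP', h1⟩ := exists_pivot (P := P) (e := .inl k) hk
        (by rintro (i | i) hi <;> exact hi) hP
      obtain ⟨g'', hg'', hP''⟩ := exists_clear_column (P := P) hk hP' h1
      -- Once column `.inl k` is standard, so is row `.inr k`. This supplies the pivot 1 for column
      -- `.inr k`.
      have hrow := (hP'' (.inl k) (Set.mem_insert _ _)).row (.inr k)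
      obtain ⟨l, hl, hlP⟩ := exists_clear_column (P := insert (.inl k) P) (c := .inr k)
        (by rintro (h | h)
            · simp at h
            · exact hk h) hP'' (by simpa using hrow)
      refine ⟨l * g'' * g' * g, mul_mem (mul_mem (mul_mem hl hg'') hg') hg, fun i hi => ?_⟩
      have e : l * g'' * g' * g * A = l * (g'' * (g' * (g * A))) := by group
      rw [e]
      rcases Finset.mem_insert.1 hi with rfl | hi
      · exact ⟨hlP _ (by simp), hlP _ (by simp)⟩
      · exact ⟨hlP _ (Or.inr (Or.inr hi)), hlP _ (Or.inr (Or.inr hi))⟩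
  obtain ⟨g, hg, h⟩ := key Finset.univ
  have h1 : g * A = 1 := by
    apply spX_ext
    ext a b
    rw [Submonoid.coe_one, Matrix.one_apply]
    rcases b with i | i
    · exact (h i (Finset.mem_univ i)).1 a
    · exact (h i (Finset.mem_univ i)).2 a
  rw [← inv_eq_of_mul_eq_one_right h1]
  exact inv_mem hg

end Generation

/-! ### Transport of words and verification of the relations -/

section Words

variable {n : ℕ} {G K : Type*} [Group G] [Group K] (ψ : G →* K) (x : Root n → ℝ → G)

theorem map_hElt (r : Root n) (t : ℝ) : ψ (hElt x r t) = hElt (fun r t => ψ (x r t)) r t := by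
  simp [hElt, wElt]

theorem map_factor (r p : Root n) (i j : ℕ) (s : ℝ) :
    ψ (factor x r p i j s) = factor (fun r t => ψ (x r t)) r p i j s := by
  unfold factor
  split_ifs <;> simp

theorem map_chevalleyProd (c : ℕ → ℕ → Root n → Root n → ℝ) (r p : Root n) (a b : ℝ) :
    ψ (chevalleyProd x c r p a b) = chevalleyProd (fun r t => ψ (x r t)) c r p a b := by
  simp only [chevalleyProd_eq, map_mul, map_factor]

end Words

section Relations

variable {n : ℕ}

theorem hElt_spX_mul (r : Root n) {s t : ℝ} (hs : s ≠ 0) (ht : t ≠ 0) :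
    hElt spX r s * hElt spX r t = hElt spX r (s * t) := by
  apply spX_ext
  rw [Submonoid.coe_mul, coe_hElt_spX r hs, coe_hElt_spX r ht, coe_hElt_spX r (mul_ne_zero hs ht),
    Matrix.diagonal_mul_diagonal]
  simp only [mul_zpow]

theorem hElt_spX_one (r : Root n) : hElt spX r 1 = 1 := by
  apply spX_ext
  rw [coe_hElt_spX r one_ne_zero]
  simp

theorem hElt_spX_neg_one_mul_self (r : Root n) : hElt spX r (-1) * hElt spX r (-1) = 1 := by
  rw [hElt_spX_mul r (by norm_num) (by norm_num)]
  simp [hElt_spX_one]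

theorem map_basicRelator {c : ℕ → ℕ → Root n → Root n → ℝ} (hc : IsStructureConstants n c)
    (ψ : FreeGroup (Root n × ℝ) →* Sp n) (hψ : ∀ r t, ψ (freeX r t) = spX r t)
    {g : FreeGroup (Root n × ℝ)} (hg : BasicRelator c g) : ψ g = 1 := by
  have hψ' : (fun r t => ψ (freeX r t)) = (spX : Root n → ℝ → Sp n) := by
    funext r t; exact hψ r t
  have hcomm : ∀ r p : Root n, ∀ a b, ψ ⁅freeX r a, freeX p b⁆ = ⁅(spX r a : Sp n), spX p b⁆ := by
    intro r p a b
    simp only [commutatorElement_def, map_mul, map_inv, hψ]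
  cases hg with
  | additive r a b _ _ => simp only [map_mul, map_inv, hψ, spX_add, mul_inv_cancel]
  | commutator r p hrp a b _ _ =>
    rw [map_mul, map_inv, hcomm, hc r p hrp, map_chevalleyProd, hψ', mul_inv_cancel]
  | commute r p hrp hroot a b _ _ =>
    have h0 : r.mat * p.mat - p.mat * r.mat = 0 := by
      have hw := ((hasWeight_mat r).mul (hasWeight_mat p)).sub
        (by rw [add_comm]; exact (hasWeight_mat p).mul (hasWeight_mat r))
      ext a b
      by_contra h
      have h1 := hw a b h
      obtain ⟨q, hq⟩ := Root.exists_vec_eq (a := a) (b := b)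
        (by rintro rfl; exact hrp (by rw [← h1, sub_self]))
      exact hroot ⟨q, hq.trans h1⟩
    have h1 : r.mat * p.mat = p.mat * r.mat := sub_eq_zero.1 h0
    have h2 : r.mat * p.mat * r.mat = 0 := by rw [h1, Matrix.mul_assoc, r.mat_sq, Matrix.mul_zero]
    have h3 : p.mat * r.mat * p.mat = 0 := by
      rw [← h1, Matrix.mul_assoc, p.mat_sq, Matrix.mul_zero]
    rw [hcomm]
    apply spX_ext
    rw [coe_commutator r p hrp, Submonoid.coe_one, h0, h2, h3]
    simp

end Relations

/-! ### Realizations from relations -/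

namespace Realization

variable {n : ℕ} {G : Type*} [Group G]

/-- The relators assume both parameters nonzero, so this needs an argument: `x(1) = x(2) x(-1) =
x(1) x(1) x(-1) = x(1) x(0)`. -/
theorem x_zero_of_additive {x : Root n → ℝ → G}
    (hadd : ∀ r a b, a ≠ 0 → b ≠ 0 → x r (a + b) = x r a * x r b) (r : Root n) : x r 0 = 1 := by
  have h1 := hadd r 1 1 one_ne_zero one_ne_zero
  have h2 := hadd r (1 + 1) (-1) (by norm_num) (by norm_num)
  have h3 := hadd r 1 (-1) one_ne_zero (by norm_num)
  rw [h1, mul_assoc, ← h3, add_neg_cancel_right] at h2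
  rw [add_neg_cancel] at h2
  exact mul_eq_left.1 h2.symm

/-- A realization from the relations between nontrivial root elements. -/
def ofRelations {c : ℕ → ℕ → Root n → Root n → ℝ} (x : Root n → ℝ → G) (π : G →* Sp n)
    (hπ : ∀ r t, π (x r t) = spX r t)
    (hadd : ∀ r a b, a ≠ 0 → b ≠ 0 → x r (a + b) = x r a * x r b)
    (hcomm : ∀ r p : Root n, r.vec + p.vec ≠ 0 → ∀ a b : ℝ, a ≠ 0 → b ≠ 0 →
      ⁅x r a, x p b⁆ = chevalleyProd x c r p a b)
    (hgen : Subgroup.closure {g | ∃ r t, g = x r t} = ⊤) : Realization n G where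
  x := x
  π := π
  π_x := hπ
  x_add r s t := by
    by_cases hs : s = 0
    · rw [hs, zero_add, x_zero_of_additive hadd, one_mul]
    by_cases ht : t = 0
    · rw [ht, add_zero, x_zero_of_additive hadd, mul_one]
    exact hadd r s t hs ht
  comm_mem r p hrp a b := by
    by_cases ha : a = 0
    · rw [ha, x_zero_of_additive hadd, commutatorElement_one_left]; exact one_mem _
    by_cases hb : b = 0
    · rw [hb, x_zero_of_additive hadd, commutatorElement_one_right]; exact one_mem _
    have hf : ∀ (i j : ℕ) (s : ℝ), 0 < i → 0 < j → factor x r p i j s ∈ Subgroup.closure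
        {g | ∃ q : Root n, (∃ i j : ℕ, 0 < i ∧ 0 < j ∧
          q.vec = (i : ℤ) • r.vec + (j : ℤ) • p.vec) ∧ ∃ t, g = x q t} := by
      intro i j s hi hj
      by_cases h : ∃ q : Root n, q.vec = (i : ℤ) • r.vec + (j : ℤ) • p.vec
      · obtain ⟨q, hq⟩ := h
        rw [factor_eq x hq]
        exact Subgroup.subset_closure ⟨q, ⟨i, j, hi, hj, hq⟩, s, rfl⟩
      · rw [factor, dif_neg h]; exact one_mem _
    rw [hcomm r p hrp a b ha hb, chevalleyProd_eq]
    exact mul_mem (hf _ _ _ (by norm_num) (by norm_num)) (mul_mem (hf _ _ _ (by norm_num)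
      (by norm_num)) (hf _ _ _ (by norm_num) (by norm_num)))
  generates := hgen

variable (R : Realization n G)

theorem π_surjective : Function.Surjective R.π := by
  rw [← MonoidHom.range_eq_top, eq_top_iff, ← elemSubgroup_eq_top, elemSubgroup, Subgroup.closure_le]
  rintro _ ⟨r, t, rfl⟩
  exact ⟨R.x r t, R.π_x r t⟩

theorem mult_of_generators (hn : 2 ≤ n) (h1 : R.Mult (shortRoot hn))
    (h2 : R.h (longRoot hn) (-1) * R.h (longRoot hn) (-1) = 1) (r : Root n) : R.Mult r := by
  have hs : (shortRoot hn).vec = wt (.inl ⟨0, by omega⟩) - wt (.inl ⟨1, by omega⟩) :=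
    Root.vec_eq (shortRoot hn)
  have hl : (longRoot hn).vec = wt (.inl ⟨n - 1, by omega⟩) - wt (Sum.inl ⟨n - 1, by omega⟩).swap :=
    Root.vec_eq (longRoot hn)
  have hshort : ∀ (p : Root n) (a b : Fin n ⊕ Fin n), b ≠ a.swap → p.vec = wt a - wt b → R.Mult p :=
    fun p a b hab hp => h1.short hn (by simp) hs hab hp
  have hne : (Sum.inl ⟨n - 1, by omega⟩ : Fin n ⊕ Fin n) ≠ Sum.inl ⟨0, by omega⟩ := by
    simp only [ne_eq, Sum.inl.injEq, Fin.mk.injEq]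
    omega
  -- The short root `L_n - L_1`, which shares its leading weight with `2L_n`, carries
  -- multiplicativity over to the long root.
  obtain ⟨p, hp⟩ := Root.exists_vec_eq hne
  have hlong : R.Mult (longRoot hn) :=
    (hshort p _ _ (by simp) hp).of_short_of_sq hn (by simp) hp hl h2
  by_cases h : r.snd = r.fst.swap
  · exact hlong.long hn hl (a := r.fst) (by rw [r.vec_eq, h])
  · exact hshort r r.fst r.snd h r.vec_eq

end Realization

/-! ### The presentation and the kernel of `π₁` -/

section MainTheorem

variable {n : ℕ}

theorem presented_additive {c : ℕ → ℕ → Root n → Root n → ℝ} {rels : Set (FreeGroup (Root n × ℝ))}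
    (h : basicRels c ⊆ rels) (r : Root n) (a b : ℝ) (ha : a ≠ 0) (hb : b ≠ 0) :
    (PresentedGroup.of (r, a + b) : PresentedGroup rels) =
      PresentedGroup.of (r, a) * PresentedGroup.of (r, b) := by
  have := PresentedGroup.one_of_mem (h (BasicRelator.additive r a b ha hb))
  rw [map_mul, map_inv, mul_inv_eq_one, map_mul] at this
  exact this.symm

theorem presented_commutator {c : ℕ → ℕ → Root n → Root n → ℝ}
    {rels : Set (FreeGroup (Root n × ℝ))} (h : basicRels c ⊆ rels) (r p : Root n)
    (hrp : r.vec + p.vec ≠ 0) (a b : ℝ) (ha : a ≠ 0) (hb : b ≠ 0) :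
    ⁅(PresentedGroup.of (r, a) : PresentedGroup rels),
        (PresentedGroup.of (p, b) : PresentedGroup rels)⁆ =
      chevalleyProd (fun r t => PresentedGroup.of (r, t)) c r p a b := by
  have := PresentedGroup.one_of_mem (h (BasicRelator.commutator r p hrp a b ha hb))
  rw [map_mul, map_inv, mul_inv_eq_one, map_chevalleyProd, commutatorElement_def, map_mul, map_mul,
    map_mul, map_inv, map_inv] at this
  exact this

theorem presented_generates (rels : Set (FreeGroup (Root n × ℝ))) :
    Subgroup.closure {g : PresentedGroup rels | ∃ r t, g = PresentedGroup.of (r, t)} = ⊤ := by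
  rw [← PresentedGroup.closure_range_of rels]
  congr 1
  ext g
  constructor
  · rintro ⟨r, t, rfl⟩; exact ⟨(r, t), rfl⟩
  · rintro ⟨⟨r, t⟩, rfl⟩; exact ⟨r, t, rfl⟩

/-- The evaluation of words in the root elements of `Sp(2n, ℝ)`. -/
noncomputable def evalSp (n : ℕ) : FreeGroup (Root n × ℝ) →* Sp n :=
  FreeGroup.lift fun p => spX p.1 p.2

theorem evalSp_freeX (r : Root n) (t : ℝ) : evalSp n (freeX r t) = spX r t :=
  FreeGroup.lift_apply_of

theorem evalSp_hElt (r : Root n) (t : ℝ) : evalSp n (hElt freeX r t) = hElt spX r t := by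
  rw [map_hElt]
  simp only [evalSp_freeX]

theorem evalSp_basicRels {c : ℕ → ℕ → Root n → Root n → ℝ} (hc : IsStructureConstants n c) :
    ∀ g ∈ basicRels c, FreeGroup.lift (fun p : Root n × ℝ => spX p.1 p.2) g = 1 :=
  fun _ hg => map_basicRelator hc (evalSp n) evalSp_freeX hg

theorem evalSp_allRels (hn : 2 ≤ n) {c : ℕ → ℕ → Root n → Root n → ℝ}
    (hc : IsStructureConstants n c) :
    ∀ g ∈ allRels hn c, FreeGroup.lift (fun p : Root n × ℝ => spX p.1 p.2) g = 1 := by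
  rintro g ((hg | ⟨a, b, ha, hb, rfl⟩) | rfl)
  · exact evalSp_basicRels hc g hg
  · change evalSp n _ = 1
    rw [map_mul, map_mul, map_inv, evalSp_hElt, evalSp_hElt, evalSp_hElt, hElt_spX_mul _ ha hb,
      mul_inv_cancel]
  · change evalSp n _ = 1
    rw [map_mul, evalSp_hElt, hElt_spX_neg_one_mul_self]

/-- The realization given by the full presentation. -/
noncomputable def presentedRealization (hn : 2 ≤ n) {c : ℕ → ℕ → Root n → Root n → ℝ}
    (hc : IsStructureConstants n c) : Realization n (PresentedGroup (allRels hn c)) :=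
  have hsub : basicRels c ⊆ allRels hn c :=
    Set.subset_union_left.trans Set.subset_union_left
  .ofRelations (c := c) (fun r t => PresentedGroup.of (r, t))
    (PresentedGroup.toGroup (evalSp_allRels hn hc)) (fun _ _ => PresentedGroup.toGroup.of _)
    (presented_additive hsub) (presented_commutator hsub) (presented_generates _)

theorem presentedRealization_injective (hn : 2 ≤ n) {c : ℕ → ℕ → Root n → Root n → ℝ}
    (hc : IsStructureConstants n c) : Function.Injective (presentedRealization hn hc).π := by
  refine Realization.π_injective_of_mult hn
    ((presentedRealization hn hc).mult_of_generators hn ?_ ?_)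
  · intro s t hs ht
    have : hElt freeX (shortRoot hn) s * hElt freeX (shortRoot hn) t *
        (hElt freeX (shortRoot hn) (s * t))⁻¹ ∈ allRels hn c := Or.inl (Or.inr ⟨s, t, hs, ht, rfl⟩)
    have h := PresentedGroup.one_of_mem this
    rw [map_mul, map_inv, mul_inv_eq_one, map_mul, map_hElt, map_hElt, map_hElt] at h
    exact h
  · have : hElt freeX (longRoot hn) (-1) * hElt freeX (longRoot hn) (-1) ∈ allRels hn c := Or.inr rfl
    have h := PresentedGroup.one_of_mem this
    rw [map_mul, map_hElt] at h
    exact h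

/-- The realization given by the basic relations. -/
noncomputable def tildeRealization {c : ℕ → ℕ → Root n → Root n → ℝ}
    (hc : IsStructureConstants n c) : Realization n (GTilde c) :=
  .ofRelations (c := c) (tildeX c) (PresentedGroup.toGroup (evalSp_basicRels hc))
    (fun _ _ => PresentedGroup.toGroup.of _) (presented_additive le_rfl)
    (presented_commutator le_rfl) (presented_generates _)

/-- The quotient of a realization by a subgroup of the kernel. -/
def Realization.quotient {G : Type*} [Group G] (R : Realization n G) (C : Subgroup G) [C.Normal]
    (hC : C ≤ R.π.ker) : Realization n (G ⧸ C) where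
  x r t := QuotientGroup.mk' C (R.x r t)
  π := QuotientGroup.lift C R.π hC
  π_x r t := R.π_x r t
  x_add r s t := by rw [R.x_add, map_mul]
  comm_mem r p h a b := by
    have h1 := Subgroup.mem_map_of_mem (QuotientGroup.mk' C) (R.comm_mem r p h a b)
    rw [MonoidHom.map_closure, map_commutatorElement] at h1
    refine Subgroup.closure_mono ?_ h1
    rintro _ ⟨_, ⟨q, hq, t, rfl⟩, rfl⟩
    exact ⟨q, hq, t, rfl⟩
  generates := by
    have h1 := congrArg (Subgroup.map (QuotientGroup.mk' C)) R.generates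
    rw [MonoidHom.map_closure, Subgroup.map_top_of_surjective _ (QuotientGroup.mk'_surjective C)] at h1
    rw [← h1]
    congr 1
    ext g
    constructor
    · rintro ⟨r, t, rfl⟩; exact ⟨_, ⟨r, t, rfl⟩, rfl⟩
    · rintro ⟨_, ⟨r, t, rfl⟩, rfl⟩; exact ⟨r, t, rfl⟩

theorem Realization.quotient_h {G : Type*} [Group G] (R : Realization n G) (C : Subgroup G)
    [C.Normal] (hC : C ≤ R.π.ker) (r : Root n) (t : ℝ) :
    (R.quotient C hC).h r t = QuotientGroup.mk' C (R.h r t) :=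
  (map_hElt (QuotientGroup.mk' C) R.x r t).symm

section Kernel

variable {G : Type*} [Group G] (R : Realization n G)

/-- The group generated by the symbols for the root `r`. -/
def Realization.symbols (r : Root n) : Subgroup G :=
  Subgroup.closure {g | ∃ s t : ℝ, s ≠ 0 ∧ t ≠ 0 ∧ g = R.h r s * R.h r t * (R.h r (s * t))⁻¹}

theorem Realization.symbol_mem_center (hn : 2 ≤ n) (r : Root n) {s t : ℝ} (hs : s ≠ 0)
    (ht : t ≠ 0) : R.h r s * R.h r t * (R.h r (s * t))⁻¹ ∈ R.π.ker ⊓ Subgroup.center G := by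
  have h1 : R.π (R.h r s * R.h r t * (R.h r (s * t))⁻¹) = 1 := by
    rw [map_mul, map_mul, map_inv, R.π_h, R.π_h, R.π_h, hElt_spX_mul r hs ht, mul_inv_cancel]
  exact ⟨h1, Realization.mem_center_of_mem_H hn
    (mul_mem (mul_mem (Realization.h_mem_H r hs) (Realization.h_mem_H r ht))
      (inv_mem (Realization.h_mem_H r (mul_ne_zero hs ht)))) h1⟩

theorem Realization.symbols_le (hn : 2 ≤ n) (r : Root n) :
    R.symbols r ≤ R.π.ker ⊓ Subgroup.center G := by
  rw [Realization.symbols, Subgroup.closure_le]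
  rintro _ ⟨s, t, hs, ht, rfl⟩
  exact R.symbol_mem_center hn r hs ht

theorem Realization.ker_inf_closure_h (hn : 2 ≤ n) (r : Root n) :
    R.π.ker ⊓ Subgroup.closure {g | ∃ t : ℝ, t ≠ 0 ∧ g = R.h r t} = R.symbols r := by
  apply le_antisymm
  · rintro g ⟨h1, hg⟩
    -- Symbols are central, so in any word in the `h_r(t)` they can be collected on the left,
    -- leaving a single `h_r(t)`.
    have key : ∃ z ∈ R.symbols r, ∃ t : ℝ, t ≠ 0 ∧ g = z * R.h r t := by
      clear h1
      induction hg using Subgroup.closure_induction_left with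
      | one => exact ⟨1, one_mem _, 1, one_ne_zero, by rw [R.h_one, mul_one]⟩
      | mul_left y hy g _ ih =>
        obtain ⟨s, hs, rfl⟩ := hy
        obtain ⟨z, hz, t, ht, rfl⟩ := ih
        have hzc := Subgroup.mem_center_iff.1 (R.symbols_le hn r hz).2 (R.h r s)
        refine ⟨z * (R.h r s * R.h r t * (R.h r (s * t))⁻¹),
          mul_mem hz (Subgroup.subset_closure ⟨s, t, hs, ht, rfl⟩), s * t, mul_ne_zero hs ht, ?_⟩
        rw [← mul_assoc, hzc]; group
      | inv_mul_cancel y hy g _ ih =>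
        obtain ⟨s, hs, rfl⟩ := hy
        obtain ⟨z, hz, t, ht, rfl⟩ := ih
        have hst : s⁻¹ * t ≠ 0 := mul_ne_zero (inv_ne_zero hs) ht
        set σ := R.h r s * R.h r (s⁻¹ * t) * (R.h r (s * (s⁻¹ * t)))⁻¹ with hσ
        have hσm : σ ∈ R.symbols r := Subgroup.subset_closure ⟨s, s⁻¹ * t, hs, hst, rfl⟩
        have hzc := Subgroup.mem_center_iff.1 (R.symbols_le hn r hz).2 (R.h r s)⁻¹
        have hσc := Subgroup.mem_center_iff.1 (R.symbols_le hn r (inv_mem hσm)).2 (R.h r s)⁻¹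
        refine ⟨z * σ⁻¹, mul_mem hz (inv_mem hσm), s⁻¹ * t, hst, ?_⟩
        have e : R.h r t = σ⁻¹ * R.h r s * R.h r (s⁻¹ * t) := by
          rw [hσ, mul_inv_cancel_left₀ hs]; group
        rw [← mul_assoc, hzc, e, mul_assoc z, mul_assoc z, ← mul_assoc (R.h r s)⁻¹,
          ← mul_assoc (R.h r s)⁻¹, hσc]
        group
    obtain ⟨z, hz, t, ht, rfl⟩ := key
    have hz1 : R.π z = 1 := (R.symbols_le hn r hz).1
    replace h1 : R.π (z * R.h r t) = 1 := h1
    rw [map_mul, hz1, one_mul, R.π_h] at h1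
    have h2 := coe_hElt_spX r ht
    rw [h1] at h2
    -- The diagonal entry at `r.fst` is `t` itself, so an element of the kernel has `t = 1` and is a
    -- product of symbols and their inverses.
    have h3 := congrFun (congrFun h2 r.fst) r.fst
    rw [Submonoid.coe_one, Matrix.one_apply_eq, Matrix.diagonal_apply_eq,
      (dot_co_of_wt_sub r.vec_eq.symm).1, zpow_one] at h3
    rw [← h3, R.h_one, mul_one]
    exact hz
  · refine le_inf ((R.symbols_le hn r).trans inf_le_left) ?_
    rw [Realization.symbols, Subgroup.closure_le]
    rintro _ ⟨s, t, hs, ht, rfl⟩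
    have hm : ∀ t : ℝ, t ≠ 0 → R.h r t ∈ Subgroup.closure {g | ∃ t : ℝ, t ≠ 0 ∧ g = R.h r t} :=
      fun t ht => Subgroup.subset_closure ⟨t, ht, rfl⟩
    exact mul_mem (mul_mem (hm s hs) (hm t ht)) (inv_mem (hm _ (mul_ne_zero hs ht)))

/-- Dividing by the central subgroup generated by the symbols and `h(-1)²` enforces exactly the two
extra relations. The quotient then maps injectively to `Sp n`, so nothing else is in the kernel. -/
theorem Realization.ker_eq (hn : 2 ≤ n) :
    (R.π.ker : Set G) = (R.symbols (shortRoot hn) : Set G) *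
      (Subgroup.zpowers (R.h (longRoot hn) (-1) * R.h (longRoot hn) (-1)) : Set G) := by
  set Z := Subgroup.zpowers (R.h (longRoot hn) (-1) * R.h (longRoot hn) (-1)) with hZ
  have hZle : Z ≤ R.π.ker ⊓ Subgroup.center G := by
    rw [hZ, Subgroup.zpowers_le]
    have h1 : R.π (R.h (longRoot hn) (-1) * R.h (longRoot hn) (-1)) = 1 := by
      rw [map_mul, R.π_h, hElt_spX_neg_one_mul_self]
    have h2 := Realization.h_mem_H (R := R) (longRoot hn) (neg_ne_zero.2 one_ne_zero)
    exact ⟨h1, Realization.mem_center_of_mem_H hn (mul_mem h2 h2) h1⟩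
  have hnormal : ∀ C : Subgroup G, C ≤ Subgroup.center G → C.Normal := fun C hC =>
    ⟨fun z hz g => by
      rw [Subgroup.mem_center_iff.1 (hC hz) g, mul_inv_cancel_right]; exact hz⟩
  have hZn := hnormal Z (hZle.trans inf_le_right)
  rw [← Subgroup.mul_normal]
  set C := R.symbols (shortRoot hn) ⊔ Z with hCdef
  have hC : C ≤ R.π.ker ⊓ Subgroup.center G := sup_le (R.symbols_le hn _) hZle
  have hCn := hnormal C (hC.trans inf_le_right)
  have hCk := hC.trans inf_le_left
  apply Set.Subset.antisymm _ hCk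
  have hinj : Function.Injective (R.quotient C hCk).π := by
    refine Realization.π_injective_of_mult hn ((R.quotient C hCk).mult_of_generators hn ?_ ?_)
    · intro s t hs ht
      rw [R.quotient_h, R.quotient_h, R.quotient_h, ← mul_inv_eq_one, ← map_mul, ← map_inv,
        ← map_mul, QuotientGroup.mk'_apply, QuotientGroup.eq_one_iff]
      exact Subgroup.mem_sup_left (Subgroup.subset_closure ⟨s, t, hs, ht, rfl⟩)
    · rw [R.quotient_h, ← map_mul, QuotientGroup.mk'_apply, QuotientGroup.eq_one_iff]
      exact Subgroup.mem_sup_right (Subgroup.mem_zpowers _)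
  intro g hg
  have h1 : (R.quotient C hCk).π (QuotientGroup.mk' C g) = 1 := hg
  have h2 := (injective_iff_map_eq_one _).1 hinj _ h1
  rwa [QuotientGroup.mk'_apply, QuotientGroup.eq_one_iff] at h2

end Kernel

end MainTheorem

end SpPresentation

theorem theorem3 (n : ℕ) (hn : 2 ≤ n) :
    (∃ c, SpPresentation.IsStructureConstants n c) ∧
    ∀ c, SpPresentation.IsStructureConstants n c →
      (∃ e : PresentedGroup (SpPresentation.allRels hn c) ≃* SpPresentation.Sp n,
        ∀ (r : SpPresentation.Root n) (a : ℝ),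
          e (PresentedGroup.of (r, a)) = SpPresentation.spX r a) ∧
      (∃ π : SpPresentation.GTilde c →* SpPresentation.Sp n,
        (∀ (r : SpPresentation.Root n) (a : ℝ),
          π (SpPresentation.tildeX c r a) = SpPresentation.spX r a) ∧
        (π.ker : Set (SpPresentation.GTilde c)) =
          ((π.ker ⊓ SpPresentation.HTilde c (SpPresentation.shortRoot hn) :
              Subgroup (SpPresentation.GTilde c)) : Set (SpPresentation.GTilde c))
            * (SpPresentation.HTilde0 hn c : Set (SpPresentation.GTilde c)) ∧
        π.ker ⊓ SpPresentation.HTilde c (SpPresentation.shortRoot hn) =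
          Subgroup.closure
            {g | ∃ s t : ℝ, s ≠ 0 ∧ t ≠ 0 ∧ g = SpPresentation.symbol hn c s t}) := by
  refine ⟨SpPresentation.exists_isStructureConstants n, fun c hc => ⟨?_, ?_⟩⟩
  · set R := SpPresentation.presentedRealization hn hc
    exact ⟨MulEquiv.ofBijective R.π
      ⟨SpPresentation.presentedRealization_injective hn hc, R.π_surjective⟩, R.π_x⟩
  · set R := SpPresentation.tildeRealization hc
    have h1 : R.π.ker ⊓ SpPresentation.HTilde c (SpPresentation.shortRoot hn) =
        R.symbols (SpPresentation.shortRoot hn) := R.ker_inf_closure_h hn _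
    refine ⟨R.π, R.π_x, ?_, h1⟩
    rw [h1]
    exact R.ker_eq hn
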